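/- **Setting.** Fix a finite family $\mathscr A$ of free algebras; each $\mathbb A\in\mathscr A$ is a finite set of constructors $c$ with arities $\mathcal R(c)\in\mathbb N$, constructor sets of different algebras being disjoint. $\mathscr E_{\mathbb A}$ is the set of free algebra terms over $\mathbb A$. *Terms* (up to renaming of bound variables) are $M::=x\mid c\mid MM\mid\lambda x.M\mid M\{\!\{M_1,\dots,M_n\}\!\}\mid M\langle\!\langle M_1,\dots,M_n\rangle\!\rangle$ (the last two are conditional and recursion). *Values* are variables, abstractions, and terms built from constructors by application. The size is $|x|=|c|=1$, $|\lambda x.M|=|M|+1$, $|MN|=|M|+|N|$, $|M\{\!\{M_1,\dots,M_n\}\!\}|=|M\langle\!\langle M_1,\dots,M_n\rangle\!\rangle|=|M|+\sum_i|M_i|+n$; so $|t|$ is the number of constructors of $t$ if $t\in\mathscr E_{\mathbb A}$. The reduction $\leadsto$ is generated by $(\lambda x.M)V\leadsto M\{V/x\}$ for $V$ a value and, for $c=c_i$ the $i$-th constructor of $\mathbb A$, $n=\mathcal R(c)$ and $t_1,\dots,t_n\in\mathscr E_{\mathbb A}$, $(c\,t_1\cdots t_n)\{\!\{\vec M\}\!\}\leadsto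 M_i\,t_1\cdots t_n$ and $(c\,t_1\cdots t_n)\langle\!\langle\vec M\rangle\!\rangle\leadsto M_i\,t_1\cdots t_n\,(t_1\langle\!\langle\vec M\rangle\!\rangle)\cdots(t_n\langle\!\langle\vec M\rangle\!\rangle)$, and is closed under reduction in either part of an application and in the argument $L$ of $L\{\!\{\cdot\}\!\}$ and $L\langle\!\langle\cdot\rangle\!\rangle$ (not under $\lambda$, nor in branches). $\leadsto^n$ means reduction in exactly $n$ steps. *Types* are $A::=\mathbb A^n\mid A\multimap A$ ($n\in\mathbb N$ an index); $A\multimap^0B=B$, $A\multimap^{n+1}B=A\multimap(A\multimap^nB)$. Derivations $\pi:\Gamma\vdash_{\mathsf{H(A)}}M:A$ are built by the rules (contexts are finite sets of declarations of distinct variables, and contexts that are joined are disjoint): axiom $x:A\vdash x:A$; weakening, from $\Gamma\vdash M:B$ to $\Gamma,x:A\vdash M:B$; contraction *at base types $A=\mathbb A^n$ only*, from $\Gamma,x:A,y:A\vdash M:B$ to $\Gamma,z:A\vdash M\{z/x,z/y\}:B$; abstraction, from $\Gamma,x:A\vdash M:B$ to $\Gamma\vdash\lambda x.M:A\multimap B$;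 application, from $\Gamma\vdash M:A\multimap B$ and $\Delta\vdash N:A$ to $\Gamma,\Delta\vdash MN:B$; constants $\vdash c:\mathbb A^n\multimap^{\mathcal R(c)}\mathbb A^n$; conditional, from $\Delta\vdash L:\mathbb A^m$ and $\Gamma_i\vdash M_i:\mathbb A^m\multimap^{\mathcal R(c_i)}C$ for every constructor $c_i$ of $\mathbb A$, to $\Gamma_1,\dots,\Gamma_k,\Delta\vdash L\{\!\{M_1,\dots,M_k\}\!\}:C$; recursion, from $\Delta\vdash L:\mathbb A^m$ and $\Gamma_i\vdash M_i:\mathbb A^m\multimap^{\mathcal R(c_i)}C\multimap^{\mathcal R(c_i)}C$ for every $c_i$, *where all types in the $\Gamma_i$ are base types*, to $\Gamma_1,\dots,\Gamma_k,\Delta\vdash L\langle\!\langle M_1,\dots,M_k\rangle\!\rangle:C$. Derivations are assumed to be in standard form: weakening is only used immediately before an abstraction. The recursion depth $R(\pi)$ is the largest number of instances of the recursion rule on a path from the root of $\pi$ to a leaf. **Interaction graph $G_\pi$.** Its edges carry types. It has a conclusion edge and one premise edge per variable of $\Gamma$, and is built along $\pi$. An axiom is an edge that is both premise and conclusion; a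 constant is a vertex $I^c$ with the conclusion edge. A weakening adds a vertex with a new premise edge. A contraction adds a vertex $X(e,g,h)$, where $e,g$ are the former premises for $x,y$ and $h$ is the new premise. An abstraction adds $I_\multimap(e,g,h)$ with $e$ the premise for $x$, $g$ the former conclusion, and $h$ the new conclusion. An application adds $E_\multimap(e,g,h)$ with $e,g$ the conclusions for $M,N$ and $h$ the new conclusion. A conditional adds $C^N(e_0,e_1,\dots,e_k,g)$ and a recursion adds $C^R(e_0,e_1,\dots,e_k,g)$, with $e_0$ the conclusion for $L$, $e_i$ that for $M_i$, and $g$ the new conclusion. For a recursion the graphs of $M_1,\dots,M_k$ form a *box* closed by the vertex $v=C^R$, whose recursive premise is $\rho(v)=e_0$, and each premise $g'$ of these graphs is linked by a vertex $P^R(e',g')$ to a new premise edge $e'$ outside of the box. $\theta(e)$ is the $C^R$ vertex closing the innermost box that contains $e$, if there is one. **Context semantics $T(G)$.** A term context $u$ is a free algebra term with one hole. A type context is $L::=[\cdot]\mid L\multimap A\mid A\multimap L$; $[\cdot]$ is positive, $A\multimap L$ has the sign of $L$, and $L\multimap A$ the opposite sign. $L$ is a focus for $A$ if $A=L[\mathbb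 A^i]$ for some $\mathbb A,i$; $P_A$ ($N_A$) denotes an arbitrary positive (negative) focus for $A$. Trees have vertices labelled by $(t,e,U,L)$ with $t$ a free algebra term, $e$ an edge, $U$ a finite sequence of triples $(u,s,v)$ (term context, term, vertex) and $L$ a type context; $L(T)$ is the first component of the root label. $B(T,u,s)$, for $L(T)=u[s]$, is the last subtree $S$ with $L(S)=s$ met on the path which starts at the root of $T$ and is guided by $u$ (a vertex with a single child carrying the same term is followed by that child; a vertex that applies a constructor to the terms of its children is followed by the child for the argument containing the hole). $T(G)$ is the smallest set of trees closed under the following conditions, where $l\leftarrow T_1,\dots,T_n$ means that the tree with root label $l$ and immediate subtrees $T_1,\dots,T_n$ is in $T(G)$ if the $T_i$ are, and a label to the right of $\leftarrow$ stands for any tree in $T(G)$ with that root label. * $I_\multimap(e,g,h)$, with $e$ of type $A$, $g$ of type $B$: $(t,e,U,P_A)\leftarrow(t,h,U,P_A\multimap B)$; $(t,h,U,N_A\multimap B)\leftarrow(t,e,U,N_A)$; $(t,h,U,A\multimap P_B)\leftarrow(t,g,U,P_B)$; $(t,g,U,N_B)\leftarrow(t,h,U,A\multimap N_B)$. * $E_\multimap(e,g,h)$,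 with $g$ of type $A$, $h$ of type $B$: $(t,e,U,P_A\multimap B)\leftarrow(t,g,U,P_A)$; $(t,g,U,N_A)\leftarrow(t,e,U,N_A\multimap B)$; $(t,e,U,A\multimap N_B)\leftarrow(t,h,U,N_B)$; $(t,h,U,P_B)\leftarrow(t,e,U,A\multimap P_B)$. * $X(e,g,h)$: $(t,e,U,[\cdot])\leftarrow(t,h,U,[\cdot])$ and $(t,g,U,[\cdot])\leftarrow(t,h,U,[\cdot])$. * $I^c$ with edge $e$, $\mathcal R(c)=0$: $(c,e,\varepsilon,[\cdot])\leftarrow$ if $\theta(e)$ is undefined; $(c,e,(u,t,v)U,[\cdot])\leftarrow$ if $\theta(e)=v$ and some tree in $T(G)$ has root label $(u[t],\rho(v),U,[\cdot])$. * $I^c$ with edge $e$ of type $A\multimap^nA$, $n=\mathcal R(c)\ge1$: $(c\,t_1\cdots t_n,e,U,A\multimap^n[\cdot])\leftarrow T_1,\dots,T_n$, with $T_j$ having root label $(t_j,e,U,A\multimap^{j-1}([\cdot]\multimap(A\multimap^{n-j}A)))$. * $C^N(e_0,\dots,e_k,g)$ with $e_0$ of type $A$, $g$ of type $C$: let $T\in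 T(G)$ have root label $(c_it_1\cdots t_n,e_0,U,[\cdot])$. Then $(t,g,U,P_C)\leftarrow(t,e_i,U,A\multimap^nP_C)$; $(t,e_i,U,A\multimap^nN_C)\leftarrow(t,g,U,N_C)$; and, for $1\le j\le n$, $(t_j,e_i,U,A\multimap^{j-1}([\cdot]\multimap(A\multimap^{n-j}C)))\leftarrow B(T,c_it_1\cdots[\cdot]_j\cdots t_n,t_j)$, where $[\cdot]_j$ replaces $t_j$. * $v=C^R(e_0,\dots,e_k,g)$ with $e_0$ of type $A$, $g$ of type $C$: let $T\in T(G)$ have root label $(t,e_0,U,[\cdot])$. If $t=u[s]$ and $s=c_it_1\cdots t_n$, where $t_q$ has head constructor $c_j$ of arity $n'$, then with $w=u[c_it_1\cdots[\cdot]_q\cdots t_n]$ and $D_q[L]=A\multimap^n(C\multimap^{q-1}(L\multimap(C\multimap^{n-q}C)))$: $(r,e_i,(u,s,v)U,D_q[P_C])\leftarrow(r,e_j,(w,t_q,v)U,A\multimap^{n'}(C\multimap^{n'}P_C))$ and $(r,e_j,(w,t_q,v)U,A\multimap^{n'}(C\multimap^{n'}N_C))\leftarrow(r,e_i,(u,s,v)U,D_q[N_C])$.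 If $t=c_it_1\cdots t_n$, then $(r,g,U,P_C)\leftarrow(r,e_i,([\cdot],t,v)U,A\multimap^n(C\multimap^nP_C))$ and $(r,e_i,([\cdot],t,v)U,A\multimap^n(C\multimap^nN_C))\leftarrow(r,g,U,N_C)$. If $t=u[s]$, $s=c_it_1\cdots t_n$ and $1\le j\le n$, then $(t_j,e_i,(u,s,v)U,A\multimap^{j-1}([\cdot]\multimap(A\multimap^{n-j}(C\multimap^nC))))\leftarrow B(T,u[c_it_1\cdots[\cdot]_j\cdots t_n],t_j)$. * $P^R(e,g)$: if $\theta(g)=v$ and some tree in $T(G)$ has root label $(u[s],\rho(v),U,[\cdot])$, then $(t,g,(u,s,v)U,[\cdot])\leftarrow(t,e,U,[\cdot])$. **Theorem.** 1. For every $d\in\mathbb N$ there is a primitive recursive function $p_d:\mathbb N\to\mathbb N$ such that for every type derivation $\pi:\Gamma\vdash_{\mathsf{H(A)}}M:A$ and every $T\in T(G_\pi)$, $|L(T)|\le p_{R(\pi)}(|M|)$. 2. Normalization in $\mathsf{H(A)}$ is primitive-recursively bounded: for every $d\in\mathbb N$ there is a primitive recursive function $q_d:\mathbb N\to\mathbb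 N$ such that whenever $\pi:\Gamma\vdash_{\mathsf{H(A)}}M:A$ and $M\leadsto^nN$, then $n\le q_{R(\pi)}(|M|)$ and $|N|\le q_{R(\pi)}(|M|)$. 3. $\mathsf{H(A)}$ represents only primitive recursive functions: let $\mathbb U\in\mathscr A$ be the algebra of unary strings (a first constructor of arity $1$, a second one of arity $0$), with numerals $\ulcorner n\urcorner\in\mathscr E_{\mathbb U}$. If $f:\mathbb N^k\to\mathbb N$ and there is a term $M$ with $\vdash_{\mathsf{H(A)}}M:\mathbb U^{i_1}\multimap\cdots\multimap\mathbb U^{i_k}\multimap\mathbb U^j$ for some $i_1,\dots,i_k,j$ and $M\ulcorner n_1\urcorner\cdots\ulcorner n_k\urcorner\leadsto^*\ulcorner f(n_1,\dots,n_k)\urcorner$ for all $n_1,\dots,n_k$, then $f$ is primitive recursive. -/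

import Mathlib

namespace HRec

/-! ### Free algebras, types and terms -/

/-- A free algebra: finitely many constructors, each with an arity. -/
structure DataAlg where
  numCons : ℕ
  arity : Fin numCons → ℕ

/-- A finite family of free algebras. Constructors are addressed as pairs (algebra, constructor), so
the constructor sets of different members are disjoint. -/
structure Family where
  numAlg : ℕ
  alg : Fin numAlg → DataAlg

/-- (Indices of) the members of the family. -/
abbrev Family.Alg (F : Family) : Type := Fin F.numAlg

/-- The constructors of a member of the family. -/
abbrev Family.Cons (F : Family) (a : F.Alg) : Type := Fin (F.alg a).numCons

/-- The arity of a constructor. -/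
abbrev Family.ar (F : Family) {a : F.Alg} (c : F.Cons a) : ℕ := (F.alg a).arity c

/-- The word algebra of unary strings: a unary constructor followed by a constant. -/
def unaryAlg : DataAlg := ⟨2, ![1, 0]⟩

/-- Types: indexed base types and linear arrows. -/
inductive Ty (F : Family) : Type
  | base (a : F.Alg) (n : ℕ) : Ty F
  | arr (A B : Ty F) : Ty F

/-- `Ty.lin A n B` is `A ⊸ ⋯ ⊸ A ⊸ B` with `n` arguments of type `A`. -/
def Ty.lin {F : Family} (A : Ty F) : ℕ → Ty F → Ty F
  | 0, B => B
  | n + 1, B => .arr A (Ty.lin A n B)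

/-- The class of all base types, on which contraction is permitted in the system `H(A)`. -/
def baseTypes (F : Family) : Set (Ty F) := {A | ∃ a n, A = Ty.base a n}

/-- Terms up to renaming of bound variables, in locally nameless form: `fvar` are (named) variables,
`bvar` are de Bruijn indices pointing to an enclosing `lam`. -/
inductive Tm (F : Family) : Type
  | bvar (i : ℕ) : Tm F
  | fvar (x : ℕ) : Tm F
  | con (a : F.Alg) (c : F.Cons a) : Tm F
  | app (M N : Tm F) : Tm F
  | lam (M : Tm F) : Tm F
  | cond (L : Tm F) (n : ℕ) (N : Fin n → Tm F) : Tm F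
  | recu (L : Tm F) (n : ℕ) (N : Fin n → Tm F) : Tm F

namespace Tm

variable {F : Family}

/-- The size `|M|` of a term. -/
def size : Tm F → ℕ
  | bvar _ => 1
  | fvar _ => 1
  | con _ _ => 1
  | app M N => M.size + N.size
  | lam M => M.size + 1
  | cond L n N => L.size + (∑ i, (N i).size) + n
  | recu L n N => L.size + (∑ i, (N i).size) + n

/-- Renaming of free variables. -/
def rename (f : ℕ → ℕ) : Tm F → Tm F
  | bvar i => bvar i
  | fvar x => fvar (f x)
  | con a c => con a c
  | app M N => app (M.rename f) (N.rename f)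
  | lam M => lam (M.rename f)
  | cond L n N => cond (L.rename f) n (fun i => (N i).rename f)
  | recu L n N => recu (L.rename f) n (fun i => (N i).rename f)

/-- Turn the variable `x` into the index that points `k` binders up. -/
def closeAt (x : ℕ) : ℕ → Tm F → Tm F
  | _, bvar i => bvar i
  | k, fvar y => if y = x then bvar k else fvar y
  | _, con a c => con a c
  | k, app M N => app (closeAt x k M) (closeAt x k N)
  | k, lam M => lam (closeAt x (k + 1) M)
  | k, cond L n N => cond (closeAt x k L) n (fun i => closeAt x k (N i))
  | k, recu L n N => recu (closeAt x k L) n (fun i => closeAt x k (N i))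

/-- The abstraction `λx.M`. -/
def abs (x : ℕ) (M : Tm F) : Tm F := lam (closeAt x 0 M)

/-- Replace the index that points `k` binders up by the (locally closed) term `V`. -/
def openAt (V : Tm F) : ℕ → Tm F → Tm F
  | k, bvar i => if i = k then V else bvar i
  | _, fvar y => fvar y
  | _, con a c => con a c
  | k, app M N => app (openAt V k M) (openAt V k N)
  | k, lam M => lam (openAt V (k + 1) M)
  | k, cond L n N => cond (openAt V k L) n (fun i => openAt V k (N i))
  | k, recu L n N => recu (openAt V k L) n (fun i => openAt V k (N i))

/-- The iterated application `M N₁ ⋯ Nₖ`. -/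
def apps (M : Tm F) (Ns : List (Tm F)) : Tm F := Ns.foldl app M

/-- Terms built from constructors by application only. -/
inductive IsAlg : Tm F → Prop
  | con (a : F.Alg) (c : F.Cons a) : IsAlg (con a c)
  | app {M N : Tm F} : IsAlg M → IsAlg N → IsAlg (app M N)

/-- Values. -/
inductive IsValue : Tm F → Prop
  | fvar (x : ℕ) : IsValue (fvar x)
  | lam (M : Tm F) : IsValue (lam M)
  | alg {M : Tm F} : IsAlg M → IsValue M

end Tm

/-- The terms of a free algebra. -/
inductive ETerm (F : Family) (a : F.Alg) : Type
  | mk (c : F.Cons a) (args : Fin (F.ar c) → ETerm F a) : ETerm F a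

/-- The number of constructors of a free algebra term. -/
def ETerm.size {F : Family} {a : F.Alg} : ETerm F a → ℕ
  | .mk _ args => (∑ i, (args i).size) + 1

/-- Free algebra terms as terms of the calculus. -/
def ETerm.toTm {F : Family} {a : F.Alg} : ETerm F a → Tm F
  | .mk c args => Tm.apps (.con a c) (List.ofFn fun i => (args i).toTm)

/-- Weak call-by-value reduction. -/
inductive Step {F : Family} : Tm F → Tm F → Prop
  | beta (M : Tm F) {V : Tm F} : V.IsValue → Step (.app (.lam M) V) (Tm.openAt V 0 M)
  | cond {a : F.Alg} (c : F.Cons a) (ts : Fin (F.ar c) → ETerm F a) (N : F.Cons a → Tm F) :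
      Step (.cond (ETerm.mk c ts).toTm (F.alg a).numCons N)
        (Tm.apps (N c) (List.ofFn fun j => (ts j).toTm))
  | recu {a : F.Alg} (c : F.Cons a) (ts : Fin (F.ar c) → ETerm F a) (N : F.Cons a → Tm F) :
      Step (.recu (ETerm.mk c ts).toTm (F.alg a).numCons N)
        (Tm.apps (N c) ((List.ofFn fun j => (ts j).toTm) ++
          (List.ofFn fun j => Tm.recu (ts j).toTm (F.alg a).numCons N)))
  | appL {M M' : Tm F} (L : Tm F) : Step M M' → Step (.app M L) (.app M' L)
  | appR {M M' : Tm F} (L : Tm F) : Step M M' → Step (.app L M) (.app L M')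
  | condL {M M' : Tm F} (n : ℕ) (N : Fin n → Tm F) : Step M M' → Step (.cond M n N) (.cond M' n N)
  | recuL {M M' : Tm F} (n : ℕ) (N : Fin n → Tm F) : Step M M' → Step (.recu M n N) (.recu M' n N)

/-- `Steps n M N`: the term `M` reduces to `N` in exactly `n` steps. -/
inductive Steps {F : Family} : ℕ → Tm F → Tm F → Prop
  | refl (M : Tm F) : Steps 0 M M
  | tail {n : ℕ} {M N L : Tm F} : Steps n M N → Step N L → Steps (n + 1) M L

/-! ### Type derivations of the system `H(D)` -/

/-- Typing contexts. Derivable contexts never contain a variable twice. -/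
abbrev Ctx (F : Family) : Type := Multiset (ℕ × Ty F)

/-- The variables of a context. -/
def names {F : Family} (Γ : Ctx F) : Multiset ℕ := Γ.map Prod.fst

/-- Type derivations `π : Γ ⊢ M : A` of the system `H(D)`: contraction is restricted to types in `D`,
and so are the contexts of the branches of a recursion. -/
inductive Der {F : Family} (D : Set (Ty F)) : Ctx F → Tm F → Ty F → Type
  | ax (x : ℕ) (A : Ty F) : Der D {(x, A)} (.fvar x) A
  | weak {Γ : Ctx F} {M : Tm F} {B : Ty F} (x : ℕ) (A : Ty F) (hx : x ∉ names Γ)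
      (π : Der D Γ M B) : Der D ((x, A) ::ₘ Γ) M B
  | contr {Γ : Ctx F} {M : Tm F} {B : Ty F} (x y z : ℕ) (A : Ty F) (hA : A ∈ D)
      (hz : z ∉ names Γ) (π : Der D ((x, A) ::ₘ (y, A) ::ₘ Γ) M B) :
      Der D ((z, A) ::ₘ Γ) (M.rename fun v => if v = x ∨ v = y then z else v) B
  | lam {Γ : Ctx F} {M : Tm F} (x : ℕ) (A B : Ty F) (π : Der D ((x, A) ::ₘ Γ) M B) :
      Der D Γ (.abs x M) (.arr A B)
  | app {Γ Δ : Ctx F} {M N : Tm F} (A B : Ty F) (h : (names (Γ + Δ)).Nodup)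
      (π₁ : Der D Γ M (.arr A B)) (π₂ : Der D Δ N A) : Der D (Γ + Δ) (.app M N) B
  | con (a : F.Alg) (c : F.Cons a) (n : ℕ) :
      Der D 0 (.con a c) (Ty.lin (.base a n) (F.ar c) (.base a n))
  | cond (a : F.Alg) (m : ℕ) (C : Ty F) {Γ : F.Cons a → Ctx F} {Δ : Ctx F}
      {N : F.Cons a → Tm F} {L : Tm F} (h : (names ((∑ i, Γ i) + Δ)).Nodup)
      (πs : ∀ i, Der D (Γ i) (N i) (Ty.lin (.base a m) (F.ar i) C))
      (π : Der D Δ L (.base a m)) :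
      Der D ((∑ i, Γ i) + Δ) (.cond L (F.alg a).numCons N) C
  | recu (a : F.Alg) (m : ℕ) (C : Ty F) {Γ : F.Cons a → Ctx F} {Δ : Ctx F}
      {N : F.Cons a → Tm F} {L : Tm F} (h : (names ((∑ i, Γ i) + Δ)).Nodup)
      (hD : ∀ i, ∀ p ∈ Γ i, p.2 ∈ D)
      (πs : ∀ i, Der D (Γ i) (N i) (Ty.lin (.base a m) (F.ar i) (Ty.lin C (F.ar i) C)))
      (π : Der D Δ L (.base a m)) :
      Der D ((∑ i, Γ i) + Δ) (.recu L (F.alg a).numCons N) C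

namespace Der

variable {F : Family} {D : Set (Ty F)}

/-- The recursion depth `R(π)`: the largest number of recursion rules on a path from the root to a
leaf. -/
def depth {Γ : Ctx F} {M : Tm F} {A : Ty F} : Der D Γ M A → ℕ
  | ax _ _ => 0
  | weak _ _ _ π => π.depth
  | contr _ _ _ _ _ _ π => π.depth
  | lam _ _ _ π => π.depth
  | app _ _ _ π₁ π₂ => max π₁.depth π₂.depth
  | con _ _ _ => 0
  | cond _ _ _ _ πs π => max (Finset.univ.sup fun i => (πs i).depth) π.depth
  | recu _ _ _ _ _ πs π => max (Finset.univ.sup fun i => (πs i).depth) π.depth + 1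

/-- `π.StdAux b`: every weakening in `π` is immediately above an abstraction, where `b` tells whether
the root of `π` is. -/
def StdAux {Γ : Ctx F} {M : Tm F} {A : Ty F} (b : Bool) : Der D Γ M A → Prop
  | ax _ _ => True
  | weak _ _ _ π => b = true ∧ π.StdAux false
  | contr _ _ _ _ _ _ π => π.StdAux false
  | lam _ _ _ π => π.StdAux true
  | app _ _ _ π₁ π₂ => π₁.StdAux false ∧ π₂.StdAux false
  | con _ _ _ => True
  | cond _ _ _ _ πs π => (∀ i, (πs i).StdAux false) ∧ π.StdAux false
  | recu _ _ _ _ _ πs π => (∀ i, (πs i).StdAux false) ∧ π.StdAux false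

/-- Derivations in standard form: the weakening rule is only used to derive the premise of an
abstraction rule. -/
def Standard {Γ : Ctx F} {M : Tm F} {A : Ty F} (π : Der D Γ M A) : Prop := π.StdAux false

end Der

/-! ### Interaction graphs -/

/-- The label of a vertex of an interaction graph, together with the edges incident to the vertex. -/
inductive Node (F : Family) (E : Type) : Type
  /-- Weakening, with its premise edge. -/
  | weak (e : E) : Node F E
  /-- Contraction of the edges `e` and `g` into the premise edge `h`. -/
  | contr (e g h : E) : Node F E
  /-- Abstraction: variable edge `e`, body `g`, result `h`. -/
  | lam (e g h : E) : Node F E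
  /-- Application: function `e`, argument `g`, result `h`. -/
  | app (e g h : E) : Node F E
  /-- The constructor `c` at the base type with index `n`, with its outgoing edge. -/
  | con (a : F.Alg) (c : F.Cons a) (n : ℕ) (e : E) : Node F E
  /-- Conditional: scrutinee `e₀`, branches `es`, result `g`. -/
  | cond (a : F.Alg) (e₀ : E) (es : F.Cons a → E) (g : E) : Node F E
  /-- Recursion, closing a box: recursive premise `e₀`, branches `es` (in the box), result `g`. -/
  | recu (a : F.Alg) (e₀ : E) (es : F.Cons a → E) (g : E) : Node F E
  /-- Premise of a box: outer edge `e`, inner edge `g`. -/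
  | port (a : F.Alg) (e g : E) : Node F E

/-- Transport of the incident edges. -/
def Node.map {F : Family} {E E' : Type} (f : E → E') : Node F E → Node F E'
  | .weak e => .weak (f e)
  | .contr e g h => .contr (f e) (f g) (f h)
  | .lam e g h => .lam (f e) (f g) (f h)
  | .app e g h => .app (f e) (f g) (f h)
  | .con a c n e => .con a c n (f e)
  | .cond a e₀ es g => .cond a (f e₀) (fun i => f (es i)) (f g)
  | .recu a e₀ es g => .recu a (f e₀) (fun i => f (es i)) (f g)
  | .port a e g => .port a (f e) (f g)

/-- Interaction graphs with premises indexed by the variables of `Γ`. The vertices that merely mark the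
conclusion and the premises of the graph (they induce no closure condition) are not listed among the
vertices: the edges they are attached to are given by `concl` and `prem`. -/
structure IGraph {F : Family} (Γ : Ctx F) : Type 1 where
  Vert : Type
  Edge : Type
  /-- labels and incidence -/
  node : Vert → Node F Edge
  /-- the type labelling an edge -/
  ty : Edge → Ty F
  /-- the recursion vertex closing the innermost box that contains the edge, if there is a box -/
  box : Edge → Option Vert
  /-- the conclusion edge -/
  concl : Edge
  /-- the premise edge of a variable -/
  prem : ∀ x : ℕ, x ∈ names Γ → Edge

/-- Vertices or edges of the graph of a conditional: a new one, and those of the parts. -/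
inductive Branching {ι : Type} (V : ι → Type) (V₀ : Type) : Type
  | main : Branching V V₀
  | branch (i : ι) (v : V i) : Branching V V₀
  | arg (v : V₀) : Branching V V₀

/-- Vertices or edges of the graph of a recursion: a new one, one for each premise of the box, and
those of the parts. -/
inductive Boxed {ι : Type} (X V : ι → Type) (V₀ : Type) : Type
  | main : Boxed X V V₀
  | port (i : ι) (x : X i) : Boxed X V V₀
  | inner (i : ι) (v : V i) : Boxed X V V₀
  | arg (v : V₀) : Boxed X V V₀

section names

variable {F : Family} {Γ Δ : Ctx F} {x y : ℕ} {A : Ty F}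

theorem mem_names_cons_of_mem (h : x ∈ names Γ) : x ∈ names ((y, A) ::ₘ Γ) := by
  simp only [names, Multiset.map_cons, Multiset.mem_cons]
  exact Or.inr h

theorem mem_names_cons_self : x ∈ names ((x, A) ::ₘ Γ) := by
  simp [names]

theorem mem_names_of_mem_cons (h : x ∈ names ((y, A) ::ₘ Γ)) (hne : x ≠ y) : x ∈ names Γ := by
  simp only [names, Multiset.map_cons, Multiset.mem_cons] at h
  exact h.resolve_left hne

theorem mem_names_right (h : x ∈ names (Γ + Δ)) (hn : x ∉ names Γ) : x ∈ names Δ := by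
  simp only [names, Multiset.map_add, Multiset.mem_add] at h
  exact h.resolve_left hn

theorem exists_mem_names {n : ℕ} {Γs : Fin n → Ctx F} (h : x ∈ names ((∑ i, Γs i) + Δ))
    (hn : x ∉ names Δ) : ∃ i, x ∈ names (Γs i) := by
  simp only [names, Multiset.map_add, Multiset.mem_add] at h
  have h' := h.resolve_right hn
  simp only [Multiset.mem_map, Multiset.mem_sum] at h'
  obtain ⟨p, ⟨i, _, hi⟩, rfl⟩ := h'
  exact ⟨i, Multiset.mem_map_of_mem _ hi⟩

end names

namespace IGraph

variable {F : Family}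

/-- An edge joining a premise and the conclusion. -/
def ax (x : ℕ) (A : Ty F) : IGraph (F := F) {(x, A)} where
  Vert := Empty
  Edge := Unit
  node v := v.elim
  ty _ := A
  box _ := none
  concl := ()
  prem _ _ := ()

/-- A constructor vertex attached to the conclusion. -/
def con (a : F.Alg) (c : F.Cons a) (n : ℕ) : IGraph (F := F) 0 where
  Vert := Unit
  Edge := Unit
  node _ := .con a c n ()
  ty _ := Ty.lin (.base a n) (F.ar c) (.base a n)
  box _ := none
  concl := ()
  prem _ _ := ()

/-- A new premise `none`, attached to a weakening vertex. -/
def weak {Γ : Ctx F} (x : ℕ) (A : Ty F) (G : IGraph Γ) : IGraph ((x, A) ::ₘ Γ) where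
  Vert := Option G.Vert
  Edge := Option G.Edge
  node v := v.elim (.weak none) fun v => (G.node v).map some
  ty e := e.elim A G.ty
  box e := e.elim none fun e => (G.box e).map some
  concl := some G.concl
  prem v hv := if h : v = x then none else some (G.prem v (mem_names_of_mem_cons hv h))

/-- A new premise `none`, split by a contraction vertex into the former premises `x` and `y`. -/
def contr {Γ : Ctx F} (x y z : ℕ) (A : Ty F) (G : IGraph ((x, A) ::ₘ (y, A) ::ₘ Γ)) :
    IGraph ((z, A) ::ₘ Γ) where
  Vert := Option G.Vert
  Edge := Option G.Edge
  node v := v.elim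
    (.contr (some (G.prem x mem_names_cons_self))
      (some (G.prem y (mem_names_cons_of_mem mem_names_cons_self))) none)
    fun v => (G.node v).map some
  ty e := e.elim A G.ty
  box e := e.elim none fun e => (G.box e).map some
  concl := some G.concl
  prem v hv := if h : v = z then none else
    some (G.prem v (mem_names_cons_of_mem (mem_names_cons_of_mem (mem_names_of_mem_cons hv h))))

/-- An abstraction vertex with the new conclusion `none`. -/
def lam {Γ : Ctx F} (x : ℕ) (A B : Ty F) (G : IGraph ((x, A) ::ₘ Γ)) : IGraph Γ where
  Vert := Option G.Vert
  Edge := Option G.Edge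
  node v := v.elim (.lam (some (G.prem x mem_names_cons_self)) (some G.concl) none)
    fun v => (G.node v).map some
  ty e := e.elim (.arr A B) G.ty
  box e := e.elim none fun e => (G.box e).map some
  concl := none
  prem v hv := some (G.prem v (mem_names_cons_of_mem hv))

/-- An application vertex with the new conclusion `none`. -/
def app {Γ Δ : Ctx F} (B : Ty F) (G : IGraph Γ) (H : IGraph Δ) : IGraph (Γ + Δ) where
  Vert := Option (G.Vert ⊕ H.Vert)
  Edge := Option (G.Edge ⊕ H.Edge)
  node
    | none => .app (some (.inl G.concl)) (some (.inr H.concl)) none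
    | some (.inl v) => (G.node v).map fun e => some (.inl e)
    | some (.inr v) => (H.node v).map fun e => some (.inr e)
  ty
    | none => B
    | some (.inl e) => G.ty e
    | some (.inr e) => H.ty e
  box
    | none => none
    | some (.inl e) => (G.box e).map fun v => some (.inl v)
    | some (.inr e) => (H.box e).map fun v => some (.inr v)
  concl := none
  prem v hv := by
    classical
    exact if h : v ∈ names Γ then some (.inl (G.prem v h))
      else some (.inr (H.prem v (mem_names_right hv h)))

/-- A conditional vertex with the new conclusion `main`. -/
noncomputable def cond (a : F.Alg) (C : Ty F) {Γ : F.Cons a → Ctx F} {Δ : Ctx F}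
    (Gs : ∀ i, IGraph (Γ i)) (H : IGraph Δ) : IGraph ((∑ i, Γ i) + Δ) where
  Vert := Branching (fun i => (Gs i).Vert) H.Vert
  Edge := Branching (fun i => (Gs i).Edge) H.Edge
  node
    | .main => .cond a (.arg H.concl) (fun i => .branch i (Gs i).concl) .main
    | .branch i v => ((Gs i).node v).map (.branch i)
    | .arg v => (H.node v).map .arg
  ty
    | .main => C
    | .branch i e => (Gs i).ty e
    | .arg e => H.ty e
  box
    | .main => none
    | .branch i e => ((Gs i).box e).map (.branch i)
    | .arg e => (H.box e).map .arg
  concl := .main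
  prem v hv := by
    classical
    exact if h : v ∈ names Δ then .arg (H.prem v h)
      else
        have hi := exists_mem_names hv h
        .branch hi.choose ((Gs hi.choose).prem v hi.choose_spec)

/-- A recursion vertex with the new conclusion `main`. All branches are put in the box of this vertex,
and each of their premises is connected to a new premise edge through a port. -/
noncomputable def recu (a : F.Alg) (C : Ty F) {Γ : F.Cons a → Ctx F} {Δ : Ctx F}
    (Gs : ∀ i, IGraph (Γ i)) (H : IGraph Δ) : IGraph ((∑ i, Γ i) + Δ) where
  Vert := Boxed (fun i => {x // x ∈ names (Γ i)}) (fun i => (Gs i).Vert) H.Vert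
  Edge := Boxed (fun i => {x // x ∈ names (Γ i)}) (fun i => (Gs i).Edge) H.Edge
  node
    | .main => .recu a (.arg H.concl) (fun i => .inner i (Gs i).concl) .main
    | .port i x => .port a (.port i x) (.inner i ((Gs i).prem x.1 x.2))
    | .inner i v => ((Gs i).node v).map (.inner i)
    | .arg v => (H.node v).map .arg
  ty
    | .main => C
    | .port i x => (Gs i).ty ((Gs i).prem x.1 x.2)
    | .inner i e => (Gs i).ty e
    | .arg e => H.ty e
  box
    | .main => none
    | .port _ _ => none
    | .inner i e => some (((Gs i).box e).elim .main fun v => .inner i v)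
    | .arg e => (H.box e).map .arg
  concl := .main
  prem v hv := by
    classical
    exact if h : v ∈ names Δ then .arg (H.prem v h)
      else
        have hi := exists_mem_names hv h
        .port hi.choose ⟨v, hi.choose_spec⟩

end IGraph

/-- The interaction graph `G_π` of a type derivation `π`. -/
noncomputable def Der.graph {F : Family} {D : Set (Ty F)} {Γ : Ctx F} {M : Tm F} {A : Ty F} :
    Der D Γ M A → IGraph Γ
  | .ax x A => .ax x A
  | .weak x A _ π => .weak x A π.graph
  | .contr x y z A _ _ π => .contr x y z A π.graph
  | .lam x A B π => .lam x A B π.graph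
  | .app _ B _ π₁ π₂ => .app B π₁.graph π₂.graph
  | .con a c n => .con a c n
  | .cond a _ C _ πs π => .cond a C (fun i => (πs i).graph) π.graph
  | .recu a _ C _ _ πs π => .recu a C (fun i => (πs i).graph) π.graph

/-! ### Algebraic context semantics -/

/-- Term contexts: free algebra terms with exactly one hole. -/
inductive ECtx (F : Family) (a : F.Alg) : Type
  | hole : ECtx F a
  | mk (c : F.Cons a) (i : Fin (F.ar c)) (rest : {j : Fin (F.ar c) // j ≠ i} → ETerm F a)
      (u : ECtx F a) : ECtx F a

namespace ECtx

variable {F : Family} {a : F.Alg}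

/-- The term `u[t]`. -/
def plug : ECtx F a → ETerm F a → ETerm F a
  | hole, t => t
  | mk c i rest u, t => .mk c fun j => if h : j = i then u.plug t else rest ⟨j, h⟩

/-- The context `u[w]`. -/
def comp : ECtx F a → ECtx F a → ECtx F a
  | hole, w => w
  | mk c i rest u, w => mk c i rest (u.comp w)

/-- The context obtained from `c t₁ ⋯ tₙ` by replacing the argument with index `i` by the hole. -/
def frame (c : F.Cons a) (ts : Fin (F.ar c) → ETerm F a) (i : Fin (F.ar c)) : ECtx F a :=
  mk c i (fun j => ts j.1) hole

end ECtx

/-- Type contexts: `left L A` is `L ⊸ A` and `right A L` is `A ⊸ L`. -/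
inductive TyCtx (F : Family) : Type
  | hole : TyCtx F
  | left (L : TyCtx F) (A : Ty F) : TyCtx F
  | right (A : Ty F) (L : TyCtx F) : TyCtx F

namespace TyCtx

variable {F : Family}

/-- The type `L[B]`. -/
def fill (B : Ty F) : TyCtx F → Ty F
  | hole => B
  | left L A => .arr (L.fill B) A
  | right A L => .arr A (L.fill B)

/-- Positive type contexts; the others are the negative ones. -/
def Positive : TyCtx F → Prop
  | hole => True
  | left L _ => ¬ L.Positive
  | right _ L => L.Positive

/-- `L` is a positive focus for `A`. -/
def PosFocus (L : TyCtx F) (A : Ty F) : Prop :=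
  L.Positive ∧ ∃ (a : F.Alg) (i : ℕ), A = L.fill (.base a i)

/-- `L` is a negative focus for `A`. -/
def NegFocus (L : TyCtx F) (A : Ty F) : Prop :=
  ¬ L.Positive ∧ ∃ (a : F.Alg) (i : ℕ), A = L.fill (.base a i)

/-- `rights A n L` is `A ⊸ ⋯ ⊸ A ⊸ L` with `n` arguments of type `A`. -/
def rights (A : Ty F) : ℕ → TyCtx F → TyCtx F
  | 0, L => L
  | n + 1, L => right A (rights A n L)

end TyCtx

/-- Free algebra terms over all members of the family. -/
abbrev Val (F : Family) : Type := Σ a : F.Alg, ETerm F a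

/-- Elements of stacks. -/
structure StackElt (F : Family) (V : Type) : Type where
  alg : F.Alg
  ctx : ECtx F alg
  term : ETerm F alg
  vert : V

/-- The labels occurring in trees. -/
structure Label (F : Family) (V E : Type) : Type where
  val : Val F
  edge : E
  stack : List (StackElt F V)
  focus : TyCtx F

/-- Finite ordered trees with labelled vertices. -/
inductive CTree (F : Family) (V E : Type) : Type
  | node (l : Label F V E) (n : ℕ) (f : Fin n → CTree F V E) : CTree F V E

namespace CTree

variable {F : Family} {V E : Type}

/-- The label of the root. -/
def root : CTree F V E → Label F V E
  | node l _ _ => l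

/-- The free algebra term `L(T)`. -/
def val (T : CTree F V E) : Val F := T.root.val

/-- `S` is an immediate subtree of `T`. -/
def IsChild (S : CTree F V E) : CTree F V E → Prop
  | node _ _ f => ∃ j, f j = S

/-- The root of `T` has the given second, third and fourth component. -/
def At (T : CTree F V E) (e : E) (U : List (StackElt F V)) (L : TyCtx F) : Prop :=
  T.root.edge = e ∧ T.root.stack = U ∧ T.root.focus = L

/-- The tree whose root has `T` as only child and carries the same free algebra term. -/
def ext (T : CTree F V E) (e : E) (U : List (StackElt F V)) (L : TyCtx F) : CTree F V E :=
  node ⟨T.val, e, U, L⟩ 1 fun _ => T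

/-- `Guided T u S`: the subtree `S` is met when travelling from the root of `T` towards the leaves
along the path prescribed by the term context `u`. -/
inductive Guided {a : F.Alg} : CTree F V E → ECtx F a → CTree F V E → Prop
  | here (T : CTree F V E) : Guided T .hole T
  | same {l : Label F V E} {f : Fin 1 → CTree F V E} {u : ECtx F a} {S : CTree F V E} :
      (f 0).val = l.val → Guided (f 0) u S → Guided (node l 1 f) u S
  | con {l : Label F V E} {c : F.Cons a} {f : Fin (F.ar c) → CTree F V E}
      {ts : Fin (F.ar c) → ETerm F a} (i : Fin (F.ar c)) {u : ECtx F a} {S : CTree F V E} :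
      l.val = ⟨a, .mk c ts⟩ → (∀ j, (f j).val = ⟨a, ts j⟩) → Guided (f i) u S →
      Guided (node l (F.ar c) f) (.mk c i (fun j => ts j.1) u) S

/-- `S = B(T, u, s)`: the last subtree `S` with `L(S) = s` that is met when travelling along `u`. -/
def IsB {a : F.Alg} (T : CTree F V E) (u : ECtx F a) (s : ETerm F a) (S : CTree F V E) : Prop :=
  Guided T u S ∧ S.val = ⟨a, s⟩ ∧ ∀ S' : CTree F V E, S'.IsChild S → S'.val ≠ S.val

end CTree

/-- `InT G T`: the tree `T` belongs to the set `T(G)`, the smallest set of trees that is closed under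
the conditions induced by the vertices of the interaction graph `G`. -/
inductive InT {F : Family} {Γ : Ctx F} (G : IGraph Γ) : CTree F G.Vert G.Edge → Prop
  -- abstraction
  | lam_var_pos {v e g h T U P} : G.node v = .lam e g h →
      InT G T → T.At h U (.left P (G.ty g)) → P.PosFocus (G.ty e) → InT G (T.ext e U P)
  | lam_var_neg {v e g h T U N} : G.node v = .lam e g h →
      InT G T → T.At e U N → N.NegFocus (G.ty e) → InT G (T.ext h U (.left N (G.ty g)))
  | lam_body_pos {v e g h T U P} : G.node v = .lam e g h →
      InT G T → T.At g U P → P.PosFocus (G.ty g) → InT G (T.ext h U (.right (G.ty e) P))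
  | lam_body_neg {v e g h T U N} : G.node v = .lam e g h →
      InT G T → T.At h U (.right (G.ty e) N) → N.NegFocus (G.ty g) → InT G (T.ext g U N)
  -- application
  | app_arg_pos {v e g h T U P} : G.node v = .app e g h →
      InT G T → T.At g U P → P.PosFocus (G.ty g) → InT G (T.ext e U (.left P (G.ty h)))
  | app_arg_neg {v e g h T U N} : G.node v = .app e g h →
      InT G T → T.At e U (.left N (G.ty h)) → N.NegFocus (G.ty g) → InT G (T.ext g U N)
  | app_res_neg {v e g h T U N} : G.node v = .app e g h →
      InT G T → T.At h U N → N.NegFocus (G.ty h) → InT G (T.ext e U (.right (G.ty g) N))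
  | app_res_pos {v e g h T U P} : G.node v = .app e g h →
      InT G T → T.At e U (.right (G.ty g) P) → P.PosFocus (G.ty h) → InT G (T.ext h U P)
  -- contraction
  | contr_left {v e g h T U} : G.node v = .contr e g h →
      InT G T → T.At h U .hole → InT G (T.ext e U .hole)
  | contr_right {v e g h T U} : G.node v = .contr e g h →
      InT G T → T.At h U .hole → InT G (T.ext g U .hole)
  -- constructors of arity zero, outside all boxes and inside a box
  | con_zero {w a n e} {c : F.Cons a} {ts : Fin (F.ar c) → ETerm F a}
      {f : Fin 0 → CTree F G.Vert G.Edge} :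
      G.node w = .con a c n e → F.ar c = 0 → G.box e = none →
      InT G (.node ⟨⟨a, .mk c ts⟩, e, [], .hole⟩ 0 f)
  | con_zero_box {w a n e} {c : F.Cons a} {ts : Fin (F.ar c) → ETerm F a}
      {f : Fin 0 → CTree F G.Vert G.Edge} {v b e₀ es g T U} {u : ECtx F b} {t : ETerm F b} :
      G.node w = .con a c n e → F.ar c = 0 → G.box e = some v →
      G.node v = .recu b e₀ es g →
      InT G T → T.root = ⟨⟨b, u.plug t⟩, e₀, U, .hole⟩ →
      InT G (.node ⟨⟨a, .mk c ts⟩, e, ⟨b, u, t, v⟩ :: U, .hole⟩ 0 f)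
  -- constructors of positive arity
  | con_succ {w a n e U} {c : F.Cons a} {ts : Fin (F.ar c) → ETerm F a}
      {f : Fin (F.ar c) → CTree F G.Vert G.Edge} :
      G.node w = .con a c n e → 0 < F.ar c →
      (∀ j, InT G (f j)) →
      (∀ j, (f j).root = ⟨⟨a, ts j⟩, e, U, .rights (.base a n) j
        (.left .hole (Ty.lin (.base a n) (F.ar c - 1 - j) (.base a n)))⟩) →
      InT G (.node ⟨⟨a, .mk c ts⟩, e, U, .rights (.base a n) (F.ar c) .hole⟩ (F.ar c) f)
  -- conditional
  | cond_pos {v a e₀ es g T U S P} {c : F.Cons a} {ts : Fin (F.ar c) → ETerm F a} :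
      G.node v = .cond a e₀ es g →
      InT G T → T.root = ⟨⟨a, .mk c ts⟩, e₀, U, .hole⟩ →
      InT G S → S.At (es c) U (.rights (G.ty e₀) (F.ar c) P) → P.PosFocus (G.ty g) →
      InT G (S.ext g U P)
  | cond_neg {v a e₀ es g T U S N} {c : F.Cons a} {ts : Fin (F.ar c) → ETerm F a} :
      G.node v = .cond a e₀ es g →
      InT G T → T.root = ⟨⟨a, .mk c ts⟩, e₀, U, .hole⟩ →
      InT G S → S.At g U N → N.NegFocus (G.ty g) →
      InT G (S.ext (es c) U (.rights (G.ty e₀) (F.ar c) N))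
  | cond_sub {v a e₀ es g T U S} {c : F.Cons a} {ts : Fin (F.ar c) → ETerm F a}
      (j : Fin (F.ar c)) :
      G.node v = .cond a e₀ es g →
      InT G T → T.root = ⟨⟨a, .mk c ts⟩, e₀, U, .hole⟩ →
      T.IsB (.frame c ts j) (ts j) S →
      InT G (S.ext (es c) U (.rights (G.ty e₀) j
        (.left .hole (Ty.lin (G.ty e₀) (F.ar c - 1 - j) (G.ty g)))))
  -- recursion: from the copy of the box for a subterm to the copy for its parent, and back
  | recu_up {v a e₀ es g T U S P} {u : ECtx F a} {c d : F.Cons a}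
      {ts : Fin (F.ar c) → ETerm F a} {ss : Fin (F.ar d) → ETerm F a} (k : Fin (F.ar c)) :
      G.node v = .recu a e₀ es g →
      InT G T → T.root = ⟨⟨a, u.plug (.mk c ts)⟩, e₀, U, .hole⟩ → ts k = .mk d ss →
      InT G S → S.At (es d) (⟨a, u.comp (.frame c ts k), ts k, v⟩ :: U)
        (.rights (G.ty e₀) (F.ar d) (.rights (G.ty g) (F.ar d) P)) → P.PosFocus (G.ty g) →
      InT G (S.ext (es c) (⟨a, u, .mk c ts, v⟩ :: U)
        (.rights (G.ty e₀) (F.ar c) (.rights (G.ty g) k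
          (.left P (Ty.lin (G.ty g) (F.ar c - 1 - k) (G.ty g))))))
  | recu_down {v a e₀ es g T U S N} {u : ECtx F a} {c d : F.Cons a}
      {ts : Fin (F.ar c) → ETerm F a} {ss : Fin (F.ar d) → ETerm F a} (k : Fin (F.ar c)) :
      G.node v = .recu a e₀ es g →
      InT G T → T.root = ⟨⟨a, u.plug (.mk c ts)⟩, e₀, U, .hole⟩ → ts k = .mk d ss →
      InT G S → S.At (es c) (⟨a, u, .mk c ts, v⟩ :: U)
        (.rights (G.ty e₀) (F.ar c) (.rights (G.ty g) k
          (.left N (Ty.lin (G.ty g) (F.ar c - 1 - k) (G.ty g))))) → N.NegFocus (G.ty g) →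
      InT G (S.ext (es d) (⟨a, u.comp (.frame c ts k), ts k, v⟩ :: U)
        (.rights (G.ty e₀) (F.ar d) (.rights (G.ty g) (F.ar d) N)))
  -- recursion: leaving and entering the box through its conclusion
  | recu_out {v a e₀ es g T U S P} {c : F.Cons a} {ts : Fin (F.ar c) → ETerm F a} :
      G.node v = .recu a e₀ es g →
      InT G T → T.root = ⟨⟨a, .mk c ts⟩, e₀, U, .hole⟩ →
      InT G S → S.At (es c) (⟨a, .hole, .mk c ts, v⟩ :: U)
        (.rights (G.ty e₀) (F.ar c) (.rights (G.ty g) (F.ar c) P)) → P.PosFocus (G.ty g) →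
      InT G (S.ext g U P)
  | recu_in {v a e₀ es g T U S N} {c : F.Cons a} {ts : Fin (F.ar c) → ETerm F a} :
      G.node v = .recu a e₀ es g →
      InT G T → T.root = ⟨⟨a, .mk c ts⟩, e₀, U, .hole⟩ →
      InT G S → S.At g U N → N.NegFocus (G.ty g) →
      InT G (S.ext (es c) (⟨a, .hole, .mk c ts, v⟩ :: U)
        (.rights (G.ty e₀) (F.ar c) (.rights (G.ty g) (F.ar c) N)))
  -- recursion: passing the subterms of the recursion argument to the branches
  | recu_sub {v a e₀ es g T U S} {u : ECtx F a} {c : F.Cons a} {ts : Fin (F.ar c) → ETerm F a}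
      (j : Fin (F.ar c)) :
      G.node v = .recu a e₀ es g →
      InT G T → T.root = ⟨⟨a, u.plug (.mk c ts)⟩, e₀, U, .hole⟩ →
      T.IsB (u.comp (.frame c ts j)) (ts j) S →
      InT G (S.ext (es c) (⟨a, u, .mk c ts, v⟩ :: U) (.rights (G.ty e₀) j
        (.left .hole (Ty.lin (G.ty e₀) (F.ar c - 1 - j) (Ty.lin (G.ty g) (F.ar c) (G.ty g))))))
  -- entering a box through a premise
  | port {w a e g v b e₀ es g' T U S} {u : ECtx F b} {s : ETerm F b} :
      G.node w = .port a e g → G.box g = some v → G.node v = .recu b e₀ es g' →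
      InT G T → T.root = ⟨⟨b, u.plug s⟩, e₀, U, .hole⟩ →
      InT G S → S.At e U .hole →
      InT G (S.ext g (⟨b, u, s, v⟩ :: U) .hole)

/-! ### Representable functions -/

/-- The numeral for a natural number in an algebra of unary strings. -/
def numeral {F : Family} {u : F.Alg} (hu : F.alg u = unaryAlg) : ℕ → Tm F
  | 0 => .con u ⟨1, by simp [hu, unaryAlg]⟩
  | n + 1 => .app (.con u ⟨0, by simp [hu, unaryAlg]⟩) (numeral hu n)

/-- The term `M` represents `f` in the system `H(D)`: it is closed, has a type
`𝕌^i₁ ⊸ ⋯ ⊸ 𝕌^iₖ ⊸ 𝕌^j`, and applied to numerals it reduces to the numeral of the value of `f`. -/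
def Represents {F : Family} {u : F.Alg} (hu : F.alg u = unaryAlg) (D : Set (Ty F)) (M : Tm F)
    {k : ℕ} (f : List.Vector ℕ k → ℕ) : Prop :=
  (∃ (i : Fin k → ℕ) (j : ℕ), Nonempty (Der D 0 M
    ((List.ofFn fun l => Ty.base u (i l)).foldr Ty.arr (Ty.base u j)))) ∧
  ∀ v : List.Vector ℕ k, Relation.ReflTransGen Step
    (Tm.apps M (v.toList.map (numeral hu))) (numeral hu (f v))

end HRec

/-! The three claims rest on a termination argument, a counting argument and a simulation.

Normalization. A typed term gets a weight, a finitely supported sequence of numbers that decreases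
colexicographically in every reduction step. The branches of a recursion count only through their
rank, the nesting depth of recursion branches. If the branches have maximal rank r, the recursion
puts a 1 at position 2r+3 while its argument is not yet a constructor term, and the size of the
argument at position 2r+2 once it is one. Unfolding replaces the size of a term by the sum of the
sizes of its immediate subterms, which is one less, and releases a branch whose weight lives at
positions at most 2r+1. A beta step removes a unit at position 0. Duplication does no harm: only
variables of base type occur more than once or in a recursion branch, and values of base type are
variables or constructor terms, of weight and rank zero. There are 2R+2 relevant positions, where R
is the recursion depth, the entries are bounded by the size of the term, and a step takes size s to
at most (s+2)^2. By `exists_primrec_descent` a colexicographic descent controlled in this way has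
primitive recursively bounded length. The type system `HasTy` keeps just the information needed and
is stable under reduction.

Context semantics. A tree is determined by the edge, stack and focus at its root (`Stage.unique`).
Hence a constructor vertex with a given stack cannot recur below itself in a tree, and the depth of
the term of a tree is at most the number of such pairs (`Stage.depth_le`). So it suffices to count
stacks. A stack inside l+1 boxes consists of a recursion vertex, a stack inside l boxes, and a
decomposition u[s] of the argument of that recursion; a term has as many decompositions as
constructors. The apparent circle, that the sizes of arguments depend on the number of deeper stacks
and conversely, is broken by generating trees in rounds. While no new instance of a recursion inside
l boxes appears, the arguments of the old ones stay fixed; when one appears, its argument is bounded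
in terms of the old arguments. There are boundedly many instances, so finitely many iterations of
the bound for fewer open levels suffice (`Inst.size_le`), and `exists_primrec_size_le` is an
induction on the number of open levels.

Representable functions. An environment machine on coded states has a primitive recursive transition
function. Each of its steps either is a reduction or lowers a cost that is linear in the size of the
denoted term, so the bounds for normalization bound its running time. Reduction has the diamond
property, so the value found by the machine is the numeral in question. -/

namespace HRec

/-! ### Colexicographically decreasing sequences -/

/-- The strict colexicographic order on sequences of natural numbers: the last entry in which `f` and
`g` differ is smaller in `f`. -/
def ColexLt (f g : ℕ → ℕ) : Prop := ∃ i, f i < g i ∧ ∀ j, i < j → f j = g j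

/-- The reflexive closure of `ColexLt`. -/
def ColexLe (f g : ℕ → ℕ) : Prop := f = g ∨ ColexLt f g

theorem ColexLe.refl (f : ℕ → ℕ) : ColexLe f f := Or.inl rfl

theorem ColexLt.add_right {f g : ℕ → ℕ} (h : ColexLt f g) (k : ℕ → ℕ) :
    ColexLt (f + k) (g + k) := by
  obtain ⟨i, hi, hj⟩ := h
  exact ⟨i, by simpa using hi, fun j hij => by simp [hj j hij]⟩

theorem ColexLt.trans {f g k : ℕ → ℕ} (h : ColexLt f g) (h' : ColexLt g k) : ColexLt f k := by
  obtain ⟨i, hi, hj⟩ := h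
  obtain ⟨i', hi', hj'⟩ := h'
  rcases lt_trichotomy i i' with hl | rfl | hl
  · exact ⟨i', by rw [hj _ hl]; exact hi', fun j h => by rw [hj _ (hl.trans h), hj' _ h]⟩
  · exact ⟨i, hi.trans hi', fun j h => by rw [hj _ h, hj' _ h]⟩
  · exact ⟨i, by rw [← hj' _ hl]; exact hi, fun j h => by rw [hj _ h, hj' _ (hl.trans h)]⟩

theorem ColexLt.trans_le {f g k : ℕ → ℕ} (h : ColexLt f g) (h' : ColexLe g k) : ColexLt f k := by
  rcases h' with rfl | h'
  exacts [h, h.trans h']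

theorem ColexLe.trans_lt {f g k : ℕ → ℕ} (h : ColexLe f g) (h' : ColexLt g k) : ColexLt f k := by
  rcases h with rfl | h
  exacts [h', h.trans h']

theorem ColexLe.trans {f g k : ℕ → ℕ} (h : ColexLe f g) (h' : ColexLe g k) : ColexLe f k := by
  rcases h with rfl | h
  exacts [h', Or.inr (h.trans_le h')]

theorem ColexLe.add_right {f g : ℕ → ℕ} (h : ColexLe f g) (k : ℕ → ℕ) :
    ColexLe (f + k) (g + k) := by
  rcases h with rfl | h
  exacts [.refl _, Or.inr (h.add_right k)]

theorem ColexLe.add {f g f' g' : ℕ → ℕ} (h : ColexLe f g) (h' : ColexLe f' g') :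
    ColexLe (f + f') (g + g') := by
  refine (h.add_right f').trans ?_
  rw [add_comm g, add_comm g]
  exact h'.add_right g

theorem ColexLt.add_le {f g f' g' : ℕ → ℕ} (h : ColexLt f g) (h' : ColexLe f' g') :
    ColexLt (f + f') (g + g') := by
  refine (h.add_right f').trans_le ?_
  rw [add_comm g, add_comm g]
  exact h'.add_right g

/-- Agreement from K on is essential: it provides a last position at which the sequences differ. -/
theorem ColexLe.of_le {f g : ℕ → ℕ} {K : ℕ} (h : f ≤ g) (hK : ∀ j, K ≤ j → f j = g j) :
    ColexLe f g := by
  induction K with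
  | zero => exact Or.inl (funext fun j => hK j (Nat.zero_le _))
  | succ K ih =>
    rcases (h K).eq_or_lt with he | hl
    · exact ih fun j hj => by
        rcases hj.eq_or_lt with rfl | hj
        exacts [he, hK j hj]
    · exact Or.inr ⟨K, hl, fun j hj => hK j hj⟩

theorem ColexLe.sum {ι : Type*} (t : Finset ι) {f g : ι → ℕ → ℕ} (h : ∀ i ∈ t, ColexLe (f i) (g i)) :
    ColexLe (∑ i ∈ t, f i) (∑ i ∈ t, g i) := by
  classical
  induction t using Finset.induction_on with
  | empty => exact .refl _
  | insert a t ha ih =>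
    rw [Finset.sum_insert ha, Finset.sum_insert ha]
    exact (h a (Finset.mem_insert_self _ _)).add
      (ih fun i hi => h i (Finset.mem_insert_of_mem hi))

theorem iterate_le_iterate_of_le {g : ℕ → ℕ} (hg : Monotone g) (hid : ∀ s, s ≤ g s) {m n s t : ℕ}
    (hmn : m ≤ n) (hst : s ≤ t) : g^[m] s ≤ g^[n] t :=
  (hg.iterate m hst).trans (Function.monotone_iterate_of_id_le hid hmn t)

theorem le_iterate_of_forall_succ_le {g s : ℕ → ℕ} (hg : Monotone g) {n : ℕ}
    (hs : ∀ i < n, s (i + 1) ≤ g (s i)) : s n ≤ g^[n] (s 0) := by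
  induction n with
  | zero => exact le_rfl
  | succ n ih =>
    rw [Function.iterate_succ_apply']
    exact (hs n n.lt_succ_self).trans (hg (ih fun i hi => hs i (hi.trans n.lt_succ_self)))

/-- The length of a colexicographically decreasing sequence of vectors of length `K`, whose entries
are controlled by a sequence `s` of numbers that grows at most as prescribed by `g`, is bounded by a
primitive recursive function of the first control value. -/
theorem exists_primrec_descent {g : ℕ → ℕ} (hg : Primrec g) (hm : Monotone g) (hid : ∀ s, s ≤ g s)
    (K : ℕ) : ∃ T : ℕ → ℕ, Primrec T ∧ Monotone T ∧ ∀ (w : ℕ → ℕ → ℕ) (s : ℕ → ℕ) (n : ℕ),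
      (∀ i < n, ColexLt (w (i + 1)) (w i)) → (∀ i < n, s (i + 1) ≤ g (s i)) →
      (∀ i j, w i j ≤ s i) → (∀ i ≤ n, ∀ j, K ≤ j → w i j = w 0 j) → n ≤ T (s 0) := by
  induction K with
  | zero =>
    refine ⟨fun _ => 0, Primrec.const 0, monotone_const, fun w s n hw _ _ hK => ?_⟩
    -- With no coordinate allowed to vary, all vectors coincide and no descent is possible.
    by_contra hn
    obtain ⟨i, hi, -⟩ := hw 0 (by omega)
    have := hK 1 (by omega) i (Nat.zero_le _)
    simp only [zero_add] at hi
    omega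
  | succ K ih =>
    obtain ⟨T, hT, hTm, hTb⟩ := ih
    -- `h` bounds the control value after one block in which coordinate K is constant, of at most `T
    -- s` steps, followed by the step in which it drops.
    let h : ℕ → ℕ := fun s => g^[T s + 1] s
    have hh : Primrec h :=
      Primrec.nat_iterate (Primrec.succ.comp hT) Primrec.id (hg.comp₂ Primrec₂.right)
    have hhm : Monotone h := fun s t hst =>
      iterate_le_iterate_of_le hm hid (Nat.succ_le_succ (hTm hst)) hst
    have hhid : ∀ s, s ≤ h s := fun s =>
      (iterate_le_iterate_of_le hm hid (Nat.zero_le (T s + 1)) le_rfl : g^[0] s ≤ _)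
    -- Coordinate K never increases, so it has at most `c + 1` blocks of constancy. All of them
    -- start with control values at most `h^[c] (s 0)`, and on each the bound `T` for K coordinates
    -- applies.
    have key : ∀ (c : ℕ) (w : ℕ → ℕ → ℕ) (s : ℕ → ℕ) (n : ℕ),
        (∀ i < n, ColexLt (w (i + 1)) (w i)) → (∀ i < n, s (i + 1) ≤ g (s i)) →
        (∀ i j, w i j ≤ s i) → (∀ i ≤ n, ∀ j, K + 1 ≤ j → w i j = w 0 j) →
        w 0 K ≤ c → n ≤ (c + 1) * (T (h^[c] (s 0)) + 1) := by
      intro c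
      induction c with
      | zero =>
        intro w s n hw hs hb hK hc
        have hcon : ∀ i ≤ n, w i K = 0 := by
          intro i
          induction i with
          | zero => intro _; omega
          | succ i ihi =>
            intro hi
            obtain ⟨p, hp, hq⟩ := hw i (by omega)
            rcases lt_trichotomy p K with hl | rfl | hl
            · rw [hq K hl, ihi (by omega)]
            · rw [ihi (by omega)] at hp; omega
            · rw [hK (i + 1) hi p hl, hK i (by omega) p hl] at hp; omega
        have := hTb w s n hw hs hb fun i hi j hj => by
          rcases hj.eq_or_lt with rfl | hj
          · rw [hcon i hi, hcon 0 (Nat.zero_le _)]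
          · exact hK i hi j hj
        simp only [Function.iterate_zero, id_eq, zero_add, one_mul]
        omega
      | succ c ihc =>
        intro w s n hw hs hb hK hc
        have hstep : ∀ i < n, w (i + 1) K ≤ w i K := by
          intro i hi
          obtain ⟨p, hp, hq⟩ := hw i hi
          rcases lt_trichotomy p K with hl | rfl | hl
          · rw [hq K hl]
          · exact hp.le
          · rw [hK (i + 1) hi p hl, hK i hi.le p hl] at hp; omega
        have hhc : ∀ k, T (s 0) ≤ T (h^[k] (s 0)) := fun k => hTm
          (iterate_le_iterate_of_le hhm hhid (Nat.zero_le k) le_rfl : h^[0] (s 0) ≤ _)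
        by_cases hcon : ∀ i ≤ n, w i K = w 0 K
        · have := hTb w s n hw hs hb fun i hi j hj => by
            rcases hj.eq_or_lt with rfl | hj
            · exact hcon i hi
            · exact hK i hi j hj
          have h2 := hhc (c + 1)
          nlinarith
        · push Not at hcon
          classical
          -- The first time at which coordinate K has changed. Up to `m - 1` the bound for K
          -- coordinates applies; at `m` the coordinate is strictly smaller than at the start, so
          -- the induction on `c` covers the rest.
          let m := Nat.find hcon
          obtain ⟨hmn, hmK⟩ : m ≤ n ∧ w m K ≠ w 0 K := Nat.find_spec hcon
          have hmin : ∀ i < m, w i K = w 0 K := fun i hi => by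
            by_contra hne
            exact Nat.find_min hcon hi ⟨by omega, hne⟩
          obtain ⟨m', hm'⟩ : ∃ m', m = m' + 1 := by
            refine Nat.exists_eq_succ_of_ne_zero fun h0 => ?_
            rw [h0] at hmK
            exact hmK rfl
          have h1 : m' ≤ T (s 0) := hTb w s m' (fun i hi => hw i (by omega))
            (fun i hi => hs i (by omega)) hb fun i hi j hj => by
              rcases hj.eq_or_lt with rfl | hj
              · exact hmin i (by omega)
              · exact hK i (by omega) j hj
          have h2 : w m K < w 0 K := by
            refine lt_of_le_of_ne ?_ hmK
            rw [hm', ← hmin m' (by omega)]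
            exact hstep m' (by omega)
          have h3 : s m ≤ h (s 0) := by
            refine (le_iterate_of_forall_succ_le hm fun i hi => hs i (by omega)).trans ?_
            exact iterate_le_iterate_of_le hm hid (by omega) le_rfl
          have h4 := ihc (fun i => w (m + i)) (fun i => s (m + i)) (n - m)
            (fun i hi => hw (m + i) (by omega)) (fun i hi => hs (m + i) (by omega))
            (fun i j => hb (m + i) j)
            (fun i hi j hj => by
              rw [hK (m + i) (by omega) j hj, add_zero, hK m hmn j hj])
            (by simp only [add_zero]; omega)
          have h5 : T (h^[c] (s (m + 0))) ≤ T (h^[c + 1] (s 0)) := by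
            rw [Function.iterate_succ_apply]
            exact hTm (hhm.iterate c h3)
          have h6 := hhc (c + 1)
          calc n = m + (n - m) := by omega
            _ ≤ (T (h^[c + 1] (s 0)) + 1) + (c + 1) * (T (h^[c + 1] (s 0)) + 1) := by
              refine add_le_add (by omega) (h4.trans ?_)
              gcongr
            _ = _ := by ring
    -- Entries are bounded by the control value, so `c = s 0` is admissible in `key`.
    refine ⟨fun s => (s + 1) * (T (h^[s] s) + 1), ?_, ?_, fun w s n hw hs hb hK => ?_⟩
    · exact Primrec.nat_mul.comp Primrec.succ (Primrec.succ.comp (hT.comp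
        (Primrec.nat_iterate Primrec.id Primrec.id (hh.comp₂ Primrec₂.right))))
    · intro s t hst
      exact Nat.mul_le_mul (by omega)
        (Nat.succ_le_succ (hTm (iterate_le_iterate_of_le hhm hhid hst hst)))
    · exact key (s 0) w s n hw hs hb hK (hb 0 K)

end HRec

/-! ### Bounded normalization: simple types and a weight that decreases under reduction. -/

namespace HRec

variable {F : Family}

/-! ### A type system with indices for bound variables -/

namespace Tm

/-- The number of occurrences of the index pointing `k` binders up, where those in the branches of a
recursion count twice. -/
def occ : ℕ → Tm F → ℕ
  | k, bvar i => if i = k then 1 else 0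
  | _, fvar _ => 0
  | _, con _ _ => 0
  | k, app M N => occ k M + occ k N
  | k, lam M => occ (k + 1) M
  | k, cond L _ N => occ k L + ∑ i, occ k (N i)
  | k, recu L _ N => occ k L + 2 * ∑ i, occ k (N i)

/-- The number of occurrences of a free variable, where those in the branches of a recursion count
twice. -/
def focc (x : ℕ) : Tm F → ℕ
  | bvar _ => 0
  | fvar y => if y = x then 1 else 0
  | con _ _ => 0
  | app M N => focc x M + focc x N
  | lam M => focc x M
  | cond L _ N => focc x L + ∑ i, focc x (N i)
  | recu L _ N => focc x L + 2 * ∑ i, focc x (N i)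

/-- The nesting depth of the branches of recursions. -/
def rank : Tm F → ℕ
  | bvar _ => 0
  | fvar _ => 0
  | con _ _ => 0
  | app M N => max M.rank N.rank
  | lam M => M.rank
  | cond L _ N => max L.rank (Finset.univ.sup fun i => (N i).rank)
  | recu L _ N => max L.rank ((Finset.univ.sup fun i => (N i).rank) + 1)

theorem size_pos (M : Tm F) : 0 < M.size := by
  induction M with
  | bvar | fvar | con => exact Nat.one_pos
  | app M N hM hN => simp only [size]; omega
  | lam M hM => simp only [size]; omega
  | cond L n N hL hN => simp only [size]; omega
  | recu L n N hL hN => simp only [size]; omega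

theorem apps_append (M : Tm F) (Ns Ns' : List (Tm F)) :
    apps M (Ns ++ Ns') = apps (apps M Ns) Ns' :=
  List.foldl_append

@[simp]
theorem apps_nil (M : Tm F) : apps M [] = M := rfl

@[simp]
theorem apps_cons (M N : Tm F) (Ns : List (Tm F)) : apps M (N :: Ns) = apps (app M N) Ns := rfl

theorem apps_concat (M N : Tm F) (Ns : List (Tm F)) : apps M (Ns ++ [N]) = app (apps M Ns) N := by
  rw [apps_append]; rfl

theorem size_apps (M : Tm F) (Ns : List (Tm F)) :
    (apps M Ns).size = M.size + (Ns.map size).sum := by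
  induction Ns generalizing M with
  | nil => simp
  | cons N Ns ih => simp only [apps_cons, ih, size, List.map_cons, List.sum_cons]; omega

theorem size_openAt_le (V : Tm F) (k : ℕ) (M : Tm F) :
    (openAt V k M).size ≤ M.size * V.size := by
  have hV := V.size_pos
  induction M generalizing k with
  | bvar i => simp only [openAt]; split_ifs <;> simp only [size] <;> omega
  | fvar | con => simpa [openAt, size] using Nat.succ_le_of_lt hV
  | app M N hM hN =>
    simp only [openAt, size, add_mul]
    exact add_le_add (hM k) (hN k)
  | lam M hM =>
    simp only [openAt, size, add_mul]
    exact add_le_add (hM _) (by omega)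
  | cond L n N hL hN | recu L n N hL hN =>
    simp only [openAt, size, add_mul, Finset.sum_mul]
    exact add_le_add (add_le_add (hL k) (Finset.sum_le_sum fun i _ => hN i k))
      (Nat.le_mul_of_pos_right n hV)

end Tm

/-- Simple types for locally nameless terms: `φ` types the free variables and `Δ` the indices.
A variable bound by an abstraction may occur more than once or in a branch of a recursion only if its
type is a base type. -/
inductive HasTy (φ : ℕ → Option (Ty F)) : List (Ty F) → Tm F → Ty F → Prop
  | bvar {Δ : List (Ty F)} {i : ℕ} {A : Ty F} : Δ[i]? = some A → HasTy φ Δ (.bvar i) A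
  | fvar {Δ : List (Ty F)} {x : ℕ} {A : Ty F} : φ x = some A → HasTy φ Δ (.fvar x) A
  | con {Δ : List (Ty F)} (a : F.Alg) (c : F.Cons a) (n : ℕ) :
      HasTy φ Δ (.con a c) (Ty.lin (.base a n) (F.ar c) (.base a n))
  | app {Δ : List (Ty F)} {M N : Tm F} {A B : Ty F} : HasTy φ Δ M (.arr A B) → HasTy φ Δ N A →
      HasTy φ Δ (.app M N) B
  | lam {Δ : List (Ty F)} {M : Tm F} {A B : Ty F} : HasTy φ (A :: Δ) M B →
      (A ∈ baseTypes F ∨ M.occ 0 ≤ 1) → HasTy φ Δ (.lam M) (.arr A B)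
  | cond {Δ : List (Ty F)} {a : F.Alg} {m : ℕ} {C : Ty F} {L : Tm F} {n : ℕ} {N : Fin n → Tm F}
      (hn : n = (F.alg a).numCons) : HasTy φ Δ L (.base a m) →
      (∀ i, HasTy φ Δ (N i) (Ty.lin (.base a m) ((F.alg a).arity (Fin.cast hn i)) C)) →
      HasTy φ Δ (.cond L n N) C
  | recu {Δ : List (Ty F)} {a : F.Alg} {m : ℕ} {C : Ty F} {L : Tm F} {n : ℕ} {N : Fin n → Tm F}
      (hn : n = (F.alg a).numCons) : HasTy φ Δ L (.base a m) →
      (∀ i, HasTy φ Δ (N i) (Ty.lin (.base a m) ((F.alg a).arity (Fin.cast hn i))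
        (Ty.lin C ((F.alg a).arity (Fin.cast hn i)) C))) →
      HasTy φ Δ (.recu L n N) C

namespace Tm

variable {φ : ℕ → Option (Ty F)}

theorem occ_eq_zero_of_hasTy {Δ : List (Ty F)} {M : Tm F} {A : Ty F} (h : HasTy φ Δ M A) {k : ℕ}
    (hk : Δ.length ≤ k) : M.occ k = 0 := by
  induction h generalizing k with
  | bvar h =>
    obtain ⟨hlt, -⟩ := List.getElem?_eq_some_iff.1 h
    simp only [occ, ite_eq_right_iff, one_ne_zero, imp_false]
    omega
  | fvar | con => rfl
  | app _ _ h₁ h₂ => simp [occ, h₁ hk, h₂ hk]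
  | lam _ _ h => exact h (by simpa using hk)
  | cond _ _ _ h₁ h₂ => simp [occ, h₁ hk, fun i => h₂ i hk]
  | recu _ _ _ h₁ h₂ => simp [occ, h₁ hk, fun i => h₂ i hk]

theorem openAt_of_occ_eq_zero (V : Tm F) {k : ℕ} {M : Tm F} (h : M.occ k = 0) :
    openAt V k M = M := by
  induction M generalizing k with
  | bvar i =>
    simp only [occ, ite_eq_right_iff, one_ne_zero, imp_false] at h
    simp [openAt, h]
  | fvar | con => rfl
  | app M N hM hN =>
    simp only [occ, Nat.add_eq_zero_iff] at h
    simp [openAt, hM h.1, hN h.2]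
  | lam M hM => simp [openAt, hM (k := k + 1) h]
  | cond L n N hL hN =>
    simp only [occ, Nat.add_eq_zero_iff, Finset.sum_eq_zero_iff, Finset.mem_univ, true_imp_iff] at h
    simp [openAt, hL h.1, fun i => hN i (h.2 i)]
  | recu L n N hL hN =>
    simp only [occ, Nat.add_eq_zero_iff, Nat.mul_eq_zero, OfNat.ofNat_ne_zero, false_or,
      Finset.sum_eq_zero_iff, Finset.mem_univ, true_imp_iff] at h
    simp [openAt, hL h.1, fun i => hN i (h.2 i)]

theorem occ_openAt {V : Tm F} (hV : ∀ j, V.occ j = 0) {j k : ℕ} (hjk : j ≠ k) (M : Tm F) :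
    (openAt V k M).occ j = M.occ j := by
  induction M generalizing j k with
  | bvar i =>
    simp only [openAt]
    split_ifs with h
    · rw [hV]; simp [occ, h, hjk.symm]
    · rfl
  | fvar | con => rfl
  | app M N hM hN => simp [openAt, occ, hM hjk, hN hjk]
  | lam M hM => exact hM (by omega)
  | cond L n N hL hN => simp [openAt, occ, hL hjk, fun i => hN i hjk]
  | recu L n N hL hN => simp [openAt, occ, hL hjk, fun i => hN i hjk]

end Tm

namespace HasTy

variable {φ : ℕ → Option (Ty F)}

theorem append {Δ : List (Ty F)} {M : Tm F} {A : Ty F} (h : HasTy φ Δ M A) (Δ' : List (Ty F)) :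
    HasTy φ (Δ ++ Δ') M A := by
  induction h with
  | bvar h =>
    obtain ⟨hlt, -⟩ := List.getElem?_eq_some_iff.1 h
    exact bvar (by rwa [List.getElem?_append_left hlt])
  | fvar h => exact fvar h
  | con a c n => exact con a c n
  | app _ _ h₁ h₂ => exact app h₁ h₂
  | lam _ h h₁ => exact lam h₁ h
  | cond hn _ _ h₁ h₂ => exact cond hn h₁ h₂
  | recu hn _ _ h₁ h₂ => exact recu hn h₁ h₂

theorem closed_append {M : Tm F} {A : Ty F} (h : HasTy φ [] M A) (Δ : List (Ty F)) :
    HasTy φ Δ M A := by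
  simpa using h.append Δ

theorem openAt {Δ : List (Ty F)} {M V : Tm F} {A B : Ty F} (h : HasTy φ (Δ ++ [A]) M B)
    (hV : HasTy φ [] V A) : HasTy φ Δ (Tm.openAt V Δ.length M) B := by
  have hV0 : ∀ j, V.occ j = 0 := fun j => Tm.occ_eq_zero_of_hasTy hV (Nat.zero_le j)
  generalize hΔ : Δ ++ [A] = Δ' at h
  induction h generalizing Δ with
  | @bvar Δ₁ i B h =>
    subst hΔ
    simp only [Tm.openAt]
    split_ifs with hi
    · subst hi
      rw [List.getElem?_append_right le_rfl] at h
      simp only [Nat.sub_self, List.getElem?_cons_zero, Option.some.injEq] at h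
      exact h ▸ hV.closed_append Δ
    · obtain ⟨hlt, -⟩ := List.getElem?_eq_some_iff.1 h
      simp only [List.length_append, List.length_cons, List.length_nil, zero_add] at hlt
      rw [List.getElem?_append_left (by omega)] at h
      exact bvar h
  | fvar h => exact fvar h
  | con a c n => exact con a c n
  | app _ _ h₁ h₂ => exact app (h₁ hΔ) (h₂ hΔ)
  | @lam Δ₁ M A' B _ h h₁ =>
    -- The linearity condition on the inner abstraction survives because `V` has no dangling
    -- indices.
    refine lam (h₁ (Δ := A' :: Δ) (by rw [← hΔ]; rfl)) ?_
    rwa [Tm.occ_openAt hV0 (by simp)]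
  | cond hn _ _ h₁ h₂ => exact cond hn (h₁ hΔ) fun i => h₂ i hΔ
  | recu hn _ _ h₁ h₂ => exact recu hn (h₁ hΔ) fun i => h₂ i hΔ

theorem apps_lin {Δ : List (Ty F)} {M : Tm F} {X Y : Ty F} {Ns : List (Tm F)} {n : ℕ}
    (hn : Ns.length = n) (h : HasTy φ Δ M (Ty.lin X n Y)) (hN : ∀ N ∈ Ns, HasTy φ Δ N X) :
    HasTy φ Δ (Tm.apps M Ns) Y := by
  subst hn
  induction Ns generalizing M with
  | nil => exact h
  | cons N Ns ih =>
    exact ih (fun N' hN' => hN N' (List.mem_cons_of_mem _ hN')) (app h (hN N List.mem_cons_self))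

theorem toTm {Δ : List (Ty F)} {a : F.Alg} (t : ETerm F a) (n : ℕ) :
    HasTy φ Δ t.toTm (.base a n) := by
  induction t with
  | mk c ts ih =>
    refine apps_lin (by simp) (con a c n) fun N hN => ?_
    obtain ⟨i, rfl⟩ := List.mem_ofFn.1 hN
    exact ih i

end HasTy

/-- The algebra of the base type at which a type ends. -/
def Ty.target : Ty F → F.Alg
  | base a _ => a
  | arr _ B => B.target

@[simp]
theorem Ty.target_lin (A B : Ty F) (n : ℕ) : (Ty.lin A n B).target = B.target := by
  induction n with
  | zero => rfl
  | succ n ih => exact ih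

theorem HasTy.exists_of_apps {φ : ℕ → Option (Ty F)} {Δ : List (Ty F)} {M : Tm F} {B : Ty F}
    {Ns : List (Tm F)} (h : HasTy φ Δ (Tm.apps M Ns) B) :
    ∃ As, HasTy φ Δ M (As.foldr Ty.arr B) ∧ List.Forall₂ (HasTy φ Δ) Ns As := by
  induction Ns generalizing M with
  | nil => exact ⟨[], h, .nil⟩
  | cons N Ns ih =>
    obtain ⟨As, h₁, h₂⟩ := ih h
    cases h₁ with
    | app h₁ h₃ => exact ⟨_ :: As, h₁, .cons h₃ h₂⟩

theorem Ty.target_foldr (As : List (Ty F)) (B : Ty F) :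
    (As.foldr Ty.arr B).target = B.target := by
  induction As with
  | nil => rfl
  | cons A As ih => exact ih

/-- The target of a type is invariant under supplying arguments. This identifies the algebra of the
redex with the algebra in the typing of a conditional or recursion. -/
theorem HasTy.alg_eq {φ : ℕ → Option (Ty F)} {Δ : List (Ty F)} {a b : F.Alg} {c : F.Cons a} {n : ℕ}
    {Ns : List (Tm F)} (h : HasTy φ Δ (Tm.apps (.con a c) Ns) (.base b n)) : b = a := by
  obtain ⟨As, h, -⟩ := h.exists_of_apps
  generalize hT : As.foldr Ty.arr (.base b n) = T at h
  cases h with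
  | con _ _ m => simpa [Ty.target_foldr, Ty.target] using congrArg Ty.target hT

theorem HasTy.step {φ : ℕ → Option (Ty F)} {M N : Tm F} {A : Ty F} (h : HasTy φ [] M A)
    (hs : Step M N) : HasTy φ [] N A := by
  induction hs generalizing A with
  | beta M hV =>
    cases h with
    | app h₁ h₂ =>
      cases h₁ with
      | lam h₁ _ => exact HasTy.openAt (Δ := []) h₁ h₂
  | cond c ts N =>
    cases h with
    | cond hn h₁ h₂ =>
      obtain rfl := h₁.alg_eq
      refine apps_lin (by simp) (h₂ c) fun N hN => ?_
      obtain ⟨i, rfl⟩ := List.mem_ofFn.1 hN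
      exact toTm _ _
  | recu c ts N =>
    cases h with
    | recu hn h₁ h₂ =>
      obtain rfl := h₁.alg_eq
      rw [Tm.apps_append]
      refine apps_lin (by simp) (apps_lin (by simp) (h₂ c) fun N hN => ?_) fun N hN => ?_
      · obtain ⟨i, rfl⟩ := List.mem_ofFn.1 hN
        exact toTm _ _
      · obtain ⟨i, rfl⟩ := List.mem_ofFn.1 hN
        exact recu hn (toTm _ _) h₂
  | appL L _ ih =>
    cases h with
    | app h₁ h₂ => exact app (ih h₁) h₂
  | appR L _ ih =>
    cases h with
    | app h₁ h₂ => exact app h₁ (ih h₂)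
  | condL n N _ ih =>
    cases h with
    | cond hn h₁ h₂ => exact cond hn (ih h₁) h₂
  | recuL n N _ ih =>
    cases h with
    | recu hn h₁ h₂ => exact recu hn (ih h₁) h₂

/-! ### The weight of a term -/

namespace Tm

open Classical in
/-- The weight of a term, a sequence of numbers that decreases in every reduction step of a typed
term. The branches of a recursion only contribute their rank. -/
noncomputable def weight : Tm F → ℕ → ℕ
  | bvar _ => 0
  | fvar _ => 0
  | con _ _ => 0
  | app M N => M.weight + N.weight
  | lam M => M.weight + Pi.single 0 1
  | cond L n N => L.weight + (∑ i, (N i).weight) + Pi.single 0 n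
  | recu L n N => L.weight + if n = 0 then 0 else if L.IsAlg then
      Pi.single (2 * (Finset.univ.sup fun i => (N i).rank) + 2) L.size else
      Pi.single (2 * (Finset.univ.sup fun i => (N i).rank) + 3) 1

theorem IsAlg.apps {M : Tm F} {Ns : List (Tm F)} (hM : M.IsAlg) (hN : ∀ N ∈ Ns, N.IsAlg) :
    (apps M Ns).IsAlg := by
  induction Ns generalizing M with
  | nil => exact hM
  | cons N Ns ih =>
    exact ih (.app hM (hN N List.mem_cons_self)) fun N' h => hN N' (List.mem_cons_of_mem _ h)

theorem isAlg_toTm {a : F.Alg} (t : ETerm F a) : t.toTm.IsAlg := by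
  induction t with
  | mk c ts ih =>
    refine (IsAlg.con a c).apps fun N hN => ?_
    obtain ⟨i, rfl⟩ := List.mem_ofFn.1 hN
    exact ih i

theorem size_toTm {a : F.Alg} (t : ETerm F a) : t.toTm.size = t.size := by
  induction t with
  | mk c ts ih =>
    rw [ETerm.toTm, ETerm.size, size_apps, List.map_ofFn, List.sum_ofFn, add_comm]
    simp [ih, size]

theorem IsAlg.weight_eq_zero {M : Tm F} (h : M.IsAlg) : M.weight = 0 := by
  induction h with
  | con => rfl
  | app _ _ h₁ h₂ => simp [weight, h₁, h₂]

theorem IsAlg.rank_eq_zero {M : Tm F} (h : M.IsAlg) : M.rank = 0 := by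
  induction h with
  | con => rfl
  | app _ _ h₁ h₂ => simp [rank, h₁, h₂]

theorem IsAlg.openAt_eq {M : Tm F} (h : M.IsAlg) (V : Tm F) (k : ℕ) : openAt V k M = M := by
  induction h with
  | con => rfl
  | app _ _ h₁ h₂ => simp [openAt, h₁, h₂]

theorem IsAlg.not_step {M N : Tm F} (h : M.IsAlg) : ¬ Step M N := by
  intro hs
  induction hs with
  | beta => cases h with | app h _ => cases h
  | appL _ _ ih => cases h with | app h _ => exact ih h
  | appR _ _ ih => cases h with | app _ h => exact ih h
  | _ => cases h

theorem weight_apps (M : Tm F) (Ns : List (Tm F)) :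
    (apps M Ns).weight = M.weight + (Ns.map weight).sum := by
  induction Ns generalizing M with
  | nil => simp
  | cons N Ns ih => simp [ih, weight, add_assoc]

/-- A recursion with branches of rank at most r has rank at least r+1 and uses the positions 2r+2
and 2r+3, the last two up to 2(r+1)+1. -/
theorem weight_eq_zero_of_lt {M : Tm F} {j : ℕ} (h : 2 * M.rank + 1 < j) : M.weight j = 0 := by
  induction M generalizing j with
  | bvar | fvar | con => rfl
  | app M N hM hN =>
    simp only [rank] at h
    simp only [weight, Pi.add_apply]
    rw [hM (by omega), hN (by omega)]
  | lam M hM =>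
    simp only [rank] at h
    simp only [weight, Pi.add_apply]
    rw [hM h, Pi.single_eq_of_ne (by omega), add_zero]
  | cond L n N hL hN =>
    simp only [rank] at h
    simp only [weight, Pi.add_apply, Finset.sum_apply]
    have hN' : ∀ i, (N i).weight j = 0 := fun i => hN i (by
      have := Finset.le_sup (f := fun i => (N i).rank) (Finset.mem_univ i)
      omega)
    simp [hL (j := j) (by omega), hN', Pi.single_eq_of_ne (show j ≠ 0 by omega)]
  | recu L n N hL hN =>
    simp only [rank] at h
    simp only [weight, Pi.add_apply]
    rw [hL (by omega)]
    split_ifs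
    · rfl
    · rw [Pi.single_eq_of_ne (by omega), add_zero]
    · rw [Pi.single_eq_of_ne (by omega), add_zero]

/-- A recursion without branches adds nothing to the size of its argument; this is why it carries no
entry of its own in the weight. Otherwise n ≥ 1 pays for the entry 1 of an unevaluated argument, and
a constructor term has weight zero, so that its size is available for the other entry. -/
theorem weight_le_size (M : Tm F) (j : ℕ) : M.weight j ≤ M.size := by
  have hsingle : ∀ (i m : ℕ), (Pi.single i m : ℕ → ℕ) j ≤ m := fun i m => by
    rw [Pi.single_apply]; split_ifs <;> omega
  induction M with
  | bvar | fvar | con => exact Nat.zero_le _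
  | app M N hM hN => exact add_le_add hM hN
  | lam M hM => exact add_le_add hM (hsingle _ _)
  | cond L n N hL hN =>
    simp only [weight, Pi.add_apply, Finset.sum_apply, size]
    exact add_le_add (add_le_add hL (Finset.sum_le_sum fun i _ => hN i)) (hsingle _ _)
  | recu L n N hL hN =>
    simp only [weight, Pi.add_apply, size]
    split_ifs with h₁ h₂
    · simp only [Pi.zero_apply]; omega
    · rw [h₂.weight_eq_zero]
      have := hsingle (2 * (Finset.univ.sup fun i => (N i).rank) + 2) L.size
      simp only [Pi.zero_apply]
      omega
    · have := hsingle (2 * (Finset.univ.sup fun i => (N i).rank) + 3) 1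
      omega

theorem rank_openAt {V : Tm F} (hV : V.rank = 0) (k : ℕ) (M : Tm F) :
    (openAt V k M).rank = M.rank := by
  induction M generalizing k with
  | bvar i => simp only [openAt]; split_ifs <;> simp [rank, hV]
  | fvar | con => rfl
  | app M N hM hN => simp [openAt, rank, hM, hN]
  | lam M hM => exact hM _
  | cond L n N hL hN => simp [openAt, rank, hL, hN]
  | recu L n N hL hN => simp [openAt, rank, hL, hN]

/-- Since occurrences in recursion branches count twice, `occ k ≤ 1` excludes them there. Thus in
both cases the ranks of the branches, and with them the positions of the entries, are unchanged by
the substitution. -/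
theorem colexLe_weight_openAt {V : Tm F} {k : ℕ} {M : Tm F}
    (h : V.weight = 0 ∧ V.rank = 0 ∨ M.occ k ≤ 1) :
    ColexLe (openAt V k M).weight (M.weight + M.occ k • V.weight) := by
  induction M generalizing k with
  | bvar i =>
    simp only [openAt, occ]
    split_ifs
    · simpa [weight] using ColexLe.refl _
    · simpa using ColexLe.refl _
  | fvar | con => simpa [occ, openAt] using ColexLe.refl _
  | app M N hM hN =>
    simp only [openAt, weight, occ, add_smul] at h ⊢
    rw [add_add_add_comm]
    exact (hM (h.imp_right (by omega))).add (hN (h.imp_right (by omega)))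
  | lam M hM =>
    simp only [openAt, weight, occ] at h ⊢
    rw [add_right_comm]
    exact (hM h).add_right _
  | cond L n N hL hN =>
    simp only [openAt, weight, occ, add_smul, Finset.sum_smul] at h ⊢
    rw [add_right_comm _ (Pi.single (M := fun _ => ℕ) 0 n), add_add_add_comm, ← Finset.sum_add_distrib]
    refine ((hL (h.imp_right (by omega))).add (ColexLe.sum _ fun i _ => hN i ?_)).add_right _
    refine h.imp_right fun h => ?_
    have := Finset.single_le_sum (f := fun i => (N i).occ k) (fun i _ => Nat.zero_le _)
      (Finset.mem_univ i)
    omega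
  | recu L n N hL hN =>
    have hr : ∀ i, (openAt V k (N i)).rank = (N i).rank := by
      intro i
      rcases h with h | h
      · exact rank_openAt h.2 _ _
      · simp only [occ] at h
        have := Finset.single_le_sum (f := fun i => (N i).occ k) (fun i _ => Nat.zero_le _)
          (Finset.mem_univ i)
        rw [openAt_of_occ_eq_zero V (by omega)]
    -- Branches of a recursion do not contribute to the weight, so the copies counted for them must
    -- contribute nothing on the right either.
    have hocc : (2 * ∑ i, (N i).occ k) • V.weight = 0 := by
      rcases h with h | h
      · simp [h.1]
      · simp only [occ] at h
        rw [show ∑ i, (N i).occ k = 0 by omega]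
        simp
    simp only [openAt, weight, occ, add_smul, hr, hocc, add_zero]
    have hL' := hL (k := k) (h.imp_right fun h => by simp only [occ] at h; omega)
    rw [add_right_comm]
    by_cases hn : n = 0
    · simpa [hn] using hL'
    by_cases h₁ : L.IsAlg
    · simp only [hn, if_false, h₁, if_true, h₁.openAt_eq]
      rw [h₁.openAt_eq] at hL'
      exact hL'.add_right _
    by_cases h₂ : (openAt V k L).IsAlg
    · simp only [hn, if_false, h₁, h₂, if_true, h₂.weight_eq_zero, zero_add]
      -- The substitution turns the argument into a constructor term: a 1 at position 2r+3 becomes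
      -- an arbitrarily large entry at position 2r+2, a colexicographic decrease.
      refine ColexLe.trans (g := Pi.single (2 * (Finset.univ.sup fun i => (N i).rank) + 3) 1)
        (Or.inr ⟨2 * (Finset.univ.sup fun i => (N i).rank) + 3, by simp, fun j hj => ?_⟩) ?_
      · rw [Pi.single_eq_of_ne (by omega), Pi.single_eq_of_ne (by omega)]
      · refine ColexLe.of_le (K := 2 * (max (max L.rank V.rank)
          (Finset.univ.sup fun i => (N i).rank)) + 4) (fun j => ?_) fun j hj => ?_
        · simp
        · simp only [Pi.add_apply, Pi.smul_apply]
          rw [weight_eq_zero_of_lt (M := L) (by omega), weight_eq_zero_of_lt (M := V) (by omega)]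
          simp
    · simp only [hn, if_false, h₁, h₂]
      exact hL'.add_right _

end Tm

open Tm

/-- Beta and conditional steps decrease position 0 without an increase above it, the unit of the
abstraction or the number n of branches being lost; a substitution may only lower the entries of
recursions. A recursion with branches of maximal rank r decreases position 2r+2 when it is unfolded.
-/
theorem Step.colexLt_weight {φ : ℕ → Option (Ty F)} {M N : Tm F} (hs : Step M N) {A : Ty F}
    (h : HasTy φ [] M A) : ColexLt N.weight M.weight := by
  induction hs generalizing A with
  | @beta B V hV =>
    cases h with
    | app h₁ h₂ =>
      cases h₁ with
      | @lam _ _ A' _ h₁ hA =>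
        have hz : V.weight = 0 ∧ V.rank = 0 ∨ B.occ 0 ≤ 1 := by
          cases hV with
          | fvar x => exact Or.inl ⟨rfl, rfl⟩
          | alg hV => exact Or.inl ⟨hV.weight_eq_zero, hV.rank_eq_zero⟩
          -- An abstraction has an arrow type, so the bound variable is not of base type and is used
          -- linearly.
          | lam V =>
            refine Or.inr (hA.resolve_left ?_)
            rintro ⟨a, n, rfl⟩
            cases h₂
        have h3 := colexLe_weight_openAt hz
        -- Either `V` has weight zero or it is copied at most once, so one copy of its weight
        -- suffices.
        refine (h3.trans (k := B.weight + V.weight) ?_).trans_lt ?_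
        · refine ColexLe.of_le (K := 2 * V.rank + 2) (fun j => ?_) fun j hj => ?_
          · simp only [Pi.add_apply, Pi.smul_apply, smul_eq_mul]
            rcases hz with hz | hz
            · simp [hz.1]
            · have := Nat.mul_le_mul_right (V.weight j) hz
              omega
          · simp [weight_eq_zero_of_lt (M := V) (show 2 * V.rank + 1 < j by omega)]
        · simp only [weight]
          rw [add_right_comm]
          refine ⟨0, by simp, fun j hj => ?_⟩
          simp [Pi.single_eq_of_ne (show j ≠ 0 by omega)]
  | @cond a c ts N =>
    have hn : 0 < (F.alg a).numCons := c.pos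
    rw [weight_apps]
    have hz : ((List.ofFn fun j => (ts j).toTm).map weight).sum = 0 := by
      rw [List.map_ofFn, List.sum_ofFn]
      simp [(isAlg_toTm _).weight_eq_zero]
    rw [hz]
    simp only [weight, (isAlg_toTm _).weight_eq_zero, zero_add, add_zero]
    refine ColexLe.trans_lt (g := ∑ i, (N i).weight) ?_
      ⟨0, by simpa using hn, fun j hj => by simp [Pi.single_eq_of_ne (show j ≠ 0 by omega)]⟩
    refine ColexLe.of_le (K := 2 * (Finset.univ.sup fun i => (N i).rank) + 2)
      (Finset.single_le_sum (f := fun i => (N i).weight) (fun i _ => fun _ => Nat.zero_le _)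
        (Finset.mem_univ c)) fun j hj => ?_
    have hle : ∀ i, (N i).weight j = 0 := fun i => weight_eq_zero_of_lt (by
      have := Finset.le_sup (f := fun i => (N i).rank) (Finset.mem_univ i)
      omega)
    simp [hle]
  | @recu a c ts N =>
    have hn : (F.alg a).numCons ≠ 0 := c.pos.ne'
    rw [weight_apps]
    have hz : ((List.ofFn fun j => (ts j).toTm).map weight).sum = 0 := by
      rw [List.map_ofFn, List.sum_ofFn]
      simp [(isAlg_toTm _).weight_eq_zero]
    rw [List.map_append, List.sum_append, hz, List.map_ofFn, List.sum_ofFn]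
    simp only [weight, (isAlg_toTm _).weight_eq_zero, zero_add, hn, if_false, isAlg_toTm,
      if_true, Function.comp_def, size_toTm, ETerm.size]
    -- At this position the recursive calls contribute the sum of the sizes of the subterms, one
    -- less than the size of the old argument; the released branch vanishes here and above.
    refine ⟨2 * (Finset.univ.sup fun i => (N i).rank) + 2, ?_, fun j hj => ?_⟩
    · have := Finset.le_sup (f := fun i => (N i).rank) (Finset.mem_univ c)
      simp [weight_eq_zero_of_lt (M := N c)
        (show 2 * (N c).rank + 1 < 2 * (Finset.univ.sup fun i => (N i).rank) + 2 by omega)]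
    · have := Finset.le_sup (f := fun i => (N i).rank) (Finset.mem_univ c)
      simp [weight_eq_zero_of_lt (M := N c) (show 2 * (N c).rank + 1 < j by omega),
        Pi.single_eq_of_ne (show j ≠ 2 * (Finset.univ.sup fun i => (N i).rank) + 2 by omega)]
  | appL L _ ih =>
    cases h with
    | app h₁ h₂ => exact (ih h₁).add_right _
  | appR L _ ih =>
    cases h with
    | app h₁ h₂ =>
      simp only [weight]
      rw [add_comm, add_comm L.weight]
      exact (ih h₂).add_right _
  | condL n N _ ih =>
    cases h with
    | cond hn h₁ h₂ =>
      simp only [weight, add_assoc]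
      exact (ih h₁).add_right _
  | @recuL M M' n N hs ih =>
    cases h with
    | recu hn h₁ h₂ =>
      have hM : ¬ M.IsAlg := fun hM => hM.not_step hs
      simp only [weight, hM, if_false]
      by_cases hn : n = 0
      · simpa [hn] using ih h₁
      simp only [hn, if_false]
      refine (ih h₁).add_le ?_
      split_ifs
      -- The argument has just become a constructor term, so the entry moves from position 2r+3 down
      -- to 2r+2.
      · refine Or.inr ⟨2 * (Finset.univ.sup fun i => (N i).rank) + 3, by simp, fun j hj => ?_⟩
        rw [Pi.single_eq_of_ne (by omega), Pi.single_eq_of_ne (by omega)]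
      · exact .refl _

/-- Beta multiplies two sizes at worst; unfolding copies the branches once for each immediate
subterm of the argument. Evaluation contexts only add the same number on both sides, which `hctx`
absorbs. -/
theorem Step.size_le {M N : Tm F} (hs : Step M N) : N.size ≤ (M.size + 2) ^ 2 := by
  have hctx : ∀ {m m' : ℕ}, m' ≤ (m + 2) ^ 2 → ∀ k, m' + k ≤ (m + k + 2) ^ 2 := by
    intro m m' h k
    nlinarith [Nat.zero_le (m * k), Nat.zero_le (k * k)]
  induction hs with
  | beta M hV =>
    refine (size_openAt_le _ _ _).trans ?_
    simp only [size]
    nlinarith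
  | @cond a c ts N =>
    rw [size_apps, List.map_ofFn, List.sum_ofFn]
    simp only [Function.comp_def, size_toTm, size, ETerm.size]
    have : (N c).size ≤ ∑ i : Fin (F.alg a).numCons, (N i).size :=
      Finset.single_le_sum (f := fun i => (N i).size) (fun i _ => Nat.zero_le _) (Finset.mem_univ c)
    refine le_trans ?_ (Nat.le_self_pow two_ne_zero _)
    omega
  | @recu a c ts N =>
    rw [size_apps, List.map_append, List.sum_append, List.map_ofFn, List.map_ofFn, List.sum_ofFn,
      List.sum_ofFn]
    simp only [Function.comp_def, size_toTm, size, ETerm.size, Finset.sum_add_distrib,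
      Finset.sum_const, Finset.card_univ, Fintype.card_fin, smul_eq_mul]
    have h1 := Finset.single_le_sum (f := fun i => (N i).size) (fun i _ => Nat.zero_le _)
      (Finset.mem_univ c)
    have h2 : F.ar c ≤ ∑ j, (ts j).size := by
      calc F.ar c = ∑ j : Fin (F.ar c), 1 := by simp
        _ ≤ _ := Finset.sum_le_sum fun j _ => by
          rw [← size_toTm]; exact size_pos _
    generalize ∑ j, (ts j).size = p at *
    generalize ∑ j, (N j).size = q at *
    nlinarith [Nat.mul_le_mul_right q h2, Nat.mul_le_mul_right (F.alg a).numCons h2]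
  | appL L _ ih => exact hctx ih _
  | appR L _ ih =>
    simp only [size]
    rw [add_comm, add_comm L.size]
    exact hctx ih _
  | condL n N _ ih | recuL n N _ ih =>
    simp only [size, add_assoc]
    simpa only [add_assoc] using hctx ih ((∑ i, (N i).size) + n)

theorem Steps.exists_seq {n : ℕ} {M N : Tm F} (h : Steps n M N) :
    ∃ x : ℕ → Tm F, x 0 = M ∧ (∀ i, n ≤ i → x i = N) ∧ ∀ i < n, Step (x i) (x (i + 1)) := by
  induction h with
  | refl M => exact ⟨fun _ => M, rfl, fun _ _ => rfl, fun i hi => absurd hi (Nat.not_lt_zero i)⟩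
  | @tail n M N L _ hs ih =>
    obtain ⟨x, h₀, h₁, h₂⟩ := ih
    refine ⟨fun i => if i ≤ n then x i else L, by simp [h₀], fun i hi => if_neg (by omega),
      fun i hi => ?_⟩
    rcases (Nat.lt_succ_iff.1 hi).eq_or_lt with rfl | hi'
    · simpa [h₁ i le_rfl] using hs
    · simpa [hi'.le, Nat.succ_le_of_lt hi'] using h₂ i hi'

/-- The weights along a reduction form a colexicographic descent controlled by the sizes. The final
size is then bounded by iterating the growth of one step as often as there can be steps. -/
theorem exists_primrec_steps_le (F : Family) (d : ℕ) : ∃ q : ℕ → ℕ, Primrec q ∧ Monotone q ∧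
    ∀ (φ : ℕ → Option (Ty F)) (M : Tm F) (A : Ty F), HasTy φ [] M A → M.rank ≤ d →
      ∀ (n : ℕ) (N : Tm F), Steps n M N → n ≤ q M.size ∧ N.size ≤ q M.size := by
  let g : ℕ → ℕ := fun s => (s + 2) ^ 2
  have hg : Primrec g := by
    refine (Primrec.nat_mul.comp (Primrec.nat_add.comp Primrec.id (Primrec.const 2))
      (Primrec.nat_add.comp Primrec.id (Primrec.const 2))).of_eq fun s => ?_
    simp [g, sq]
  have hm : Monotone g := fun s t h => Nat.pow_le_pow_left (by omega) 2
  have hid : ∀ s, s ≤ g s := fun s => by simp only [g]; nlinarith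
  -- Weights of terms of rank at most `d` live at the positions 0, ..., 2d+1.
  obtain ⟨T, hT, hTm, hTb⟩ := exists_primrec_descent hg hm hid (2 * d + 2)
  refine ⟨fun s => T s + g^[T s] s, ?_, ?_, fun φ M A hM hr n N hN => ?_⟩
  · exact Primrec.nat_add.comp hT (Primrec.nat_iterate hT Primrec.id (hg.comp₂ Primrec₂.right))
  · exact fun s t h => add_le_add (hTm h) (iterate_le_iterate_of_le hm hid (hTm h) h)
  obtain ⟨x, h₀, h₁, h₂⟩ := hN.exists_seq
  have hty : ∀ i ≤ n, HasTy φ [] (x i) A := by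
    intro i
    induction i with
    | zero => intro _; rwa [h₀]
    | succ i ih => intro hi; exact (ih (by omega)).step (h₂ i (by omega))
  have hw : ∀ i < n, ColexLt (x (i + 1)).weight (x i).weight :=
    fun i hi => (h₂ i hi).colexLt_weight (hty i hi.le)
  have hs : ∀ i < n, (x (i + 1)).size ≤ g (x i).size := fun i hi => (h₂ i hi).size_le
  -- The rank need not be followed along the reduction: in a colexicographic descent no entry above
  -- the support of the first weight can ever become positive.
  have hz : ∀ i ≤ n, ∀ j, 2 * d + 2 ≤ j → (x i).weight j = 0 := by
    intro i
    induction i with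
    | zero => intro _ j hj; rw [h₀]; exact weight_eq_zero_of_lt (by omega)
    | succ i ih =>
      intro hi j hj
      obtain ⟨p, hp, hq⟩ := hw i (by omega)
      have hpj : p < j := by
        by_contra hle
        have := ih (by omega) p (by omega)
        omega
      rw [hq j hpj, ih (by omega) j hj]
  have hn : n ≤ T M.size := by
    have := hTb (fun i => (x i).weight) (fun i => (x i).size) n hw hs
      (fun i j => weight_le_size _ _)
      (fun i hi j hj => by rw [hz i hi j hj, hz 0 (Nat.zero_le _) j hj])
    rwa [h₀] at this
  refine ⟨hn.trans (Nat.le_add_right _ _), ?_⟩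
  have := le_iterate_of_forall_succ_le (s := fun i => (x i).size) hm hs
  simp only [h₀, h₁ n le_rfl] at this
  exact (this.trans (iterate_le_iterate_of_le hm hid hn le_rfl)).trans (Nat.le_add_left _ _)

end HRec

namespace HRec

variable {F : Family}

/-! ### From derivations to simple types -/

namespace Tm

theorem occ_closeAt_of_ne {j k : ℕ} (h : j ≠ k) (x : ℕ) (M : Tm F) :
    (closeAt x k M).occ j = M.occ j := by
  induction M generalizing j k with
  | fvar y => simp only [closeAt]; split_ifs <;> simp [occ, h.symm]
  | bvar | con => rfl
  | app M N hM hN => simp [closeAt, occ, hM h, hN h]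
  | lam M hM => exact hM (by omega)
  | cond L n N hL hN => simp [closeAt, occ, hL h, fun i => hN i h]
  | recu L n N hL hN => simp [closeAt, occ, hL h, fun i => hN i h]

theorem occ_closeAt_self (k x : ℕ) (M : Tm F) :
    (closeAt x k M).occ k = M.occ k + M.focc x := by
  induction M generalizing k with
  | fvar y => simp only [closeAt]; split_ifs with h <;> simp [occ, focc, h]
  | bvar | con => rfl
  | app M N hM hN => simp only [closeAt, occ, focc, hM, hN]; omega
  | lam M hM => exact hM _
  | cond L n N hL hN =>
    simp only [closeAt, occ, focc, hL, hN, Finset.sum_add_distrib]; omega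
  | recu L n N hL hN =>
    simp only [closeAt, occ, focc, hL, hN, Finset.sum_add_distrib]; omega

theorem focc_closeAt_of_ne {x y : ℕ} (h : y ≠ x) (k : ℕ) (M : Tm F) :
    (closeAt x k M).focc y = M.focc y := by
  induction M generalizing k with
  | fvar z =>
    simp only [closeAt]
    split_ifs with hz
    · subst hz; simp [focc, h.symm]
    · rfl
  | bvar | con => rfl
  | app M N hM hN => simp [closeAt, focc, hM, hN]
  | lam M hM => exact hM _
  | cond L n N hL hN => simp [closeAt, focc, hL, hN]
  | recu L n N hL hN => simp [closeAt, focc, hL, hN]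

theorem focc_closeAt_self (x k : ℕ) (M : Tm F) : (closeAt x k M).focc x = 0 := by
  induction M generalizing k with
  | fvar z => simp only [closeAt]; split_ifs with hz <;> simp [focc, hz]
  | bvar | con => rfl
  | app M N hM hN => simp [closeAt, focc, hM, hN]
  | lam M hM => exact hM _
  | cond L n N hL hN => simp [closeAt, focc, hL, hN]
  | recu L n N hL hN => simp [closeAt, focc, hL, hN]

theorem rank_closeAt (x k : ℕ) (M : Tm F) : (closeAt x k M).rank = M.rank := by
  induction M generalizing k with
  | fvar z => simp only [closeAt]; split_ifs <;> rfl
  | bvar | con => rfl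
  | app M N hM hN => simp [closeAt, rank, hM, hN]
  | lam M hM => exact hM _
  | cond L n N hL hN => simp [closeAt, rank, hL, hN]
  | recu L n N hL hN => simp [closeAt, rank, hL, hN]

theorem size_closeAt (x k : ℕ) (M : Tm F) : (closeAt x k M).size = M.size := by
  induction M generalizing k with
  | fvar z => simp only [closeAt]; split_ifs <;> rfl
  | bvar | con => rfl
  | app M N hM hN => simp [closeAt, size, hM, hN]
  | lam M hM => simp [closeAt, size, hM]
  | cond L n N hL hN => simp [closeAt, size, hL, hN]
  | recu L n N hL hN => simp [closeAt, size, hL, hN]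

theorem occ_rename (f : ℕ → ℕ) (k : ℕ) (M : Tm F) : (M.rename f).occ k = M.occ k := by
  induction M generalizing k with
  | fvar | bvar | con => rfl
  | app M N hM hN => simp [rename, occ, hM, hN]
  | lam M hM => exact hM _
  | cond L n N hL hN => simp [rename, occ, hL, hN]
  | recu L n N hL hN => simp [rename, occ, hL, hN]

theorem rank_rename (f : ℕ → ℕ) (M : Tm F) : (M.rename f).rank = M.rank := by
  induction M with
  | fvar | bvar | con => rfl
  | app M N hM hN => simp [rename, rank, hM, hN]
  | lam M hM => exact hM
  | cond L n N hL hN => simp [rename, rank, hL, hN]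
  | recu L n N hL hN => simp [rename, rank, hL, hN]

theorem size_rename (f : ℕ → ℕ) (M : Tm F) : (M.rename f).size = M.size := by
  induction M with
  | fvar | bvar | con => rfl
  | app M N hM hN => simp [rename, size, hM, hN]
  | lam M hM => simp [rename, size, hM]
  | cond L n N hL hN => simp [rename, size, hL, hN]
  | recu L n N hL hN => simp [rename, size, hL, hN]

theorem focc_rename {f : ℕ → ℕ} {y : ℕ} (h : ∀ v, f v = y ↔ v = y) (M : Tm F) :
    (M.rename f).focc y = M.focc y := by
  induction M with
  | fvar v => simp [rename, focc, h]
  | bvar | con => rfl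
  | app M N hM hN => simp [rename, focc, hM, hN]
  | lam M hM => exact hM
  | cond L n N hL hN => simp [rename, focc, hL, hN]
  | recu L n N hL hN => simp [rename, focc, hL, hN]

theorem focc_rename_eq_zero {f : ℕ → ℕ} {y : ℕ} {M : Tm F} (h : ∀ v, f v = y → M.focc v = 0) :
    (M.rename f).focc y = 0 := by
  induction M with
  | fvar v =>
    simp only [rename, focc, ite_eq_right_iff, one_ne_zero, imp_false]
    exact fun hv => by simpa [focc] using h v hv
  | bvar | con => rfl
  | app M N hM hN =>
    simp only [focc, Nat.add_eq_zero_iff] at h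
    simp [rename, focc, hM fun v hv => (h v hv).1, hN fun v hv => (h v hv).2]
  | lam M hM => exact hM h
  | cond L n N hL hN =>
    simp only [focc, Nat.add_eq_zero_iff, Finset.sum_eq_zero_iff, Finset.mem_univ,
      true_imp_iff] at h
    simp [rename, focc, hL fun v hv => (h v hv).1, fun i => hN i fun v hv => (h v hv).2 i]
  | recu L n N hL hN =>
    simp only [focc, Nat.add_eq_zero_iff, Nat.mul_eq_zero, OfNat.ofNat_ne_zero, false_or,
      Finset.sum_eq_zero_iff, Finset.mem_univ, true_imp_iff] at h
    simp [rename, focc, hL fun v hv => (h v hv).1, fun i => hN i fun v hv => (h v hv).2 i]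

end Tm

namespace HasTy

theorem closeAt {φ : ℕ → Option (Ty F)} {x : ℕ} {A B : Ty F} {Δ : List (Ty F)} {M : Tm F}
    (h : HasTy (Function.update φ x (some A)) Δ M B) :
    HasTy φ (Δ ++ [A]) (Tm.closeAt x Δ.length M) B := by
  induction h with
  | bvar h =>
    obtain ⟨hlt, -⟩ := List.getElem?_eq_some_iff.1 h
    exact bvar (by rwa [List.getElem?_append_left hlt])
  | @fvar Δ y B h =>
    simp only [Tm.closeAt]
    split_ifs with hy
    · subst hy
      exact bvar (by simpa using h)
    · exact fvar (by simpa [hy] using h)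
  | con a c n => exact con a c n
  | app _ _ h₁ h₂ => exact app h₁ h₂
  | lam _ h h₁ => exact lam h₁ (by rwa [Tm.occ_closeAt_of_ne (by simp)])
  | cond hn _ _ h₁ h₂ => exact cond hn h₁ h₂
  | recu hn _ _ h₁ h₂ => exact recu hn h₁ h₂

theorem rename {φ : ℕ → Option (Ty F)} {f : ℕ → ℕ} {A : Ty F} {Δ : List (Ty F)} {M : Tm F}
    (h : HasTy (φ ∘ f) Δ M A) : HasTy φ Δ (M.rename f) A := by
  induction h with
  | bvar h => exact bvar h
  | fvar h => exact fvar h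
  | con a c n => exact con a c n
  | app _ _ h₁ h₂ => exact app h₁ h₂
  | lam _ h h₁ => exact lam h₁ (by rwa [Tm.occ_rename])
  | cond hn _ _ h₁ h₂ => exact cond hn h₁ h₂
  | recu hn _ _ h₁ h₂ => exact recu hn h₁ h₂

end HasTy

theorem mem_names_of_mem {Γ : Ctx F} {p : ℕ × Ty F} (h : p ∈ Γ) : p.1 ∈ names Γ :=
  Multiset.mem_map_of_mem _ h

@[simp]
theorem names_cons (p : ℕ × Ty F) (Γ : Ctx F) : names (p ::ₘ Γ) = p.1 ::ₘ names Γ :=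
  Multiset.map_cons _ _ _

@[simp]
theorem names_add (Γ Δ : Ctx F) : names (Γ + Δ) = names Γ + names Δ :=
  Multiset.map_add _ _ _

theorem names_sum {ι : Type*} (t : Finset ι) (Γ : ι → Ctx F) :
    names (∑ i ∈ t, Γ i) = ∑ i ∈ t, names (Γ i) :=
  map_sum (Multiset.mapAddMonoidHom Prod.fst) Γ t

theorem names_nodup_of_sum {n : ℕ} {Γ : Fin n → Ctx F} {Δ : Ctx F}
    (h : (names ((∑ i, Γ i) + Δ)).Nodup) (i : Fin n) {x : ℕ} (hx : x ∈ names (Γ i)) :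
    x ∉ names Δ ∧ ∀ j, j ≠ i → x ∉ names (Γ j) := by
  classical
  rw [names_add, names_sum, ← Finset.add_sum_erase _ _ (Finset.mem_univ i),
    Multiset.nodup_add, Multiset.nodup_add] at h
  refine ⟨fun hΔ => Multiset.disjoint_left.1 h.2.2 (Multiset.mem_add.2 (Or.inl hx)) hΔ,
    fun j hj hxj => Multiset.disjoint_left.1 h.1.2.2 hx ?_⟩
  exact Multiset.mem_sum.2 ⟨j, by simpa using hj, hxj⟩

namespace Der

theorem nodup_names {D : Set (Ty F)} {Γ : Ctx F} {M : Tm F} {A : Ty F} (π : Der D Γ M A) :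
    (names Γ).Nodup := by
  induction π with
  | ax x A => simp [names]
  | weak x A hx π ih => simpa using ⟨hx, ih⟩
  | contr x y z A hA hz π ih =>
    simp only [names_cons, Multiset.nodup_cons] at ih ⊢
    exact ⟨hz, ih.2.2⟩
  | lam x A B π ih =>
    simp only [names_cons, Multiset.nodup_cons] at ih
    exact ih.2
  | app A B h | cond a m C h | recu a m C h => exact h
  | con => simp [names]

theorem focc_eq_zero {D : Set (Ty F)} {Γ : Ctx F} {M : Tm F} {A : Ty F} (π : Der D Γ M A) {y : ℕ}
    (hy : y ∉ names Γ) : M.focc y = 0 := by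
  induction π generalizing y with
  | ax x A =>
    simp only [names, Multiset.map_singleton, Multiset.mem_singleton] at hy
    simp [Tm.focc, Ne.symm hy]
  | weak x A hx π ih =>
    simp only [names_cons, Multiset.mem_cons, not_or] at hy
    exact ih hy.2
  | contr x y' z A hA hz π ih =>
    simp only [names_cons, Multiset.mem_cons, not_or] at hy ih
    refine Tm.focc_rename_eq_zero fun v hv => ?_
    split_ifs at hv with h
    · exact absurd hv.symm hy.1
    · rw [not_or] at h
      exact ih ⟨h.1, h.2, hv ▸ hy.2⟩
  | lam x A B π ih =>
    change (Tm.closeAt _ _ _).focc _ = 0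
    by_cases hxy : y = x
    · rw [hxy]; exact Tm.focc_closeAt_self _ _ _
    · rw [Tm.focc_closeAt_of_ne hxy]
      exact ih (by simpa [hxy] using hy)
  | app A B h π₁ π₂ ih₁ ih₂ =>
    simp only [names_add, Multiset.mem_add, not_or] at hy
    simp [Tm.focc, ih₁ hy.1, ih₂ hy.2]
  | con => rfl
  | cond a m C h πs π ihs ih =>
    simp only [names_add, names_sum, Multiset.mem_add, not_or, Multiset.mem_sum, not_exists,
      Finset.mem_univ, true_and] at hy
    simp [Tm.focc, ih hy.2, fun i => ihs i (hy.1 i)]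
  | recu a m C h hD πs π ihs ih =>
    simp only [names_add, names_sum, Multiset.mem_add, not_or, Multiset.mem_sum, not_exists,
      Finset.mem_univ, true_and] at hy
    simp [Tm.focc, ih hy.2, fun i => ihs i (hy.1 i)]

/-- Variables whose type is not a base type are used at most once, and not in the branches of a
recursion. -/
theorem focc_le_one {Γ : Ctx F} {M : Tm F} {A : Ty F} (π : Der (baseTypes F) Γ M A)
    {p : ℕ × Ty F} (hp : p ∈ Γ) (hb : p.2 ∉ baseTypes F) : M.focc p.1 ≤ 1 := by
  induction π with
  | ax x A => simp only [Tm.focc]; split_ifs <;> simp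
  | weak x A hx π ih =>
    rcases Multiset.mem_cons.1 hp with rfl | hp
    · rw [π.focc_eq_zero hx]; exact zero_le_one
    · exact ih hp
  | contr x y z A hA hz π ih =>
    rcases Multiset.mem_cons.1 hp with rfl | hp
    · exact absurd hA hb
    · have hnd := π.nodup_names
      simp only [names_cons, Multiset.nodup_cons, Multiset.mem_cons, not_or] at hnd
      have hpn := mem_names_of_mem hp
      have hx : p.1 ≠ x := fun h => hnd.1.2 (h ▸ hpn)
      have hy : p.1 ≠ y := fun h => hnd.2.1 (h ▸ hpn)
      have hpz : p.1 ≠ z := fun h => hz (h ▸ hpn)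
      rw [Tm.focc_rename]
      · exact ih (Multiset.mem_cons_of_mem (Multiset.mem_cons_of_mem hp))
      · intro v
        split_ifs with h
        · constructor
          · exact fun h' => absurd h'.symm hpz
          · rintro rfl
            rcases h with h | h
            exacts [absurd h hx, absurd h hy]
        · rfl
  | lam x A B π ih =>
    change (Tm.closeAt _ _ _).focc _ ≤ 1
    have hnd := π.nodup_names
    simp only [names_cons, Multiset.nodup_cons] at hnd
    rw [Tm.focc_closeAt_of_ne fun h => hnd.1 (by rw [← h]; exact mem_names_of_mem hp)]
    exact ih (Multiset.mem_cons_of_mem hp)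
  | app A B h π₁ π₂ ih₁ ih₂ =>
    simp only [names_add, Multiset.nodup_add] at h
    rcases Multiset.mem_add.1 hp with hp | hp
    · simp only [Tm.focc]
      rw [π₂.focc_eq_zero (Multiset.disjoint_left.1 h.2.2 (mem_names_of_mem hp)), add_zero]
      exact ih₁ hp
    · simp only [Tm.focc]
      rw [π₁.focc_eq_zero fun h' => Multiset.disjoint_left.1 h.2.2 h' (mem_names_of_mem hp),
        zero_add]
      exact ih₂ hp
  | con => exact Nat.zero_le _
  | cond a m C h πs π ihs ih =>
    simp only [Tm.focc]
    rcases Multiset.mem_add.1 hp with hp | hp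
    · obtain ⟨i, -, hp⟩ := Multiset.mem_sum.1 hp
      obtain ⟨h₁, h₂⟩ := names_nodup_of_sum h i (mem_names_of_mem hp)
      rw [π.focc_eq_zero h₁, zero_add, Finset.sum_eq_single i
        (fun j _ hj => (πs j).focc_eq_zero (h₂ j hj)) (fun h => absurd (Finset.mem_univ i) h)]
      exact ihs i hp
    · rw [Finset.sum_eq_zero fun i _ => (πs i).focc_eq_zero fun h' =>
        (names_nodup_of_sum h i h').1 (mem_names_of_mem hp), add_zero]
      exact ih hp
  | recu a m C h hD πs π ihs ih =>
    simp only [Tm.focc]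
    rcases Multiset.mem_add.1 hp with hp | hp
    · obtain ⟨i, -, hp⟩ := Multiset.mem_sum.1 hp
      exact absurd (hD i p hp) hb
    · rw [Finset.sum_eq_zero fun i _ => (πs i).focc_eq_zero fun h' =>
        (names_nodup_of_sum h i h').1 (mem_names_of_mem hp), mul_zero, add_zero]
      exact ih hp

/-- Contexts and structural rules are traded for an assignment `φ` of types to names; what remains
of linearity is the condition on each abstraction, supplied by `focc_le_one`. -/
theorem hasTy {Γ : Ctx F} {M : Tm F} {A : Ty F} (π : Der (baseTypes F) Γ M A)
    {φ : ℕ → Option (Ty F)} (hφ : ∀ p ∈ Γ, φ p.1 = some p.2) : HasTy φ [] M A := by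
  induction π generalizing φ with
  | ax x A => exact .fvar (hφ (x, A) (Multiset.mem_singleton_self _))
  | weak x A hx π ih => exact ih fun p hp => hφ p (Multiset.mem_cons_of_mem hp)
  | contr x y z A hA hz π ih =>
    have hnd := π.nodup_names
    simp only [names_cons, Multiset.nodup_cons, Multiset.mem_cons, not_or] at hnd
    refine HasTy.rename (ih fun p hp => ?_)
    have hzA := hφ (z, A) (Multiset.mem_cons_self _ _)
    rcases Multiset.mem_cons.1 hp with rfl | hp
    · simpa using hzA
    rcases Multiset.mem_cons.1 hp with rfl | hp
    · simpa using hzA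
    · have hx : p.1 ≠ x := fun h => hnd.1.2 (h ▸ mem_names_of_mem hp)
      have hy : p.1 ≠ y := fun h => hnd.2.1 (h ▸ mem_names_of_mem hp)
      simpa [hx, hy] using hφ p (Multiset.mem_cons_of_mem hp)
  | lam x A B π ih =>
    have hnd := π.nodup_names
    simp only [names_cons, Multiset.nodup_cons] at hnd
    have h : HasTy (Function.update φ x (some A)) [] _ B := ih fun p hp => by
      rcases Multiset.mem_cons.1 hp with rfl | hp
      · simp
      · rw [Function.update_of_ne fun h => hnd.1 (by rw [← h]; exact mem_names_of_mem hp)]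
        exact hφ p hp
    refine .lam h.closeAt ?_
    -- The body has no dangling index before closing, so the occurrences of the new index are
    -- exactly those of the name `x`.
    rw [Tm.occ_closeAt_self, Tm.occ_eq_zero_of_hasTy h (Nat.zero_le _), zero_add,
      or_iff_not_imp_left]
    exact fun hA => π.focc_le_one (Multiset.mem_cons_self (x, A) _) hA
  | app A B h π₁ π₂ ih₁ ih₂ =>
    exact .app (ih₁ fun p hp => hφ p (Multiset.mem_add.2 (Or.inl hp)))
      (ih₂ fun p hp => hφ p (Multiset.mem_add.2 (Or.inr hp)))
  | con a c n => exact .con a c n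
  | cond a m C h πs π ihs ih =>
    exact .cond rfl (ih fun p hp => hφ p (Multiset.mem_add.2 (Or.inr hp))) fun i =>
      ihs i fun p hp => hφ p (Multiset.mem_add.2
        (Or.inl (Multiset.mem_sum.2 ⟨i, Finset.mem_univ i, hp⟩)))
  | recu a m C h hD πs π ihs ih =>
    exact .recu rfl (ih fun p hp => hφ p (Multiset.mem_add.2 (Or.inr hp))) fun i =>
      ihs i fun p hp => hφ p (Multiset.mem_add.2
        (Or.inl (Multiset.mem_sum.2 ⟨i, Finset.mem_univ i, hp⟩)))

theorem exists_hasTy {Γ : Ctx F} {M : Tm F} {A : Ty F} (π : Der (baseTypes F) Γ M A) :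
    ∃ φ : ℕ → Option (Ty F), HasTy φ [] M A := by
  classical
  refine ⟨fun x => if h : ∃ B, (x, B) ∈ Γ then some h.choose else none, π.hasTy fun p hp => ?_⟩
  have h : ∃ B, (p.1, B) ∈ Γ := ⟨p.2, hp⟩
  rw [dif_pos h, Option.some_inj]
  have := (Multiset.inj_on_of_nodup_map π.nodup_names) _ h.choose_spec _ hp rfl
  exact congrArg Prod.snd this

/-- The rank counts nesting in branches only, whereas the depth also counts the recursions met in
recursion arguments. -/
theorem rank_le_depth {D : Set (Ty F)} {Γ : Ctx F} {M : Tm F} {A : Ty F} (π : Der D Γ M A) :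
    M.rank ≤ π.depth := by
  induction π with
  | ax | con => exact Nat.zero_le _
  | weak x A hx π ih => exact ih
  | contr x y z A hA hz π ih => rw [Tm.rank_rename]; exact ih
  | lam x A B π ih => exact (Tm.rank_closeAt _ _ _).le.trans ih
  | app A B h π₁ π₂ ih₁ ih₂ => exact max_le_max ih₁ ih₂
  | cond a m C h πs π ihs ih =>
    simp only [Tm.rank, depth]
    rw [max_comm]
    exact max_le_max (Finset.sup_mono_fun fun i _ => ihs i) ih
  | recu a m C h hD πs π ihs ih =>
    simp only [Tm.rank, depth]
    exact max_le (ih.trans (by omega))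
      (Nat.succ_le_succ ((Finset.sup_mono_fun fun i _ => ihs i).trans (le_max_left _ _)))

end Der

theorem exists_primrec_normalization (F : Family) (d : ℕ) : ∃ q : ℕ → ℕ, Nat.Primrec q ∧
    ∀ (Γ : Ctx F) (M : Tm F) (A : Ty F) (π : Der (baseTypes F) Γ M A), π.depth = d →
      ∀ (n : ℕ) (N : Tm F), Steps n M N → n ≤ q M.size ∧ N.size ≤ q M.size := by
  obtain ⟨q, hq, -, hb⟩ := exists_primrec_steps_le F d
  refine ⟨q, Primrec.nat_iff.1 hq, fun Γ M A π hd n N hN => ?_⟩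
  obtain ⟨φ, hφ⟩ := π.exists_hasTy
  exact hb φ M A hφ (hd ▸ π.rank_le_depth) n N hN

end HRec

/-! ### Sizes in the context semantics: structure of graphs, determinacy of trees, counting of
stacks. -/

namespace HRec

variable {F : Family}

/-! ### Bounds for cardinalities -/

/-- The set `S` is finite and has at most `n` elements. -/
def CardLe {α : Type*} (S : Set α) (n : ℕ) : Prop := ∃ t : Finset α, S ⊆ t ∧ t.card ≤ n

namespace CardLe

variable {α β : Type*} {S T : Set α} {n m : ℕ}

theorem mono (h : CardLe S n) (hS : T ⊆ S) (hn : n ≤ m) : CardLe T m := by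
  obtain ⟨t, h₁, h₂⟩ := h
  exact ⟨t, hS.trans h₁, h₂.trans hn⟩

theorem of_isEmpty (h : ∀ x, x ∉ S) : CardLe S n :=
  ⟨∅, fun x hx => absurd hx (h x), by simp⟩

theorem of_subset_singleton {x : α} (h : ∀ y ∈ S, y = x) : CardLe S 1 :=
  ⟨{x}, fun y hy => by simpa using h y hy, by simp⟩

theorem union (hS : CardLe S n) (hT : CardLe T m) : CardLe (S ∪ T) (n + m) := by
  classical
  obtain ⟨s, h₁, h₂⟩ := hS
  obtain ⟨t, h₃, h₄⟩ := hT
  refine ⟨s ∪ t, ?_, (Finset.card_union_le s t).trans (add_le_add h₂ h₄)⟩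
  rw [Finset.coe_union]
  exact Set.union_subset_union h₁ h₃

theorem image (h : CardLe S n) (f : α → β) : CardLe (f '' S) n := by
  classical
  obtain ⟨s, h₁, h₂⟩ := h
  refine ⟨s.image f, ?_, Finset.card_image_le.trans h₂⟩
  rw [Finset.coe_image]
  exact Set.image_mono h₁

theorem biUnion (h : CardLe S n) {f : α → Set β} (hf : ∀ x ∈ S, CardLe (f x) m) :
    CardLe (⋃ x ∈ S, f x) (n * m) := by
  classical
  obtain ⟨s, h₁, h₂⟩ := h
  have : ∀ x, ∃ t : Finset β, (x ∈ S → f x ⊆ t) ∧ t.card ≤ m := fun x => by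
    by_cases hx : x ∈ S
    · obtain ⟨t, h₃, h₄⟩ := hf x hx
      exact ⟨t, fun _ => h₃, h₄⟩
    · exact ⟨∅, fun h => absurd h hx, by simp⟩
  choose t ht htc using this
  refine ⟨s.biUnion t, ?_, ?_⟩
  · intro y hy
    simp only [Set.mem_iUnion] at hy
    obtain ⟨x, hx, hy⟩ := hy
    exact Finset.mem_coe.2 (Finset.mem_biUnion.2 ⟨x, h₁ hx, ht x hx hy⟩)
  · exact (Finset.card_biUnion_le_card_mul s t m fun x _ => htc x).trans
      (Nat.mul_le_mul_right m h₂)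

theorem iUnion {ι : Type*} [Fintype ι] {f : ι → Set β} {k : ι → ℕ} (hf : ∀ i, CardLe (f i) (k i)) :
    CardLe (⋃ i, f i) (∑ i, k i) := by
  classical
  choose t ht htc using hf
  refine ⟨Finset.univ.biUnion t, ?_, ?_⟩
  · intro y hy
    obtain ⟨i, hi⟩ := Set.mem_iUnion.1 hy
    exact Finset.mem_coe.2 (Finset.mem_biUnion.2 ⟨i, Finset.mem_univ i, ht i hi⟩)
  · exact Finset.card_biUnion_le.trans (Finset.sum_le_sum fun i _ => htc i)

theorem prod {T : Set β} (hS : CardLe S n) (hT : CardLe T m) : CardLe (S ×ˢ T) (n * m) := by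
  obtain ⟨s, h₁, h₂⟩ := hS
  obtain ⟨t, h₃, h₄⟩ := hT
  refine ⟨s ×ˢ t, ?_, ?_⟩
  · rw [Finset.coe_product]
    exact Set.prod_mono h₁ h₃
  · rw [Finset.card_product]
    exact Nat.mul_le_mul h₂ h₄

theorem finite (h : CardLe S n) : S.Finite := by
  obtain ⟨s, h₁, -⟩ := h
  exact s.finite_toSet.subset h₁

theorem ncard_le (h : CardLe S n) : S.ncard ≤ n := by
  obtain ⟨s, h₁, h₂⟩ := h
  refine (Set.ncard_le_ncard h₁ s.finite_toSet).trans ?_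
  rwa [Set.ncard_coe_finset]

end CardLe

/-! ### The structure of interaction graphs -/

namespace Node

variable {E E' : Type}

/-- Labels with a positive focus reach the edge `e` through this vertex. -/
def PosOut : Node F E → E → Prop
  | weak _, _ => False
  | contr e' g _, e => e = e' ∨ e = g
  | lam e' _ h, e => e = e' ∨ e = h
  | app _ _ h, e => e = h
  | con _ _ _ e', e => e = e'
  | cond _ _ _ g, e => e = g
  | recu _ _ _ g, e => e = g
  | port _ _ g, e => e = g

/-- Labels with a negative focus reach the edge `e` through this vertex. -/
def NegOut : Node F E → E → Prop
  | lam _ g _, e => e = g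
  | app e' g _, e => e = e' ∨ e = g
  | cond _ _ es _, e => ∃ c, e = es c
  | recu _ _ es _, e => ∃ c, e = es c
  | weak _, _ => False
  | contr _ _ _, _ => False
  | con _ _ _ _, _ => False
  | port _ _ _, _ => False

/-- Compatibility of the box levels of the edges incident to a vertex. -/
def LevelOK (lev : E → ℕ) : Node F E → Prop
  | contr e g h => lev e = lev h ∧ lev g = lev h
  | lam e g h => lev e = lev h ∧ lev g = lev h
  | app e g h => lev e = lev h ∧ lev g = lev h
  | cond _ e₀ es g => lev e₀ = lev g ∧ ∀ c, lev (es c) = lev g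
  | recu _ e₀ es g => lev e₀ = lev g ∧ ∀ c, lev (es c) = lev g + 1
  | weak _ => True
  | con _ _ _ _ => True
  | port _ _ _ => True

/-- The edges to which a vertex sends labels of the same sign are distinct. -/
def Distinct : Node F E → Prop
  | lam e _ h => e ≠ h
  | app e g _ => e ≠ g
  | _ => True

/-- Constructors, and recursions over nonempty algebras. -/
def Counted : Node F E → Prop
  | con _ _ _ _ => True
  | recu a _ _ _ => 0 < (F.alg a).numCons
  | _ => False

theorem posOut_map (f : E → E') (n : Node F E) (e : E') :
    (n.map f).PosOut e ↔ ∃ e', e = f e' ∧ n.PosOut e' := by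
  cases n <;> simp [map, PosOut, and_or_left, exists_or]

theorem negOut_map (f : E → E') (n : Node F E) (e : E') :
    (n.map f).NegOut e ↔ ∃ e', e = f e' ∧ n.NegOut e' := by
  cases n <;> simp [map, NegOut, and_or_left, exists_or]

theorem levelOK_map (f : E → E') (n : Node F E) (lev : E' → ℕ) :
    (n.map f).LevelOK lev ↔ n.LevelOK (lev ∘ f) := by
  cases n <;> exact Iff.rfl

theorem distinct_map {f : E → E'} (hf : f.Injective) (n : Node F E) :
    (n.map f).Distinct ↔ n.Distinct := by
  cases n <;> simp [map, Distinct, hf.eq_iff]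

theorem counted_map (f : E → E') (n : Node F E) : (n.map f).Counted ↔ n.Counted := by
  cases n <;> exact Iff.rfl

theorem levelOK_succ {lev : E → ℕ} {n : Node F E} (h : n.LevelOK lev) :
    n.LevelOK fun e => lev e + 1 := by
  cases n <;> simp_all [LevelOK]

theorem map_eq_recu {f : E → E'} {n : Node F E} {a : F.Alg} {e₀ : E'} {es : F.Cons a → E'} {g : E'}
    (h : n.map f = recu a e₀ es g) : ∃ e₀' es' g', n = recu a e₀' es' g' ∧ e₀ = f e₀' := by
  cases n with
  | recu b e₀' es' g' =>
    simp only [map, recu.injEq] at h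
    obtain ⟨rfl, rfl, -, -⟩ := h
    exact ⟨e₀', es', g', rfl, rfl⟩
  | _ => simp [map] at h

end Node

/-- The structural properties of the interaction graphs of derivations. There are at most `m` vertices
that are constructors or recursions over nonempty algebras, and `lev` counts the boxes around an edge,
of which there are at most `d`. -/
structure Good {Γ : Ctx F} (G : IGraph Γ) (m d : ℕ) (lev : G.Edge → ℕ) : Prop where
  pos_unique : ∀ v v' e, (G.node v).PosOut e → (G.node v').PosOut e → v = v'
  neg_unique : ∀ v v' e, (G.node v).NegOut e → (G.node v').NegOut e → v = v'
  distinct : ∀ v, (G.node v).Distinct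
  levelOK : ∀ v, (G.node v).LevelOK lev
  box_none : ∀ e, G.box e = none → lev e = 0
  box_some : ∀ e v a e₀ es g, G.box e = some v → G.node v = .recu a e₀ es g → lev e = lev e₀ + 1
  lev_le : ∀ e, lev e ≤ d
  counted : CardLe {v | (G.node v).Counted} m
  concl_neg : ∀ v, ¬ (G.node v).NegOut G.concl
  lev_concl : lev G.concl = 0
  prem_pos : ∀ v x hx, ¬ (G.node v).PosOut (G.prem x hx)
  lev_prem : ∀ x hx, lev (G.prem x hx) = 0
  prem_inj : ∀ x hx y hy, G.prem x hx = G.prem y hy → x = y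

namespace Good

open Node

theorem ax (x : ℕ) (A : Ty F) : Good (IGraph.ax x A) 1 0 fun _ => 0 where
  pos_unique v := v.elim
  neg_unique v := v.elim
  distinct v := v.elim
  levelOK v := v.elim
  box_none _ _ := rfl
  box_some _ v := v.elim
  lev_le _ := le_rfl
  counted := .of_isEmpty fun v => v.elim
  concl_neg v := v.elim
  lev_concl := rfl
  prem_pos v := v.elim
  lev_prem _ _ := rfl
  prem_inj y hy z hz _ := by
    simp only [names, Multiset.map_singleton, Multiset.mem_singleton] at hy hz
    rw [hy, hz]

theorem con (a : F.Alg) (c : F.Cons a) (n : ℕ) : Good (IGraph.con a c n) 1 0 fun _ => 0 where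
  pos_unique _ _ _ _ _ := rfl
  neg_unique _ _ _ _ _ := rfl
  distinct _ := trivial
  levelOK _ := trivial
  box_none _ _ := rfl
  box_some _ _ _ _ _ _ h := by simp [IGraph.con] at h
  lev_le _ := le_rfl
  counted := .of_subset_singleton (x := ()) fun _ _ => rfl
  concl_neg _ h := h
  lev_concl := rfl
  prem_pos _ x hx := absurd hx (by simp [names])
  lev_prem _ _ := rfl
  prem_inj x hx := absurd hx (by simp [names])

section option

variable {Γ : Ctx F} {m d : ℕ}

theorem counted_option {V E : Type} {node : V → Node F E} {node' : Option V → Node F (Option E)}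
    (h : CardLe {v | (node v).Counted} m) (h₀ : ¬ (node' none).Counted)
    (h₁ : ∀ v, node' (some v) = (node v).map some) : CardLe {v | (node' v).Counted} m := by
  refine (h.image some).mono ?_ le_rfl
  rintro (_ | v) hv
  · exact absurd hv h₀
  · rw [Set.mem_ofPred_eq, h₁, counted_map] at hv
    exact ⟨v, hv, rfl⟩

theorem weak {x : ℕ} {A : Ty F} {G : IGraph Γ} {lev : G.Edge → ℕ} (h : Good G m d lev) :
    Good (IGraph.weak x A G) m d fun e => e.elim 0 lev where
  pos_unique := by
    rintro (_ | v) (_ | v') e he he'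
    · rfl
    · exact he.elim
    · exact he'.elim
    · obtain ⟨e, rfl, hp⟩ := (posOut_map _ _ _).1 he
      obtain ⟨_, h₁, hp'⟩ := (posOut_map _ _ _).1 he'
      cases h₁
      rw [h.pos_unique v v' e hp hp']
  neg_unique := by
    rintro (_ | v) (_ | v') e he he'
    · rfl
    · exact he.elim
    · exact he'.elim
    · obtain ⟨e, rfl, hp⟩ := (negOut_map _ _ _).1 he
      obtain ⟨_, h₁, hp'⟩ := (negOut_map _ _ _).1 he'
      cases h₁
      rw [h.neg_unique v v' e hp hp']
  distinct := by
    rintro (_ | v)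
    · trivial
    · exact (distinct_map (Option.some_injective _) _).2 (h.distinct v)
  levelOK := by
    rintro (_ | v)
    · trivial
    · exact (levelOK_map _ _ _).2 (h.levelOK v)
  box_none := by
    rintro (_ | e) he
    · rfl
    · exact h.box_none e (by simpa [IGraph.weak] using he)
  box_some := by
    rintro (_ | e) v a e₀ es g he hv
    · simp [IGraph.weak] at he
    · obtain ⟨v', hb, rfl⟩ := Option.map_eq_some_iff.1 he
      obtain ⟨e₀', es', g', hn, rfl⟩ := map_eq_recu hv
      exact h.box_some e v' a e₀' es' g' hb hn
  lev_le := by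
    rintro (_ | e)
    · exact Nat.zero_le _
    · exact h.lev_le e
  counted := counted_option h.counted (fun h => h) fun _ => rfl
  concl_neg := by
    rintro (_ | v) hv
    · exact hv
    · obtain ⟨e, h₁, he⟩ := (negOut_map _ _ _).1 hv
      cases h₁
      exact h.concl_neg v he
  lev_concl := h.lev_concl
  prem_pos := by
    rintro (_ | v) y hy hv
    · exact hv
    · obtain ⟨e, h₁, he⟩ := (posOut_map _ _ _).1 hv
      simp only [IGraph.weak] at h₁
      split_ifs at h₁ with hyx
      cases h₁
      exact h.prem_pos v _ _ he
  lev_prem y hy := by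
    simp only [IGraph.weak]
    split_ifs
    · rfl
    · exact h.lev_prem _ _
  prem_inj y hy z hz hyz := by
    simp only [IGraph.weak] at hyz
    split_ifs at hyz with h₁ h₂
    · rw [h₁, h₂]
    · exact h.prem_inj _ _ _ _ (Option.some_injective _ hyz)

/-- The new vertex sends positive labels to two former premises. By `prem_pos` no old vertex did so,
and by distinctness of names the remaining premises stay free of them. -/
theorem contr {x y z : ℕ} {A : Ty F} {G : IGraph ((x, A) ::ₘ (y, A) ::ₘ Γ)} {lev : G.Edge → ℕ}
    (hΓ : (names ((x, A) ::ₘ (y, A) ::ₘ Γ)).Nodup) (h : Good G m d lev) :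
    Good (IGraph.contr x y z A G) m d fun e => e.elim 0 lev where
  pos_unique := by
    rintro (_ | v) (_ | v') e he he'
    · rfl
    · obtain ⟨e, rfl, hp'⟩ := (posOut_map _ _ _).1 he'
      rcases he with he | he <;> cases he <;> exact absurd hp' (h.prem_pos _ _ _)
    · obtain ⟨e, rfl, hp⟩ := (posOut_map _ _ _).1 he
      rcases he' with he' | he' <;> cases he' <;> exact absurd hp (h.prem_pos _ _ _)
    · obtain ⟨e, rfl, hp⟩ := (posOut_map _ _ _).1 he
      obtain ⟨_, h₁, hp'⟩ := (posOut_map _ _ _).1 he'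
      cases h₁
      rw [h.pos_unique v v' e hp hp']
  neg_unique := by
    rintro (_ | v) (_ | v') e he he'
    · rfl
    · exact he.elim
    · exact he'.elim
    · obtain ⟨e, rfl, hp⟩ := (negOut_map _ _ _).1 he
      obtain ⟨_, h₁, hp'⟩ := (negOut_map _ _ _).1 he'
      cases h₁
      rw [h.neg_unique v v' e hp hp']
  distinct := by
    rintro (_ | v)
    · trivial
    · exact (distinct_map (Option.some_injective _) _).2 (h.distinct v)
  levelOK := by
    rintro (_ | v)
    · exact ⟨h.lev_prem _ _, h.lev_prem _ _⟩
    · exact (levelOK_map _ _ _).2 (h.levelOK v)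
  box_none := by
    rintro (_ | e) he
    · rfl
    · exact h.box_none e (by simpa [IGraph.contr] using he)
  box_some := by
    rintro (_ | e) v a e₀ es g he hv
    · simp [IGraph.contr] at he
    · obtain ⟨v', hb, rfl⟩ := Option.map_eq_some_iff.1 he
      obtain ⟨e₀', es', g', hn, rfl⟩ := map_eq_recu hv
      exact h.box_some e v' a e₀' es' g' hb hn
  lev_le := by
    rintro (_ | e)
    · exact Nat.zero_le _
    · exact h.lev_le e
  counted := counted_option h.counted (fun h => h) fun _ => rfl
  concl_neg := by
    rintro (_ | v) hv
    · exact hv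
    · obtain ⟨e, h₁, he⟩ := (negOut_map _ _ _).1 hv
      cases h₁
      exact h.concl_neg v he
  lev_concl := h.lev_concl
  prem_pos := by
    simp only [names_cons, Multiset.nodup_cons, Multiset.mem_cons, not_or] at hΓ
    rintro (_ | v) w hw hv
    · simp only [IGraph.contr] at hv
      split_ifs at hv with hwz
      · rcases hv with hv | hv <;> cases hv
      · have hwΓ := mem_names_of_mem_cons hw hwz
        rcases hv with hv | hv
        · exact hΓ.1.2 (h.prem_inj _ _ _ _ (Option.some_injective _ hv) ▸ hwΓ)
        · exact hΓ.2.1 (h.prem_inj _ _ _ _ (Option.some_injective _ hv) ▸ hwΓ)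
    · obtain ⟨e, h₁, he⟩ := (posOut_map _ _ _).1 hv
      simp only [IGraph.contr] at h₁
      split_ifs at h₁ with hyx
      cases h₁
      exact h.prem_pos v _ _ he
  lev_prem y hy := by
    simp only [IGraph.contr]
    split_ifs
    · rfl
    · exact h.lev_prem _ _
  prem_inj y hy z hz hyz := by
    simp only [IGraph.contr] at hyz
    split_ifs at hyz with h₁ h₂
    · rw [h₁, h₂]
    · exact h.prem_inj _ _ _ _ (Option.some_injective _ hyz)

theorem lam {x : ℕ} {A B : Ty F} {G : IGraph ((x, A) ::ₘ Γ)} {lev : G.Edge → ℕ}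
    (hΓ : x ∉ names Γ) (h : Good G m d lev) :
    Good (IGraph.lam x A B G) m d fun e => e.elim 0 lev where
  pos_unique := by
    rintro (_ | v) (_ | v') e he he'
    · rfl
    · obtain ⟨e, rfl, hp'⟩ := (posOut_map _ _ _).1 he'
      rcases he with he | he <;> cases he
      exact absurd hp' (h.prem_pos _ _ _)
    · obtain ⟨e, rfl, hp⟩ := (posOut_map _ _ _).1 he
      rcases he' with he' | he' <;> cases he'
      exact absurd hp (h.prem_pos _ _ _)
    · obtain ⟨e, rfl, hp⟩ := (posOut_map _ _ _).1 he
      obtain ⟨_, h₁, hp'⟩ := (posOut_map _ _ _).1 he'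
      cases h₁
      rw [h.pos_unique v v' e hp hp']
  neg_unique := by
    rintro (_ | v) (_ | v') e he he'
    · rfl
    · obtain ⟨e, rfl, hp'⟩ := (negOut_map _ _ _).1 he'
      cases he
      exact absurd hp' (h.concl_neg _)
    · obtain ⟨e, rfl, hp⟩ := (negOut_map _ _ _).1 he
      cases he'
      exact absurd hp (h.concl_neg _)
    · obtain ⟨e, rfl, hp⟩ := (negOut_map _ _ _).1 he
      obtain ⟨_, h₁, hp'⟩ := (negOut_map _ _ _).1 he'
      cases h₁
      rw [h.neg_unique v v' e hp hp']
  distinct := by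
    rintro (_ | v)
    · exact Option.some_ne_none _
    · exact (distinct_map (Option.some_injective _) _).2 (h.distinct v)
  levelOK := by
    rintro (_ | v)
    · exact ⟨h.lev_prem _ _, h.lev_concl⟩
    · exact (levelOK_map _ _ _).2 (h.levelOK v)
  box_none := by
    rintro (_ | e) he
    · rfl
    · exact h.box_none e (by simpa [IGraph.lam] using he)
  box_some := by
    rintro (_ | e) v a e₀ es g he hv
    · simp [IGraph.lam] at he
    · obtain ⟨v', hb, rfl⟩ := Option.map_eq_some_iff.1 he
      obtain ⟨e₀', es', g', hn, rfl⟩ := map_eq_recu hv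
      exact h.box_some e v' a e₀' es' g' hb hn
  lev_le := by
    rintro (_ | e)
    · exact Nat.zero_le _
    · exact h.lev_le e
  counted := counted_option h.counted (fun h => h) fun _ => rfl
  concl_neg := by
    rintro (_ | v) hv
    · cases hv
    · obtain ⟨e, h₁, he⟩ := (negOut_map _ _ _).1 hv
      cases h₁
  lev_concl := rfl
  prem_pos := by
    rintro (_ | v) w hw hv
    · rcases hv with hv | hv
      · exact hΓ (h.prem_inj _ _ _ _ (Option.some_injective _ hv) ▸ hw)
      · cases hv
    · obtain ⟨e, h₁, he⟩ := (posOut_map _ _ _).1 hv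
      cases h₁
      exact h.prem_pos v _ _ he
  lev_prem y hy := h.lev_prem _ _
  prem_inj y hy z hz hyz := h.prem_inj _ _ _ _ (Option.some_injective _ hyz)

end option

section app

variable {Γ Δ : Ctx F} {m m' d d' : ℕ} {B : Ty F} {G : IGraph Γ} {H : IGraph Δ}
  {lev : G.Edge → ℕ} {lev' : H.Edge → ℕ}

/-- Box levels in the graph of an application. -/
def levApp (lev : G.Edge → ℕ) (lev' : H.Edge → ℕ) : Option (G.Edge ⊕ H.Edge) → ℕ
  | none => 0
  | some (.inl e) => lev e
  | some (.inr e) => lev' e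

theorem app_prem (x : ℕ) (hx : x ∈ names (Γ + Δ)) :
    (∃ h, (IGraph.app B G H).prem x hx = some (.inl (G.prem x h))) ∨
      ∃ h, (IGraph.app B G H).prem x hx = some (.inr (H.prem x h)) := by
  by_cases h : x ∈ names Γ
  · exact Or.inl ⟨h, dif_pos h⟩
  · exact Or.inr ⟨_, dif_neg h⟩

/-- The new vertex is the only source of negative labels at both former conclusions thanks to
`concl_neg`, and the new conclusion receives only positive ones. -/
theorem app (h : Good G m d lev) (h' : Good H m' d' lev') :
    Good (IGraph.app B G H) (m + m') (max d d') (levApp lev lev') where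
  pos_unique := by
    rintro (_ | v | v) (_ | w | w) e he he'
    · rfl
    · obtain ⟨e, rfl, hp'⟩ := (posOut_map _ _ _).1 he'; cases he
    · obtain ⟨e, rfl, hp'⟩ := (posOut_map _ _ _).1 he'; cases he
    · obtain ⟨e, rfl, hp⟩ := (posOut_map _ _ _).1 he; cases he'
    · obtain ⟨e, rfl, hp⟩ := (posOut_map _ _ _).1 he
      obtain ⟨_, h₁, hp'⟩ := (posOut_map _ _ _).1 he'
      cases h₁
      rw [h.pos_unique v w e hp hp']
    · obtain ⟨e, rfl, hp⟩ := (posOut_map _ _ _).1 he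
      obtain ⟨_, h₁, hp'⟩ := (posOut_map _ _ _).1 he'
      cases h₁
    · obtain ⟨e, rfl, hp⟩ := (posOut_map _ _ _).1 he; cases he'
    · obtain ⟨e, rfl, hp⟩ := (posOut_map _ _ _).1 he
      obtain ⟨_, h₁, hp'⟩ := (posOut_map _ _ _).1 he'
      cases h₁
    · obtain ⟨e, rfl, hp⟩ := (posOut_map _ _ _).1 he
      obtain ⟨_, h₁, hp'⟩ := (posOut_map _ _ _).1 he'
      cases h₁
      rw [h'.pos_unique v w e hp hp']
  neg_unique := by
    rintro (_ | v | v) (_ | w | w) e he he'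
    · rfl
    · obtain ⟨e, rfl, hp'⟩ := (negOut_map _ _ _).1 he'
      rcases he with he | he <;> cases he
      exact absurd hp' (h.concl_neg _)
    · obtain ⟨e, rfl, hp'⟩ := (negOut_map _ _ _).1 he'
      rcases he with he | he <;> cases he
      exact absurd hp' (h'.concl_neg _)
    · obtain ⟨e, rfl, hp⟩ := (negOut_map _ _ _).1 he
      rcases he' with he' | he' <;> cases he'
      exact absurd hp (h.concl_neg _)
    · obtain ⟨e, rfl, hp⟩ := (negOut_map _ _ _).1 he
      obtain ⟨_, h₁, hp'⟩ := (negOut_map _ _ _).1 he'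
      cases h₁
      rw [h.neg_unique v w e hp hp']
    · obtain ⟨e, rfl, hp⟩ := (negOut_map _ _ _).1 he
      obtain ⟨_, h₁, hp'⟩ := (negOut_map _ _ _).1 he'
      cases h₁
    · obtain ⟨e, rfl, hp⟩ := (negOut_map _ _ _).1 he
      rcases he' with he' | he' <;> cases he'
      exact absurd hp (h'.concl_neg _)
    · obtain ⟨e, rfl, hp⟩ := (negOut_map _ _ _).1 he
      obtain ⟨_, h₁, hp'⟩ := (negOut_map _ _ _).1 he'
      cases h₁
    · obtain ⟨e, rfl, hp⟩ := (negOut_map _ _ _).1 he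
      obtain ⟨_, h₁, hp'⟩ := (negOut_map _ _ _).1 he'
      cases h₁
      rw [h'.neg_unique v w e hp hp']
  distinct := by
    rintro (_ | v | v)
    · simp [IGraph.app, Distinct]
    · exact (distinct_map ((Option.some_injective _).comp Sum.inl_injective) _).2 (h.distinct v)
    · exact (distinct_map ((Option.some_injective _).comp Sum.inr_injective) _).2 (h'.distinct v)
  levelOK := by
    rintro (_ | v | v)
    · exact ⟨h.lev_concl, h'.lev_concl⟩
    · exact (levelOK_map _ _ _).2 (h.levelOK v)
    · exact (levelOK_map _ _ _).2 (h'.levelOK v)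
  box_none := by
    rintro (_ | e | e) he
    · rfl
    · exact h.box_none e (by simpa [IGraph.app] using he)
    · exact h'.box_none e (by simpa [IGraph.app] using he)
  box_some := by
    rintro (_ | e | e) v a e₀ es g he hv
    · simp [IGraph.app] at he
    · obtain ⟨v', hb, rfl⟩ := Option.map_eq_some_iff.1 he
      obtain ⟨e₀', es', g', hn, rfl⟩ := map_eq_recu hv
      exact h.box_some e v' a e₀' es' g' hb hn
    · obtain ⟨v', hb, rfl⟩ := Option.map_eq_some_iff.1 he
      obtain ⟨e₀', es', g', hn, rfl⟩ := map_eq_recu hv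
      exact h'.box_some e v' a e₀' es' g' hb hn
  lev_le := by
    rintro (_ | e | e)
    · exact Nat.zero_le _
    · exact (h.lev_le e).trans (le_max_left _ _)
    · exact (h'.lev_le e).trans (le_max_right _ _)
  counted := by
    refine ((h.counted.image (some ∘ Sum.inl)).union (h'.counted.image (some ∘ Sum.inr))).mono ?_
      le_rfl
    rintro (_ | v | v) hv
    · exact hv.elim
    · exact Or.inl ⟨v, (counted_map _ _).1 hv, rfl⟩
    · exact Or.inr ⟨v, (counted_map _ _).1 hv, rfl⟩
  concl_neg := by
    rintro (_ | v | v) hv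
    · rcases hv with hv | hv <;> cases hv
    · obtain ⟨e, h₁, he⟩ := (negOut_map _ _ _).1 hv
      cases h₁
    · obtain ⟨e, h₁, he⟩ := (negOut_map _ _ _).1 hv
      cases h₁
  lev_concl := rfl
  prem_pos := by
    intro v x hx hv
    rcases app_prem (B := B) (G := G) (H := H) x hx with ⟨hx', he⟩ | ⟨hx', he⟩ <;> rw [he] at hv <;>
      rcases v with _ | v | v
    · cases hv
    · obtain ⟨e, h₁, he⟩ := (posOut_map _ _ _).1 hv
      cases h₁
      exact h.prem_pos _ _ _ he
    · obtain ⟨e, h₁, he⟩ := (posOut_map _ _ _).1 hv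
      cases h₁
    · cases hv
    · obtain ⟨e, h₁, he⟩ := (posOut_map _ _ _).1 hv
      cases h₁
    · obtain ⟨e, h₁, he⟩ := (posOut_map _ _ _).1 hv
      cases h₁
      exact h'.prem_pos _ _ _ he
  lev_prem x hx := by
    rcases app_prem (B := B) (G := G) (H := H) x hx with ⟨hx', he⟩ | ⟨hx', he⟩ <;> rw [he]
    exacts [h.lev_prem _ _, h'.lev_prem _ _]
  prem_inj x hx y hy hxy := by
    rcases app_prem (B := B) (G := G) (H := H) x hx with ⟨hx', he⟩ | ⟨hx', he⟩ <;>
      rcases app_prem (B := B) (G := G) (H := H) y hy with ⟨hy', he'⟩ | ⟨hy', he'⟩ <;>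
        rw [he, he'] at hxy
    · exact h.prem_inj _ _ _ _ (Sum.inl_injective (Option.some_injective _ hxy))
    · cases hxy
    · cases hxy
    · exact h'.prem_inj _ _ _ _ (Sum.inr_injective (Option.some_injective _ hxy))

end app

end Good

end HRec

namespace HRec

variable {F : Family}

namespace Good

open Node

section branching

variable {a : F.Alg} {C : Ty F} {Γ : F.Cons a → Ctx F} {Δ : Ctx F} {Gs : ∀ i, IGraph (Γ i)}
  {H : IGraph Δ} {m d : F.Cons a → ℕ} {m' d' : ℕ} {lev : ∀ i, (Gs i).Edge → ℕ}
  {lev' : H.Edge → ℕ}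

/-- Box levels in the graph of a conditional. -/
def levCond {ι E₀ : Type} {E : ι → Type} (lev : ∀ i, E i → ℕ) (lev' : E₀ → ℕ) : Branching E E₀ → ℕ
  | .main => 0
  | .branch i e => lev i e
  | .arg e => lev' e

/-- Box levels in the graph of a recursion. -/
def levRecu {ι E₀ : Type} {X E : ι → Type} (lev : ∀ i, E i → ℕ) (lev' : E₀ → ℕ) : Boxed X E E₀ → ℕ
  | .main => 0
  | .port _ _ => 0
  | .inner i e => lev i e + 1
  | .arg e => lev' e

theorem cond_prem (x : ℕ) (hx : x ∈ names ((∑ i, Γ i) + Δ)) :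
    (∃ h, (IGraph.cond a C Gs H).prem x hx = .arg (H.prem x h)) ∨
      ∃ i h, (IGraph.cond a C Gs H).prem x hx = .branch i ((Gs i).prem x h) := by
  by_cases h : x ∈ names Δ
  · exact Or.inl ⟨h, dif_pos h⟩
  · exact Or.inr ⟨_, _, dif_neg h⟩

theorem recu_prem (x : ℕ) (hx : x ∈ names ((∑ i, Γ i) + Δ)) :
    (∃ h, (IGraph.recu a C Gs H).prem x hx = .arg (H.prem x h)) ∨
      ∃ i h, (IGraph.recu a C Gs H).prem x hx = .port i ⟨x, h⟩ := by
  by_cases h : x ∈ names Δ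
  · exact Or.inl ⟨h, dif_pos h⟩
  · exact Or.inr ⟨_, _, dif_neg h⟩

theorem cond (h : ∀ i, Good (Gs i) (m i) (d i) (lev i)) (h' : Good H m' d' lev') :
    Good (IGraph.cond a C Gs H) (m' + ∑ i, m i) (max (Finset.univ.sup d) d')
      (levCond lev lev') where
  pos_unique := by
    rintro (_ | ⟨i, v⟩ | v) (_ | ⟨j, w⟩ | w) e he he'
    · rfl
    · obtain ⟨e, rfl, hp'⟩ := (posOut_map _ _ _).1 he'; cases he
    · obtain ⟨e, rfl, hp'⟩ := (posOut_map _ _ _).1 he'; cases he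
    · obtain ⟨e, rfl, hp⟩ := (posOut_map _ _ _).1 he; cases he'
    · obtain ⟨e, rfl, hp⟩ := (posOut_map _ _ _).1 he
      obtain ⟨_, h₁, hp'⟩ := (posOut_map _ _ _).1 he'
      cases h₁
      rw [(h i).pos_unique v w e hp hp']
    · obtain ⟨e, rfl, hp⟩ := (posOut_map _ _ _).1 he
      obtain ⟨_, h₁, hp'⟩ := (posOut_map _ _ _).1 he'
      cases h₁
    · obtain ⟨e, rfl, hp⟩ := (posOut_map _ _ _).1 he; cases he'
    · obtain ⟨e, rfl, hp⟩ := (posOut_map _ _ _).1 he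
      obtain ⟨_, h₁, hp'⟩ := (posOut_map _ _ _).1 he'
      cases h₁
    · obtain ⟨e, rfl, hp⟩ := (posOut_map _ _ _).1 he
      obtain ⟨_, h₁, hp'⟩ := (posOut_map _ _ _).1 he'
      cases h₁
      rw [h'.pos_unique v w e hp hp']
  neg_unique := by
    rintro (_ | ⟨i, v⟩ | v) (_ | ⟨j, w⟩ | w) e he he'
    · rfl
    · obtain ⟨e, rfl, hp'⟩ := (negOut_map _ _ _).1 he'
      obtain ⟨c, he⟩ := he
      cases he
      exact absurd hp' ((h j).concl_neg _)
    · obtain ⟨e, rfl, hp'⟩ := (negOut_map _ _ _).1 he'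
      obtain ⟨c, he⟩ := he
      cases he
    · obtain ⟨e, rfl, hp⟩ := (negOut_map _ _ _).1 he
      obtain ⟨c, he'⟩ := he'
      cases he'
      exact absurd hp ((h i).concl_neg _)
    · obtain ⟨e, rfl, hp⟩ := (negOut_map _ _ _).1 he
      obtain ⟨_, h₁, hp'⟩ := (negOut_map _ _ _).1 he'
      cases h₁
      rw [(h i).neg_unique v w e hp hp']
    · obtain ⟨e, rfl, hp⟩ := (negOut_map _ _ _).1 he
      obtain ⟨_, h₁, hp'⟩ := (negOut_map _ _ _).1 he'
      cases h₁
    · obtain ⟨e, rfl, hp⟩ := (negOut_map _ _ _).1 he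
      obtain ⟨c, he'⟩ := he'
      cases he'
    · obtain ⟨e, rfl, hp⟩ := (negOut_map _ _ _).1 he
      obtain ⟨_, h₁, hp'⟩ := (negOut_map _ _ _).1 he'
      cases h₁
    · obtain ⟨e, rfl, hp⟩ := (negOut_map _ _ _).1 he
      obtain ⟨_, h₁, hp'⟩ := (negOut_map _ _ _).1 he'
      cases h₁
      rw [h'.neg_unique v w e hp hp']
  distinct := by
    rintro (_ | ⟨i, v⟩ | v)
    · trivial
    · exact (distinct_map (fun x y hxy => by cases hxy; rfl) _).2 ((h i).distinct v)
    · exact (distinct_map (fun x y hxy => by cases hxy; rfl) _).2 (h'.distinct v)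
  levelOK := by
    rintro (_ | ⟨i, v⟩ | v)
    · exact ⟨h'.lev_concl, fun c => (h c).lev_concl⟩
    · exact (levelOK_map _ _ _).2 ((h i).levelOK v)
    · exact (levelOK_map _ _ _).2 (h'.levelOK v)
  box_none := by
    rintro (_ | ⟨i, e⟩ | e) he
    · rfl
    · exact (h i).box_none e (by simpa [IGraph.cond] using he)
    · exact h'.box_none e (by simpa [IGraph.cond] using he)
  box_some := by
    rintro (_ | ⟨i, e⟩ | e) v a e₀ es g he hv
    · simp [IGraph.cond] at he
    · obtain ⟨v', hb, rfl⟩ := Option.map_eq_some_iff.1 he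
      obtain ⟨e₀', es', g', hn, rfl⟩ := map_eq_recu hv
      exact (h i).box_some e v' a e₀' es' g' hb hn
    · obtain ⟨v', hb, rfl⟩ := Option.map_eq_some_iff.1 he
      obtain ⟨e₀', es', g', hn, rfl⟩ := map_eq_recu hv
      exact h'.box_some e v' a e₀' es' g' hb hn
  lev_le := by
    rintro (_ | ⟨i, e⟩ | e)
    · exact Nat.zero_le _
    · exact ((h i).lev_le e).trans ((Finset.le_sup (f := d) (Finset.mem_univ i)).trans
        (le_max_left _ _))
    · exact (h'.lev_le e).trans (le_max_right _ _)
  counted := by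
    refine ((h'.counted.image Branching.arg).union
      (CardLe.iUnion (β := (IGraph.cond a C Gs H).Vert)
        (f := fun i => Branching.branch i '' {v | ((Gs i).node v).Counted})
        fun i => (h i).counted.image _)).mono ?_ le_rfl
    rintro (_ | ⟨i, v⟩ | v) hv
    · exact hv.elim
    · exact Or.inr (Set.mem_iUnion.2 ⟨i, v, (counted_map _ _).1 hv, rfl⟩)
    · exact Or.inl ⟨v, (counted_map _ _).1 hv, rfl⟩
  concl_neg := by
    rintro (_ | ⟨i, v⟩ | v) hv
    · obtain ⟨c, hv⟩ := hv
      cases hv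
    · obtain ⟨e, h₁, he⟩ := (negOut_map _ _ _).1 hv
      cases h₁
    · obtain ⟨e, h₁, he⟩ := (negOut_map _ _ _).1 hv
      cases h₁
  lev_concl := rfl
  prem_pos := by
    intro v x hx hv
    rcases cond_prem (C := C) (Gs := Gs) (H := H) x hx with ⟨hx', he⟩ | ⟨i, hx', he⟩ <;>
      rw [he] at hv <;> rcases v with _ | ⟨j, v⟩ | v
    · cases hv
    · obtain ⟨e, h₁, he⟩ := (posOut_map _ _ _).1 hv
      cases h₁
    · obtain ⟨e, h₁, he⟩ := (posOut_map _ _ _).1 hv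
      cases h₁
      exact h'.prem_pos _ _ _ he
    · cases hv
    · obtain ⟨e, h₁, he⟩ := (posOut_map _ _ _).1 hv
      cases h₁
      exact (h i).prem_pos _ _ _ he
    · obtain ⟨e, h₁, he⟩ := (posOut_map _ _ _).1 hv
      cases h₁
  lev_prem x hx := by
    rcases cond_prem (C := C) (Gs := Gs) (H := H) x hx with ⟨hx', he⟩ | ⟨i, hx', he⟩ <;> rw [he]
    exacts [h'.lev_prem _ _, (h i).lev_prem _ _]
  prem_inj x hx y hy hxy := by
    rcases cond_prem (C := C) (Gs := Gs) (H := H) x hx with ⟨hx', he⟩ | ⟨i, hx', he⟩ <;>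
      rcases cond_prem (C := C) (Gs := Gs) (H := H) y hy with ⟨hy', he'⟩ | ⟨j, hy', he'⟩ <;>
        rw [he, he'] at hxy
    · exact h'.prem_inj _ _ _ _ (Branching.arg.inj hxy)
    · cases hxy
    · cases hxy
    · obtain ⟨rfl, hxy⟩ := Branching.branch.inj hxy
      exact (h i).prem_inj _ _ _ _ (eq_of_heq hxy)

/-- Boxing raises the level of the branches by one. Former premises of the branches now receive
positive labels from exactly one port each, and the new premises outside of the box from no vertex.
-/
theorem recu (h : ∀ i, Good (Gs i) (m i) (d i) (lev i)) (h' : Good H m' d' lev') :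
    Good (IGraph.recu a C Gs H) (m' + (∑ i, m i) + (F.alg a).numCons)
      (max (Finset.univ.sup d) d' + 1) (levRecu lev lev') where
  pos_unique := by
    rintro (_ | ⟨i, x⟩ | ⟨i, v⟩ | v) (_ | ⟨j, y⟩ | ⟨j, w⟩ | w) e he he'
    · rfl
    · cases he; cases he'
    · obtain ⟨e, rfl, hp'⟩ := (posOut_map _ _ _).1 he'; cases he
    · obtain ⟨e, rfl, hp'⟩ := (posOut_map _ _ _).1 he'; cases he
    · cases he; cases he'
    · cases he
      obtain ⟨rfl, hxy⟩ := Boxed.inner.inj he'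
      have := (h i).prem_inj _ _ _ _ (eq_of_heq hxy)
      rw [Subtype.ext this]
    · obtain ⟨e, rfl, hp'⟩ := (posOut_map _ _ _).1 he'
      cases he
      exact absurd hp' ((h _).prem_pos _ _ _)
    · obtain ⟨e, rfl, hp'⟩ := (posOut_map _ _ _).1 he'; cases he
    · obtain ⟨e, rfl, hp⟩ := (posOut_map _ _ _).1 he; cases he'
    · obtain ⟨e, rfl, hp⟩ := (posOut_map _ _ _).1 he
      cases he'
      exact absurd hp ((h i).prem_pos _ _ _)
    · obtain ⟨e, rfl, hp⟩ := (posOut_map _ _ _).1 he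
      obtain ⟨_, h₁, hp'⟩ := (posOut_map _ _ _).1 he'
      cases h₁
      rw [(h i).pos_unique v w e hp hp']
    · obtain ⟨e, rfl, hp⟩ := (posOut_map _ _ _).1 he
      obtain ⟨_, h₁, hp'⟩ := (posOut_map _ _ _).1 he'
      cases h₁
    · obtain ⟨e, rfl, hp⟩ := (posOut_map _ _ _).1 he; cases he'
    · obtain ⟨e, rfl, hp⟩ := (posOut_map _ _ _).1 he; cases he'
    · obtain ⟨e, rfl, hp⟩ := (posOut_map _ _ _).1 he
      obtain ⟨_, h₁, hp'⟩ := (posOut_map _ _ _).1 he'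
      cases h₁
    · obtain ⟨e, rfl, hp⟩ := (posOut_map _ _ _).1 he
      obtain ⟨_, h₁, hp'⟩ := (posOut_map _ _ _).1 he'
      cases h₁
      rw [h'.pos_unique v w e hp hp']
  neg_unique := by
    rintro (_ | ⟨i, x⟩ | ⟨i, v⟩ | v) (_ | ⟨j, y⟩ | ⟨j, w⟩ | w) e he he'
    · rfl
    · exact he'.elim
    · obtain ⟨e, rfl, hp'⟩ := (negOut_map _ _ _).1 he'
      obtain ⟨c, he⟩ := he
      cases he
      exact absurd hp' ((h j).concl_neg _)
    · obtain ⟨e, rfl, hp'⟩ := (negOut_map _ _ _).1 he'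
      obtain ⟨c, he⟩ := he
      cases he
    · exact he.elim
    · exact he.elim
    · exact he.elim
    · exact he.elim
    · obtain ⟨e, rfl, hp⟩ := (negOut_map _ _ _).1 he
      obtain ⟨c, he'⟩ := he'
      cases he'
      exact absurd hp ((h i).concl_neg _)
    · exact he'.elim
    · obtain ⟨e, rfl, hp⟩ := (negOut_map _ _ _).1 he
      obtain ⟨_, h₁, hp'⟩ := (negOut_map _ _ _).1 he'
      cases h₁
      rw [(h i).neg_unique v w e hp hp']
    · obtain ⟨e, rfl, hp⟩ := (negOut_map _ _ _).1 he
      obtain ⟨_, h₁, hp'⟩ := (negOut_map _ _ _).1 he'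
      cases h₁
    · obtain ⟨e, rfl, hp⟩ := (negOut_map _ _ _).1 he
      obtain ⟨c, he'⟩ := he'
      cases he'
    · exact he'.elim
    · obtain ⟨e, rfl, hp⟩ := (negOut_map _ _ _).1 he
      obtain ⟨_, h₁, hp'⟩ := (negOut_map _ _ _).1 he'
      cases h₁
    · obtain ⟨e, rfl, hp⟩ := (negOut_map _ _ _).1 he
      obtain ⟨_, h₁, hp'⟩ := (negOut_map _ _ _).1 he'
      cases h₁
      rw [h'.neg_unique v w e hp hp']
  distinct := by
    rintro (_ | ⟨i, x⟩ | ⟨i, v⟩ | v)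
    · trivial
    · trivial
    · exact (distinct_map (fun x y hxy => by cases hxy; rfl) _).2 ((h i).distinct v)
    · exact (distinct_map (fun x y hxy => by cases hxy; rfl) _).2 (h'.distinct v)
  levelOK := by
    rintro (_ | ⟨i, x⟩ | ⟨i, v⟩ | v)
    · exact ⟨h'.lev_concl, fun c => congrArg (· + 1) (h c).lev_concl⟩
    · trivial
    · exact (levelOK_map _ _ _).2 (levelOK_succ ((h i).levelOK v))
    · exact (levelOK_map _ _ _).2 (h'.levelOK v)
  box_none := by
    rintro (_ | ⟨i, x⟩ | ⟨i, e⟩ | e) he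
    · rfl
    · rfl
    · simp [IGraph.recu] at he
    · exact h'.box_none e (by simpa [IGraph.recu] using he)
  box_some := by
    rintro (_ | ⟨i, x⟩ | ⟨i, e⟩ | e) v b e₀ es g he hv
    · simp [IGraph.recu] at he
    · simp [IGraph.recu] at he
    -- An edge that was in no box of its branch has level 0 there and is now closed by the new
    -- vertex; the other edges keep their innermost box.
    · cases hb : (Gs i).box e with
      | none =>
        simp only [IGraph.recu, hb, Option.elim_none] at he
        obtain rfl := Option.some.inj he
        obtain ⟨rfl, h₁, -, -⟩ := Node.recu.inj hv
        subst h₁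
        exact congrArg (· + 1) (((h i).box_none e hb).trans h'.lev_concl.symm)
      | some v' =>
        simp only [IGraph.recu, hb, Option.elim_some] at he
        obtain rfl := Option.some.inj he
        obtain ⟨e₀', es', g', hn, rfl⟩ := map_eq_recu hv
        exact congrArg (· + 1) ((h i).box_some e v' b e₀' es' g' hb hn)
    · obtain ⟨v', hb, rfl⟩ := Option.map_eq_some_iff.1 he
      obtain ⟨e₀', es', g', hn, rfl⟩ := map_eq_recu hv
      exact h'.box_some e v' b e₀' es' g' hb hn
  lev_le := by
    rintro (_ | ⟨i, x⟩ | ⟨i, e⟩ | e)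
    · exact Nat.zero_le _
    · exact Nat.zero_le _
    · exact Nat.succ_le_succ (((h i).lev_le e).trans ((Finset.le_sup (f := d)
        (Finset.mem_univ i)).trans (le_max_left _ _)))
    · exact (h'.lev_le e).trans ((le_max_right _ _).trans (Nat.le_succ _))
  counted := by
    -- The size of the term grows by the number of branches, which pays for the new vertex unless
    -- the algebra is empty; in that case it is not counted.
    have hmain : CardLe {v : (IGraph.recu a C Gs H).Vert | v = .main ∧ 0 < (F.alg a).numCons}
        (F.alg a).numCons := by
      rcases Nat.eq_zero_or_pos (F.alg a).numCons with h0 | h0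
      · exact .of_isEmpty fun v hv => by simp [h0] at hv
      · exact (CardLe.of_subset_singleton fun v hv => hv.1).mono subset_rfl h0
    refine (((h'.counted.image Boxed.arg).union
      (CardLe.iUnion (β := (IGraph.recu a C Gs H).Vert)
        (f := fun i => Boxed.inner i '' {v | ((Gs i).node v).Counted})
        fun i => (h i).counted.image _)).union hmain).mono ?_ le_rfl
    rintro (_ | ⟨i, x⟩ | ⟨i, v⟩ | v) hv
    · exact Or.inr ⟨rfl, hv⟩
    · exact hv.elim
    · exact Or.inl (Or.inr (Set.mem_iUnion.2 ⟨i, v, (counted_map _ _).1 hv, rfl⟩))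
    · exact Or.inl (Or.inl ⟨v, (counted_map _ _).1 hv, rfl⟩)
  concl_neg := by
    rintro (_ | ⟨i, x⟩ | ⟨i, v⟩ | v) hv
    · obtain ⟨c, hv⟩ := hv
      cases hv
    · exact hv
    · obtain ⟨e, h₁, he⟩ := (negOut_map _ _ _).1 hv
      cases h₁
    · obtain ⟨e, h₁, he⟩ := (negOut_map _ _ _).1 hv
      cases h₁
  lev_concl := rfl
  prem_pos := by
    intro v x hx hv
    rcases recu_prem (C := C) (Gs := Gs) (H := H) x hx with ⟨hx', he⟩ | ⟨i, hx', he⟩ <;>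
      rw [he] at hv <;> rcases v with _ | ⟨j, y⟩ | ⟨j, v⟩ | v
    · cases hv
    · cases hv
    · obtain ⟨e, h₁, he⟩ := (posOut_map _ _ _).1 hv
      cases h₁
    · obtain ⟨e, h₁, he⟩ := (posOut_map _ _ _).1 hv
      cases h₁
      exact h'.prem_pos _ _ _ he
    · cases hv
    · cases hv
    · obtain ⟨e, h₁, he⟩ := (posOut_map _ _ _).1 hv
      cases h₁
    · obtain ⟨e, h₁, he⟩ := (posOut_map _ _ _).1 hv
      cases h₁
  lev_prem x hx := by
    rcases recu_prem (C := C) (Gs := Gs) (H := H) x hx with ⟨hx', he⟩ | ⟨i, hx', he⟩ <;> rw [he]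
    exacts [h'.lev_prem _ _, rfl]
  prem_inj x hx y hy hxy := by
    rcases recu_prem (C := C) (Gs := Gs) (H := H) x hx with ⟨hx', he⟩ | ⟨i, hx', he⟩ <;>
      rcases recu_prem (C := C) (Gs := Gs) (H := H) y hy with ⟨hy', he'⟩ | ⟨j, hy', he'⟩ <;>
        rw [he, he'] at hxy
    · exact h'.prem_inj _ _ _ _ (Boxed.arg.inj hxy)
    · cases hxy
    · cases hxy
    · obtain ⟨rfl, hxy⟩ := Boxed.port.inj hxy
      exact congrArg Subtype.val (eq_of_heq hxy)

end branching

end Good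

/-- The size of the term bounds the relevant vertices, and the recursion depth bounds the nesting of
boxes. -/
theorem Der.exists_good {D : Set (Ty F)} {Γ : Ctx F} {M : Tm F} {A : Ty F} (π : Der D Γ M A) :
    ∃ lev, Good π.graph M.size π.depth lev := by
  induction π with
  | ax x A => exact ⟨_, .ax x A⟩
  | weak x A hx π ih =>
    obtain ⟨lev, h⟩ := ih
    exact ⟨_, h.weak⟩
  | contr x y z A hA hz π ih =>
    obtain ⟨lev, h⟩ := ih
    rw [Tm.size_rename]
    exact ⟨_, h.contr π.nodup_names⟩
  | @lam Γ M x A B π ih =>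
    obtain ⟨lev, h⟩ := ih
    have hnd := π.nodup_names
    simp only [names_cons, Multiset.nodup_cons] at hnd
    have h' := h.lam (B := B) hnd.1
    refine ⟨_, { h' with counted := h'.counted.mono subset_rfl ?_ }⟩
    simp only [Tm.abs, Tm.size, Tm.size_closeAt]
    omega
  | app A B h π₁ π₂ ih₁ ih₂ =>
    obtain ⟨lev₁, h₁⟩ := ih₁
    obtain ⟨lev₂, h₂⟩ := ih₂
    exact ⟨_, h₁.app h₂⟩
  | con a c n => exact ⟨_, .con a c n⟩
  | cond a m C h πs π ihs ih =>
    obtain ⟨lev', h'⟩ := ih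
    choose lev h using ihs
    have h'' := Good.cond (C := C) h h'
    exact ⟨_, { h'' with counted := h''.counted.mono subset_rfl (Nat.le_add_right _ _) }⟩
  | recu a m C h hD πs π ihs ih =>
    obtain ⟨lev', h'⟩ := ih
    choose lev h using ihs
    exact ⟨_, Good.recu (C := C) h h'⟩

end HRec

namespace HRec

variable {F : Family}

/-! ### Foci, term contexts and guided paths -/

namespace TyCtx

@[simp]
theorem positive_left (L : TyCtx F) (A : Ty F) : (left L A).Positive ↔ ¬ L.Positive := Iff.rfl

@[simp]
theorem positive_right (L : TyCtx F) (A : Ty F) : (right A L).Positive ↔ L.Positive := Iff.rfl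

@[simp]
theorem positive_hole : (hole : TyCtx F).Positive := trivial

@[simp]
theorem positive_rights (A : Ty F) (n : ℕ) (L : TyCtx F) :
    (rights A n L).Positive ↔ L.Positive := by
  induction n with
  | zero => rfl
  | succ n ih => exact ih

theorem rights_injective (A : Ty F) (n : ℕ) : Function.Injective (rights A n) := by
  intro L L' h
  induction n with
  | zero => exact h
  | succ n ih => exact ih (right.inj h).2

/-- A focus past all n arguments differs from one inside argument j < n. This separates the rules
that write to the same branch edge. -/
theorem rights_ne_rights_left {A B : Ty F} {j n : ℕ} (hj : j < n) (L L' : TyCtx F) :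
    rights A n L ≠ rights A j (left L' B) := by
  induction n generalizing j with
  | zero => exact absurd hj (Nat.not_lt_zero j)
  | succ n ih =>
    cases j with
    | zero => exact fun h => by cases h
    | succ j => exact fun h => ih (Nat.lt_of_succ_lt_succ hj) (right.inj h).2

theorem rights_left_inj {A B B' : Ty F} {j k : ℕ} {L L' : TyCtx F}
    (h : rights A j (left L B) = rights A k (left L' B')) : j = k ∧ L = L' := by
  induction j generalizing k with
  | zero =>
    cases k with
    | zero => exact ⟨rfl, (left.inj h).1⟩
    | succ k => cases h
  | succ j ih =>
    cases k with
    | zero => cases h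
    | succ k =>
      obtain ⟨h₁, h₂⟩ := ih (right.inj h).2
      exact ⟨congrArg (· + 1) h₁, h₂⟩

end TyCtx

namespace ECtx

variable {a : F.Alg}

theorem comp_frame_ne_hole (u : ECtx F a) (c : F.Cons a) (ts : Fin (F.ar c) → ETerm F a)
    (k : Fin (F.ar c)) : u.comp (frame c ts k) ≠ hole := by
  cases u <;> simp [comp, frame]

/-- A frame forgets only the argument at its hole, which `hk` restores. -/
theorem frame_inj {c c' : F.Cons a} {ts : Fin (F.ar c) → ETerm F a} {ts' : Fin (F.ar c') → ETerm F a}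
    {k : Fin (F.ar c)} {k' : Fin (F.ar c')} (h : frame c ts k = frame c' ts' k')
    (hk : ts k = ts' k') : (⟨c, ts, k⟩ : Σ c : F.Cons a, (Fin (F.ar c) → ETerm F a) × Fin (F.ar c)) =
      ⟨c', ts', k'⟩ := by
  simp only [frame, mk.injEq, and_true] at h
  obtain ⟨rfl, h₁, h₂⟩ := h
  obtain rfl := eq_of_heq h₁
  have h₃ := eq_of_heq h₂
  have : ts = ts' := by
    funext j
    by_cases hj : j = k
    · rw [hj, hk]
    · exact congrFun h₃ ⟨j, hj⟩
  rw [this]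

/-- The frame next to the hole can be split off uniquely, so the context of a subterm determines
that of its parent. -/
theorem comp_frame_inj {u u' : ECtx F a} {c c' : F.Cons a} {ts : Fin (F.ar c) → ETerm F a}
    {ts' : Fin (F.ar c') → ETerm F a} {k : Fin (F.ar c)} {k' : Fin (F.ar c')}
    (h : u.comp (frame c ts k) = u'.comp (frame c' ts' k')) :
    u = u' ∧ frame c ts k = frame c' ts' k' := by
  induction u generalizing u' with
  | hole =>
    cases u' with
    | hole => exact ⟨rfl, h⟩
    | mk d i rest u' =>
      simp only [comp, frame, mk.injEq] at h
      exact absurd h.2.2.2.symm (comp_frame_ne_hole u' c' ts' k')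
  | mk d i rest u ih =>
    cases u' with
    | hole =>
      simp only [comp, frame, mk.injEq] at h
      exact absurd h.2.2.2 (comp_frame_ne_hole u c ts k)
    | mk d' i' rest' u' =>
      simp only [comp, mk.injEq] at h
      obtain ⟨rfl, h₁, h₂, h₃⟩ := h
      obtain rfl := eq_of_heq h₁
      obtain rfl := eq_of_heq h₂
      obtain ⟨rfl, h₄⟩ := ih h₃
      exact ⟨rfl, h₄⟩

theorem plug_comp (u w : ECtx F a) (t : ETerm F a) : (u.comp w).plug t = u.plug (w.plug t) := by
  induction u with
  | hole => rfl
  | mk c i rest u ih => simp [comp, plug, ih]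

theorem plug_frame (c : F.Cons a) (ts : Fin (F.ar c) → ETerm F a) (k : Fin (F.ar c)) :
    (frame c ts k).plug (ts k) = .mk c ts := by
  simp only [frame, plug]
  congr 1
  funext j
  split_ifs with h
  · rw [h]
  · rfl

end ECtx

theorem ETerm.size_lt {a : F.Alg} (c : F.Cons a) (ts : Fin (F.ar c) → ETerm F a) (i : Fin (F.ar c)) :
    (ts i).size < (ETerm.mk c ts).size := by
  have := Finset.single_le_sum (f := fun i => (ts i).size) (fun i _ => Nat.zero_le _)
    (Finset.mem_univ i)
  simp only [ETerm.size]
  omega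

namespace CTree

variable {V E : Type}

/-- `S` is a subtree of `T`. -/
def Sub (S T : CTree F V E) : Prop := Relation.ReflTransGen IsChild S T

theorem Guided.sub {a : F.Alg} {T S : CTree F V E} {u : ECtx F a} (h : Guided T u S) : S.Sub T := by
  induction h with
  | here T => exact .refl
  | same _ _ ih => exact ih.tail ⟨0, rfl⟩
  | con i _ _ _ ih => exact ih.tail ⟨i, rfl⟩

theorem Guided.cases' {a : F.Alg} {T S : CTree F V E} {u : ECtx F a} (h : Guided T u S) :
    u = .hole ∧ S = T ∨
    (∃ l f, T = node l 1 f ∧ (f 0).val = l.val ∧ Guided (f 0) u S) ∨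
    ∃ (c : F.Cons a) (ts : Fin (F.ar c) → ETerm F a) (i : Fin (F.ar c)) (w : ECtx F a)
      (l : Label F V E) (f : Fin (F.ar c) → CTree F V E), T = node l (F.ar c) f ∧
      l.val = ⟨a, .mk c ts⟩ ∧ (∀ j, (f j).val = ⟨a, ts j⟩) ∧ u = .mk c i (fun j => ts j.1) w ∧
      Guided (f i) w S := by
  cases h with
  | here => exact Or.inl ⟨rfl, rfl⟩
  | same h₁ h₂ => exact Or.inr (Or.inl ⟨_, _, rfl, h₁, h₂⟩)
  | con i h₁ h₂ h₃ => exact Or.inr (Or.inr ⟨_, _, i, _, _, _, rfl, h₁, h₂, rfl, h₃⟩)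

theorem val_ne_of_con {a : F.Alg} {c : F.Cons a} {ts : Fin (F.ar c) → ETerm F a} {l : Label F V E}
    {f : Fin (F.ar c) → CTree F V E} (h₁ : l.val = ⟨a, .mk c ts⟩)
    (h₂ : ∀ j, (f j).val = ⟨a, ts j⟩) {S : CTree F V E} (hS : S.IsChild (node l (F.ar c) f)) :
    S.val ≠ l.val := by
  obtain ⟨j, rfl⟩ := hS
  rw [h₁, h₂ j]
  intro h
  have := ETerm.size_lt c ts j
  rw [eq_of_heq (Sigma.mk.inj h).2] at this
  exact lt_irrefl _ this

/-- A path guided by `u` has no choice: at a constructor the children carry strictly smaller terms,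
so the two ways to proceed exclude each other. The last condition in `IsB` fixes where the path
stops once `u` is used up. -/
theorem IsB.unique {a : F.Alg} {T S S' : CTree F V E} {u : ECtx F a} {s : ETerm F a}
    (h : IsB T u s S) (h' : IsB T u s S') : S = S' := by
  obtain ⟨h₁, h₂, h₃⟩ := h
  obtain ⟨h₁', h₂', h₃'⟩ := h'
  induction h₁ with
  | here T =>
    rcases h₁'.cases' with ⟨-, rfl⟩ | ⟨l, f, rfl, hv, -⟩ | ⟨_, _, _, _, _, _, _, _, _, h, _⟩
    · rfl
    · exact absurd hv (h₃ _ ⟨0, rfl⟩)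
    · cases h
  | @same l f u S hv _ ih =>
    rcases h₁'.cases' with ⟨-, rfl⟩ | ⟨l', f', hT, -, hG⟩ | ⟨c, ts, i, w, l', f', hT, h₄, h₅, -, -⟩
    · exact absurd hv (h₃' _ ⟨0, rfl⟩)
    · obtain ⟨-, -, hf⟩ := node.inj hT
      obtain rfl := eq_of_heq hf
      exact ih h₂ h₃ hG
    · have hl : l = l' := (node.inj hT).1
      refine absurd (hl ▸ hv) (val_ne_of_con h₄ h₅ ?_)
      rw [← hT]
      exact ⟨0, rfl⟩
  | @con l c f ts i u S h₄ h₅ _ ih =>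
    rcases h₁'.cases' with ⟨h, -⟩ | ⟨l', f', hT, hv, -⟩ | ⟨c', ts', i', w, l', f', hT, h₄', -, hu, hG⟩
    · cases h
    · have hl : l = l' := (node.inj hT).1
      refine absurd (hl ▸ hv) (val_ne_of_con h₄ h₅ ?_)
      rw [hT]
      exact ⟨0, rfl⟩
    · obtain ⟨hc, hi, -, rfl⟩ := ECtx.mk.inj hu
      subst hc
      obtain rfl := eq_of_heq hi
      obtain ⟨-, -, hf⟩ := node.inj hT
      obtain rfl := eq_of_heq hf
      exact ih h₂ h₃ hG

/-- The roots of two trees carry the same edge, stack and focus. -/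
def SamePos (S T : CTree F V E) : Prop :=
  S.root.edge = T.root.edge ∧ S.root.stack = T.root.stack ∧ S.root.focus = T.root.focus

theorem At.samePos {S T : CTree F V E} {e : E} {U : List (StackElt F V)} {L : TyCtx F}
    (hS : S.At e U L) (hT : T.At e U L) : SamePos S T :=
  ⟨hS.1.trans hT.1.symm, hS.2.1.trans hT.2.1.symm, hS.2.2.trans hT.2.2.symm⟩

theorem samePos_of_root {S T : CTree F V E} {x y : Val F} {e : E} {U : List (StackElt F V)}
    {L : TyCtx F} (hS : S.root = ⟨x, e, U, L⟩) (hT : T.root = ⟨y, e, U, L⟩) : SamePos S T := by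
  simp [SamePos, hS, hT]

@[simp]
theorem root_node (l : Label F V E) (n : ℕ) (f : Fin n → CTree F V E) : (node l n f).root = l := rfl

@[simp]
theorem root_ext (T : CTree F V E) (e : E) (U : List (StackElt F V)) (L : TyCtx F) :
    (T.ext e U L).root = ⟨T.val, e, U, L⟩ := rfl

end CTree

/-! ### Single rules -/

open CTree in
/-- The trees obtained from trees with the property `X` by one application of a rule for the vertex
`v` labelled with the given node. -/
inductive Rule {Γ : Ctx F} (G : IGraph Γ) (X : CTree F G.Vert G.Edge → Prop) (v : G.Vert) :
    Node F G.Edge → CTree F G.Vert G.Edge → Prop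
  | lam_var_pos {e g h T U P} : X T → T.At h U (.left P (G.ty g)) → P.Positive →
      Rule G X v (.lam e g h) (T.ext e U P)
  | lam_var_neg {e g h T U N} : X T → T.At e U N → ¬ N.Positive →
      Rule G X v (.lam e g h) (T.ext h U (.left N (G.ty g)))
  | lam_body_pos {e g h T U P} : X T → T.At g U P → P.Positive →
      Rule G X v (.lam e g h) (T.ext h U (.right (G.ty e) P))
  | lam_body_neg {e g h T U N} : X T → T.At h U (.right (G.ty e) N) → ¬ N.Positive →
      Rule G X v (.lam e g h) (T.ext g U N)
  | app_arg_pos {e g h T U P} : X T → T.At g U P → P.Positive →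
      Rule G X v (.app e g h) (T.ext e U (.left P (G.ty h)))
  | app_arg_neg {e g h T U N} : X T → T.At e U (.left N (G.ty h)) → ¬ N.Positive →
      Rule G X v (.app e g h) (T.ext g U N)
  | app_res_neg {e g h T U N} : X T → T.At h U N → ¬ N.Positive →
      Rule G X v (.app e g h) (T.ext e U (.right (G.ty g) N))
  | app_res_pos {e g h T U P} : X T → T.At e U (.right (G.ty g) P) → P.Positive →
      Rule G X v (.app e g h) (T.ext h U P)
  | contr_left {e g h T U} : X T → T.At h U .hole → Rule G X v (.contr e g h) (T.ext e U .hole)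
  | contr_right {e g h T U} : X T → T.At h U .hole → Rule G X v (.contr e g h) (T.ext g U .hole)
  | con_zero {a n e} {c : F.Cons a} {ts : Fin (F.ar c) → ETerm F a}
      {f : Fin 0 → CTree F G.Vert G.Edge} : F.ar c = 0 → G.box e = none →
      Rule G X v (.con a c n e) (.node ⟨⟨a, .mk c ts⟩, e, [], .hole⟩ 0 f)
  | con_zero_box {a n e} {c : F.Cons a} {ts : Fin (F.ar c) → ETerm F a}
      {f : Fin 0 → CTree F G.Vert G.Edge} {w b e₀ es g T U} {u : ECtx F b} {t : ETerm F b} :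
      F.ar c = 0 → G.box e = some w → G.node w = .recu b e₀ es g → X T →
      T.root = ⟨⟨b, u.plug t⟩, e₀, U, .hole⟩ →
      Rule G X v (.con a c n e) (.node ⟨⟨a, .mk c ts⟩, e, ⟨b, u, t, w⟩ :: U, .hole⟩ 0 f)
  | con_succ {a n e U} {c : F.Cons a} {ts : Fin (F.ar c) → ETerm F a}
      {f : Fin (F.ar c) → CTree F G.Vert G.Edge} : 0 < F.ar c → (∀ j, X (f j)) →
      (∀ j, (f j).root = ⟨⟨a, ts j⟩, e, U, .rights (.base a n) j
        (.left .hole (Ty.lin (.base a n) (F.ar c - 1 - j) (.base a n)))⟩) →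
      Rule G X v (.con a c n e)
        (.node ⟨⟨a, .mk c ts⟩, e, U, .rights (.base a n) (F.ar c) .hole⟩ (F.ar c) f)
  | cond_pos {a e₀ es g T U S P} {c : F.Cons a} {ts : Fin (F.ar c) → ETerm F a} :
      X T → T.root = ⟨⟨a, .mk c ts⟩, e₀, U, .hole⟩ → X S →
      S.At (es c) U (.rights (G.ty e₀) (F.ar c) P) → P.Positive →
      Rule G X v (.cond a e₀ es g) (S.ext g U P)
  | cond_neg {a e₀ es g T U S N} {c : F.Cons a} {ts : Fin (F.ar c) → ETerm F a} :
      X T → T.root = ⟨⟨a, .mk c ts⟩, e₀, U, .hole⟩ → X S → S.At g U N → ¬ N.Positive →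
      Rule G X v (.cond a e₀ es g) (S.ext (es c) U (.rights (G.ty e₀) (F.ar c) N))
  | cond_sub {a e₀ es g T U S} {c : F.Cons a} {ts : Fin (F.ar c) → ETerm F a} (j : Fin (F.ar c)) :
      X T → T.root = ⟨⟨a, .mk c ts⟩, e₀, U, .hole⟩ → X S → T.IsB (.frame c ts j) (ts j) S →
      Rule G X v (.cond a e₀ es g) (S.ext (es c) U (.rights (G.ty e₀) j
        (.left .hole (Ty.lin (G.ty e₀) (F.ar c - 1 - j) (G.ty g)))))
  | recu_up {a e₀ es g T U S P} {u : ECtx F a} {c d : F.Cons a}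
      {ts : Fin (F.ar c) → ETerm F a} {ss : Fin (F.ar d) → ETerm F a} (k : Fin (F.ar c)) :
      X T → T.root = ⟨⟨a, u.plug (.mk c ts)⟩, e₀, U, .hole⟩ → ts k = .mk d ss → X S →
      S.At (es d) (⟨a, u.comp (.frame c ts k), ts k, v⟩ :: U)
        (.rights (G.ty e₀) (F.ar d) (.rights (G.ty g) (F.ar d) P)) → P.Positive →
      Rule G X v (.recu a e₀ es g) (S.ext (es c) (⟨a, u, .mk c ts, v⟩ :: U)
        (.rights (G.ty e₀) (F.ar c) (.rights (G.ty g) k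
          (.left P (Ty.lin (G.ty g) (F.ar c - 1 - k) (G.ty g))))))
  | recu_down {a e₀ es g T U S N} {u : ECtx F a} {c d : F.Cons a}
      {ts : Fin (F.ar c) → ETerm F a} {ss : Fin (F.ar d) → ETerm F a} (k : Fin (F.ar c)) :
      X T → T.root = ⟨⟨a, u.plug (.mk c ts)⟩, e₀, U, .hole⟩ → ts k = .mk d ss → X S →
      S.At (es c) (⟨a, u, .mk c ts, v⟩ :: U)
        (.rights (G.ty e₀) (F.ar c) (.rights (G.ty g) k
          (.left N (Ty.lin (G.ty g) (F.ar c - 1 - k) (G.ty g))))) → ¬ N.Positive →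
      Rule G X v (.recu a e₀ es g)
        (S.ext (es d) (⟨a, u.comp (.frame c ts k), ts k, v⟩ :: U)
          (.rights (G.ty e₀) (F.ar d) (.rights (G.ty g) (F.ar d) N)))
  | recu_out {a e₀ es g T U S P} {c : F.Cons a} {ts : Fin (F.ar c) → ETerm F a} :
      X T → T.root = ⟨⟨a, .mk c ts⟩, e₀, U, .hole⟩ → X S →
      S.At (es c) (⟨a, .hole, .mk c ts, v⟩ :: U)
        (.rights (G.ty e₀) (F.ar c) (.rights (G.ty g) (F.ar c) P)) → P.Positive →
      Rule G X v (.recu a e₀ es g) (S.ext g U P)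
  | recu_in {a e₀ es g T U S N} {c : F.Cons a} {ts : Fin (F.ar c) → ETerm F a} :
      X T → T.root = ⟨⟨a, .mk c ts⟩, e₀, U, .hole⟩ → X S → S.At g U N → ¬ N.Positive →
      Rule G X v (.recu a e₀ es g) (S.ext (es c) (⟨a, .hole, .mk c ts, v⟩ :: U)
        (.rights (G.ty e₀) (F.ar c) (.rights (G.ty g) (F.ar c) N)))
  | recu_sub {a e₀ es g T U S} {u : ECtx F a} {c : F.Cons a} {ts : Fin (F.ar c) → ETerm F a}
      (j : Fin (F.ar c)) : X T → T.root = ⟨⟨a, u.plug (.mk c ts)⟩, e₀, U, .hole⟩ → X S →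
      T.IsB (u.comp (.frame c ts j)) (ts j) S →
      Rule G X v (.recu a e₀ es g) (S.ext (es c) (⟨a, u, .mk c ts, v⟩ :: U) (.rights (G.ty e₀) j
        (.left .hole (Ty.lin (G.ty e₀) (F.ar c - 1 - j) (Ty.lin (G.ty g) (F.ar c) (G.ty g))))))
  | port {a e g w b e₀ es g' T U S} {u : ECtx F b} {s : ETerm F b} :
      G.box g = some w → G.node w = .recu b e₀ es g' → X T →
      T.root = ⟨⟨b, u.plug s⟩, e₀, U, .hole⟩ → X S → S.At e U .hole →
      Rule G X v (.port a e g) (S.ext g (⟨b, u, s, w⟩ :: U) .hole)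

namespace Rule

open CTree

variable {Γ : Ctx F} {G : IGraph Γ} {X Y : CTree F G.Vert G.Edge → Prop} {v : G.Vert}
  {n : Node F G.Edge} {T T' : CTree F G.Vert G.Edge}

theorem mono (h : Rule G X v n T) (hXY : ∀ T, X T → Y T) : Rule G Y v n T := by
  cases h with
  | lam_var_pos h₁ h₂ h₃ => exact lam_var_pos (hXY _ h₁) h₂ h₃
  | lam_var_neg h₁ h₂ h₃ => exact lam_var_neg (hXY _ h₁) h₂ h₃
  | lam_body_pos h₁ h₂ h₃ => exact lam_body_pos (hXY _ h₁) h₂ h₃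
  | lam_body_neg h₁ h₂ h₃ => exact lam_body_neg (hXY _ h₁) h₂ h₃
  | app_arg_pos h₁ h₂ h₃ => exact app_arg_pos (hXY _ h₁) h₂ h₃
  | app_arg_neg h₁ h₂ h₃ => exact app_arg_neg (hXY _ h₁) h₂ h₃
  | app_res_neg h₁ h₂ h₃ => exact app_res_neg (hXY _ h₁) h₂ h₃
  | app_res_pos h₁ h₂ h₃ => exact app_res_pos (hXY _ h₁) h₂ h₃
  | contr_left h₁ h₂ => exact contr_left (hXY _ h₁) h₂
  | contr_right h₁ h₂ => exact contr_right (hXY _ h₁) h₂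
  | con_zero h₁ h₂ => exact con_zero h₁ h₂
  | con_zero_box h₁ h₂ h₃ h₄ h₅ => exact con_zero_box h₁ h₂ h₃ (hXY _ h₄) h₅
  | con_succ h₁ h₂ h₃ => exact con_succ h₁ (fun j => hXY _ (h₂ j)) h₃
  | cond_pos h₁ h₂ h₃ h₄ h₅ => exact cond_pos (hXY _ h₁) h₂ (hXY _ h₃) h₄ h₅
  | cond_neg h₁ h₂ h₃ h₄ h₅ => exact cond_neg (hXY _ h₁) h₂ (hXY _ h₃) h₄ h₅
  | cond_sub j h₁ h₂ h₃ h₄ => exact cond_sub j (hXY _ h₁) h₂ (hXY _ h₃) h₄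
  | recu_up k h₁ h₂ h₃ h₄ h₅ h₆ => exact recu_up k (hXY _ h₁) h₂ h₃ (hXY _ h₄) h₅ h₆
  | recu_down k h₁ h₂ h₃ h₄ h₅ h₆ => exact recu_down k (hXY _ h₁) h₂ h₃ (hXY _ h₄) h₅ h₆
  | recu_out h₁ h₂ h₃ h₄ h₅ => exact recu_out (hXY _ h₁) h₂ (hXY _ h₃) h₄ h₅
  | recu_in h₁ h₂ h₃ h₄ h₅ => exact recu_in (hXY _ h₁) h₂ (hXY _ h₃) h₄ h₅
  | recu_sub j h₁ h₂ h₃ h₄ => exact recu_sub j (hXY _ h₁) h₂ (hXY _ h₃) h₄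
  | port h₁ h₂ h₃ h₄ h₅ h₆ => exact port h₁ h₂ (hXY _ h₃) h₄ (hXY _ h₅) h₆

theorem child (h : Rule G X v n T) {S : CTree F G.Vert G.Edge} (hS : S.IsChild T) : X S := by
  cases h
  case con_zero => obtain ⟨j, -⟩ := hS; exact j.elim0
  case con_zero_box => obtain ⟨j, -⟩ := hS; exact j.elim0
  case con_succ h₁ h₂ h₃ => obtain ⟨j, rfl⟩ := hS; exact h₂ j
  all_goals
    obtain ⟨-, rfl⟩ := hS
    assumption

theorem posOut (h : Rule G X v n T) (hT : T.root.focus.Positive) : n.PosOut T.root.edge := by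
  cases h <;> simp_all [Node.PosOut]

theorem negOut (h : Rule G X v n T) (hT : ¬ T.root.focus.Positive) : n.NegOut T.root.edge := by
  cases h <;> simp_all [Node.NegOut]

end Rule

end HRec

namespace HRec

variable {F : Family}

open CTree

variable {Γ : Ctx F} {G : IGraph Γ} {X X' : CTree F G.Vert G.Edge → Prop} {v : G.Vert}
  {n : Node F G.Edge} {T T' : CTree F G.Vert G.Edge}

/-- For a given vertex, the root position tells which rule was used and at which positions its
premises are rooted, so determinacy passes from the premises to the conclusion. The trees at
recursion or conditional arguments have determined positions too; their uniqueness fixes the head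
constructor, hence the branch. -/
theorem Rule.unique (hX : ∀ S S', X S → X' S' → SamePos S S' → S = S') (hn : n.Distinct)
    (h : Rule G X v n T) (h' : Rule G X' v n T') (hp : SamePos T T') : T = T' := by
  have hT : ∀ {x y : Val F} {e U} {S S' : CTree F G.Vert G.Edge}, X S → X' S' →
      S.root = ⟨x, e, U, .hole⟩ → S'.root = ⟨y, e, U, .hole⟩ → S = S' ∧ x = y :=
    fun {x y e U S S'} h₁ h₂ h₃ h₄ => by
      cases hX _ _ h₁ h₂ (samePos_of_root h₃ h₄)
      exact ⟨rfl, (Label.mk.inj (h₃.symm.trans h₄)).1⟩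
  -- Most pairs of different rules clash: in the outgoing edge (by `hn`), in the sign of the focus,
  -- in the arity of the constructor, or in the shape of focus or stack.
  cases h <;> cases h' <;> simp only [SamePos, root_ext, root_node, Node.Distinct] at hp hn <;>
    obtain ⟨h₁, h₂, h₃⟩ := hp
  all_goals try (first | exact absurd h₁ hn | exact absurd h₁.symm hn)
  all_goals try (
    have hP := congrArg TyCtx.Positive h₃
    simp only [TyCtx.positive_left, TyCtx.positive_rights,
      TyCtx.positive_hole, not_true, eq_iff_iff] at hP
    tauto)
  all_goals try omega
  all_goals try (simp only [TyCtx.left.injEq, TyCtx.right.injEq, and_true, true_and] at h₃)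
  all_goals try (subst h₂)
  all_goals try (subst h₃)
  all_goals try (cases hX _ _ ‹X _› ‹X' _› (At.samePos ‹_› ‹_›); first | rfl | (cases h₁; rfl))
  all_goals try contradiction
  case con_zero.con_zero | con_zero_box.con_zero_box =>
    all_goals
      rename F.ar _ = 0 => h0
      congr 1
      · congr 3
        exact funext fun j => absurd j.2 (by omega)
      · exact Subsingleton.elim _ _
  case con_succ.con_succ =>
    rename_i ts₁ f₁ _ x₁ r₁ ts₂ f₂ _ x₂ r₂
    have hf : f₁ = f₂ := funext fun j => hX _ _ (x₁ j) (x₂ j) (samePos_of_root (r₁ j) (r₂ j))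
    subst hf
    have : ts₁ = ts₂ := funext fun j => by
      simpa using (Label.mk.inj ((r₁ j).symm.trans (r₂ j))).1
    rw [this]
  case cond_pos.cond_pos =>
    rename_i T₁ U S₁ P c₁ ts₁ x₁ r₁ y₁ z₁ p₁ T₂ S₂ x₂ y₂ c₂ ts₂ r₂ p₂ z₂
    have hc := (hT x₁ x₂ r₁ r₂).2
    simp only [Sigma.mk.injEq, heq_eq_eq, true_and, ETerm.mk.injEq] at hc
    obtain ⟨rfl, -⟩ := hc
    rw [hX _ _ y₁ y₂ (z₁.samePos z₂)]
  case cond_neg.cond_neg =>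
    rename_i T₁ U S₁ N₁ c₁ ts₁ x₁ r₁ y₁ z₁ p₁ T₂ S₂ N₂ x₂ y₂ p₂ c₂ ts₂ r₂ z₂
    have hc := (hT x₁ x₂ r₁ r₂).2
    simp only [Sigma.mk.injEq, heq_eq_eq, true_and, ETerm.mk.injEq] at hc
    obtain ⟨rfl, -⟩ := hc
    obtain rfl := TyCtx.rights_injective _ _ h₃
    rw [hX _ _ y₁ y₂ (z₁.samePos z₂)]
  case cond_neg.cond_sub =>
    rename_i T₁ U S₁ N₁ c₁ ts₁ x₁ r₁ y₁ z₁ p₁ T₂ S₂ x₂ y₂ c₂ ts₂ j z₂ r₂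
    have hc := (hT x₁ x₂ r₁ r₂).2
    simp only [Sigma.mk.injEq, heq_eq_eq, true_and, ETerm.mk.injEq] at hc
    obtain ⟨rfl, -⟩ := hc
    exact absurd h₃ (TyCtx.rights_ne_rights_left (Fin.is_lt _) _ _)
  case cond_sub.cond_neg =>
    rename_i T₁ U S₁ c₁ ts₁ j x₁ r₁ y₁ z₁ T₂ S₂ N₂ x₂ y₂ p₂ c₂ ts₂ r₂ z₂
    have hc := (hT x₁ x₂ r₁ r₂).2
    simp only [Sigma.mk.injEq, heq_eq_eq, true_and, ETerm.mk.injEq] at hc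
    obtain ⟨rfl, -⟩ := hc
    exact absurd h₃.symm (TyCtx.rights_ne_rights_left (Fin.is_lt _) _ _)
  case cond_sub.cond_sub =>
    rename_i T₁ U S₁ c₁ ts₁ j x₁ r₁ y₁ z₁ T₂ S₂ x₂ y₂ c₂ ts₂ k z₂ r₂
    obtain ⟨rfl, hc⟩ := hT x₁ x₂ r₁ r₂
    simp only [Sigma.mk.injEq, heq_eq_eq, true_and, ETerm.mk.injEq] at hc
    obtain ⟨rfl, hts⟩ := hc
    obtain rfl := eq_of_heq hts
    obtain ⟨hk, -⟩ := TyCtx.rights_left_inj h₃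
    obtain rfl := Fin.ext hk
    rw [z₁.unique z₂]
  case recu_out.recu_out =>
    rename_i T₁ U S₁ P c₁ ts₁ x₁ r₁ y₁ z₁ p₁ T₂ S₂ x₂ y₂ c₂ ts₂ r₂ p₂ z₂
    have hc := (hT x₁ x₂ r₁ r₂).2
    simp only [Sigma.mk.injEq, heq_eq_eq, true_and, ETerm.mk.injEq] at hc
    obtain ⟨rfl, hts⟩ := hc
    obtain rfl := eq_of_heq hts
    rw [hX _ _ y₁ y₂ (z₁.samePos z₂)]
  all_goals try simp only [List.cons.injEq, StackElt.mk.injEq, heq_eq_eq, true_and, and_true,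
    ETerm.mk.injEq] at h₂
  case recu_up.recu_up =>
    rename_i hd' _ _ _ _ _ _ _ _ _ _ _ _ _ _ _ _ hd _ _
    obtain ⟨⟨rfl, rfl, hts⟩, rfl⟩ := h₂
    obtain rfl := eq_of_heq hts
    obtain ⟨hk, rfl⟩ := TyCtx.rights_left_inj (TyCtx.rights_injective _ _ h₃)
    obtain rfl := Fin.ext hk
    obtain rfl := (ETerm.mk.inj (hd'.symm.trans hd)).1
    cases hX _ _ ‹X _› ‹X' _› (At.samePos ‹_› ‹_›)
    rfl
  case recu_up.recu_down =>
    rename_i hd _ _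
    obtain ⟨⟨rfl, hc⟩, rfl⟩ := h₂
    obtain ⟨rfl, -⟩ := ETerm.mk.inj (hc.trans hd)
    exact absurd (TyCtx.rights_injective _ _ h₃).symm (TyCtx.rights_ne_rights_left (Fin.is_lt _) _ _)
  case recu_down.recu_up =>
    rename_i hd _ _ _ _ _ _ _ _ _ _ _ _ _ _ _ _ _ _ _
    obtain ⟨⟨rfl, hc⟩, rfl⟩ := h₂
    obtain ⟨rfl, -⟩ := ETerm.mk.inj (hd.symm.trans hc)
    exact absurd (TyCtx.rights_injective _ _ h₃) (TyCtx.rights_ne_rights_left (Fin.is_lt _) _ _)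
  case recu_up.recu_in =>
    obtain ⟨⟨rfl, rfl, hts⟩, rfl⟩ := h₂
    exact absurd (TyCtx.rights_injective _ _ h₃).symm (TyCtx.rights_ne_rights_left (Fin.is_lt _) _ _)
  case recu_in.recu_up =>
    obtain ⟨⟨rfl, rfl, hts⟩, rfl⟩ := h₂
    exact absurd (TyCtx.rights_injective _ _ h₃) (TyCtx.rights_ne_rights_left (Fin.is_lt _) _ _)
  case recu_up.recu_sub =>
    obtain ⟨⟨rfl, rfl, hts⟩, rfl⟩ := h₂
    exact absurd h₃ (TyCtx.rights_ne_rights_left (Fin.is_lt _) _ _)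
  case recu_sub.recu_up =>
    obtain ⟨⟨rfl, rfl, hts⟩, rfl⟩ := h₂
    exact absurd h₃.symm (TyCtx.rights_ne_rights_left (Fin.is_lt _) _ _)
  case recu_sub.recu_in =>
    obtain ⟨⟨rfl, rfl, hts⟩, rfl⟩ := h₂
    exact absurd h₃.symm (TyCtx.rights_ne_rights_left (Fin.is_lt _) _ _)
  case recu_in.recu_sub =>
    obtain ⟨⟨rfl, rfl, hts⟩, rfl⟩ := h₂
    exact absurd h₃ (TyCtx.rights_ne_rights_left (Fin.is_lt _) _ _)
  case recu_in.recu_in =>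
    obtain ⟨⟨rfl, hts⟩, rfl⟩ := h₂
    obtain rfl := TyCtx.rights_injective _ _ (TyCtx.rights_injective _ _ h₃)
    cases hX _ _ ‹X _› ‹X' _› (At.samePos ‹_› ‹_›)
    obtain rfl := eq_of_heq hts
    rfl
  -- The copy of the box for the whole argument has the empty context, a copy for a proper subterm
  -- has not.
  case recu_in.recu_down => exact absurd h₂.1.1.symm (ECtx.comp_frame_ne_hole _ _ _ _)
  case recu_down.recu_in => exact absurd h₂.1.1 (ECtx.comp_frame_ne_hole _ _ _ _)
  case recu_down.recu_down =>
    rename_i hd' _ _ _ _ _ _ _ _ _ _ _ _ _ _ _ _ hd _ _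
    obtain ⟨⟨hu, hc⟩, rfl⟩ := h₂
    -- The copy for a subterm determines the copy for its parent and the index of the subterm.
    obtain ⟨rfl, hw⟩ := ECtx.comp_frame_inj hu
    cases ECtx.frame_inj hw hc
    obtain rfl := (ETerm.mk.inj (hd'.symm.trans hd)).1
    obtain rfl := TyCtx.rights_injective _ _ (TyCtx.rights_injective _ _ h₃)
    cases hX _ _ ‹X _› ‹X' _› (At.samePos ‹_› ‹_›)
    rfl
  case recu_down.recu_sub =>
    rename_i hd' _ _ _ _ _ _ _ _ _ _ _ _ _ _
    obtain ⟨⟨rfl, hc⟩, rfl⟩ := h₂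
    obtain ⟨rfl, -⟩ := ETerm.mk.inj (hd'.symm.trans hc)
    exact absurd h₃ (TyCtx.rights_ne_rights_left (Fin.is_lt _) _ _)
  case recu_sub.recu_down =>
    rename_i hd' _ _
    obtain ⟨⟨rfl, hc⟩, rfl⟩ := h₂
    obtain ⟨rfl, -⟩ := ETerm.mk.inj (hc.trans hd')
    exact absurd h₃.symm (TyCtx.rights_ne_rights_left (Fin.is_lt _) _ _)
  case recu_sub.recu_sub =>
    rename_i T₁ U₁ S₁ u₁ c₁ ts₁ j x₁ r₁ y₁ z₁ T₂ U₂ S₂ x₂ y₂ u₂ c₂ ts₂ k z₂ r₂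
    obtain ⟨⟨rfl, rfl, hts⟩, rfl⟩ := h₂
    obtain rfl := eq_of_heq hts
    obtain ⟨hk, -⟩ := TyCtx.rights_left_inj h₃
    obtain rfl := Fin.ext hk
    obtain ⟨rfl, -⟩ := hT x₁ x₂ r₁ r₂
    rw [z₁.unique z₂]
  case port.port =>
    obtain ⟨⟨rfl, hu, hs, rfl⟩, rfl⟩ := h₂
    obtain rfl := eq_of_heq hu
    obtain rfl := eq_of_heq hs
    cases hX _ _ ‹X _› ‹X' _› (At.samePos ‹_› ‹_›)
    rfl

/-! ### Stages of the generation of trees -/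

/-- The trees generated in at most `h` rounds. -/
def Stage (G : IGraph Γ) : ℕ → CTree F G.Vert G.Edge → Prop
  | 0, _ => False
  | h + 1, T => ∃ v, Rule G (Stage G h) v (G.node v) T

namespace Stage

variable {h h' : ℕ} {S : CTree F G.Vert G.Edge}

theorem succ (hT : Stage G h T) : Stage G (h + 1) T := by
  induction h generalizing T with
  | zero => exact hT.elim
  | succ h ih =>
    obtain ⟨v, hv⟩ := hT
    exact ⟨v, hv.mono fun _ => ih⟩

theorem mono (hT : Stage G h T) (hh : h ≤ h') : Stage G h' T := by
  induction hh with
  | refl => exact hT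
  | step _ ih => exact ih.succ

theorem child (hT : Stage G h T) (hS : S.IsChild T) : Stage G h S := by
  cases h with
  | zero => exact hT.elim
  | succ h =>
    obtain ⟨v, hv⟩ := hT
    exact succ (hv.child hS)

theorem sub (hT : Stage G h T) (hS : S.Sub T) : Stage G h S := by
  induction hS using Relation.ReflTransGen.head_induction_on with
  | refl => exact hT
  | head h _ ih => exact ih.child h

/-- Determinacy of the semantics: the edge and the sign of the focus at the root determine the last
vertex, and `Rule.unique` does the rest. -/
theorem unique {m d : ℕ} {lev : G.Edge → ℕ} (hG : Good G m d lev) (hT : Stage G h T)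
    (hT' : Stage G h' T') (hp : SamePos T T') : T = T' := by
  induction h generalizing h' T T' with
  | zero => exact hT.elim
  | succ h ih =>
    cases h' with
    | zero => exact hT'.elim
    | succ h' =>
      obtain ⟨v, hv⟩ := hT
      obtain ⟨v', hv'⟩ := hT'
      obtain rfl : v = v' := by
        by_cases hpos : T.root.focus.Positive
        · have hpos' := hpos
          rw [hp.2.2] at hpos'
          exact hG.pos_unique v v' _ (hv.posOut hpos) (hp.1 ▸ hv'.posOut hpos')
        · have hpos' := hpos
          rw [hp.2.2] at hpos'
          exact hG.neg_unique v v' _ (hv.negOut hpos) (hp.1 ▸ hv'.negOut hpos')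
      exact hv.unique (fun S S' hS hS' hSS => ih hS hS' hSS) (hG.distinct v) hv' hp

end Stage

/-- Stages are closed under subtrees, so the subtrees B(T, u, s) used by some rules need no separate
generation. -/
theorem InT.exists_stage (hT : InT G T) : ∃ h, Stage G h T := by
  have pair : ∀ {S S' : CTree F G.Vert G.Edge}, (∃ h, Stage G h S) → (∃ h, Stage G h S') →
      ∃ h, Stage G h S ∧ Stage G h S' := fun ⟨h, hS⟩ ⟨h', hS'⟩ =>
    ⟨max h h', hS.mono (le_max_left _ _), hS'.mono (le_max_right _ _)⟩
  have step : ∀ {h v n} {S : CTree F G.Vert G.Edge}, G.node v = n → Rule G (Stage G h) v n S →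
      ∃ h, Stage G h S := fun {h v n S} hn hS => ⟨h + 1, v, hn ▸ hS⟩
  induction hT with
  | lam_var_pos h₁ _ h₂ h₃ ih => obtain ⟨h, ih⟩ := ih; exact step h₁ (.lam_var_pos ih h₂ h₃.1)
  | lam_var_neg h₁ _ h₂ h₃ ih => obtain ⟨h, ih⟩ := ih; exact step h₁ (.lam_var_neg ih h₂ h₃.1)
  | lam_body_pos h₁ _ h₂ h₃ ih => obtain ⟨h, ih⟩ := ih; exact step h₁ (.lam_body_pos ih h₂ h₃.1)
  | lam_body_neg h₁ _ h₂ h₃ ih => obtain ⟨h, ih⟩ := ih; exact step h₁ (.lam_body_neg ih h₂ h₃.1)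
  | app_arg_pos h₁ _ h₂ h₃ ih => obtain ⟨h, ih⟩ := ih; exact step h₁ (.app_arg_pos ih h₂ h₃.1)
  | app_arg_neg h₁ _ h₂ h₃ ih => obtain ⟨h, ih⟩ := ih; exact step h₁ (.app_arg_neg ih h₂ h₃.1)
  | app_res_neg h₁ _ h₂ h₃ ih => obtain ⟨h, ih⟩ := ih; exact step h₁ (.app_res_neg ih h₂ h₃.1)
  | app_res_pos h₁ _ h₂ h₃ ih => obtain ⟨h, ih⟩ := ih; exact step h₁ (.app_res_pos ih h₂ h₃.1)
  | contr_left h₁ _ h₂ ih => obtain ⟨h, ih⟩ := ih; exact step h₁ (.contr_left ih h₂)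
  | contr_right h₁ _ h₂ ih => obtain ⟨h, ih⟩ := ih; exact step h₁ (.contr_right ih h₂)
  | con_zero h₁ h₂ h₃ => exact step (h := 0) h₁ (.con_zero h₂ h₃)
  | con_zero_box h₁ h₂ h₃ h₄ _ h₅ ih =>
    obtain ⟨h, ih⟩ := ih
    exact step h₁ (.con_zero_box h₂ h₃ h₄ ih h₅)
  | con_succ h₁ h₂ _ h₃ ih =>
    choose h ih using ih
    exact step h₁ (.con_succ h₂
      (fun j => (ih j).mono (Finset.le_sup (f := h) (Finset.mem_univ j))) h₃)
  | cond_pos h₁ _ h₂ _ h₃ h₄ ih ih' =>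
    obtain ⟨h, ih, ih'⟩ := pair ih ih'
    exact step h₁ (.cond_pos ih h₂ ih' h₃ h₄.1)
  | cond_neg h₁ _ h₂ _ h₃ h₄ ih ih' =>
    obtain ⟨h, ih, ih'⟩ := pair ih ih'
    exact step h₁ (.cond_neg ih h₂ ih' h₃ h₄.1)
  | cond_sub j h₁ _ h₂ h₃ ih =>
    obtain ⟨h, ih⟩ := ih
    exact step h₁ (.cond_sub j ih h₂ (ih.sub h₃.1.sub) h₃)
  | recu_up k h₁ _ h₂ h₃ _ h₄ h₅ ih ih' =>
    obtain ⟨h, ih, ih'⟩ := pair ih ih'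
    exact step h₁ (.recu_up k ih h₂ h₃ ih' h₄ h₅.1)
  | recu_down k h₁ _ h₂ h₃ _ h₄ h₅ ih ih' =>
    obtain ⟨h, ih, ih'⟩ := pair ih ih'
    exact step h₁ (.recu_down k ih h₂ h₃ ih' h₄ h₅.1)
  | recu_out h₁ _ h₂ _ h₃ h₄ ih ih' =>
    obtain ⟨h, ih, ih'⟩ := pair ih ih'
    exact step h₁ (.recu_out ih h₂ ih' h₃ h₄.1)
  | recu_in h₁ _ h₂ _ h₃ h₄ ih ih' =>
    obtain ⟨h, ih, ih'⟩ := pair ih ih'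
    exact step h₁ (.recu_in ih h₂ ih' h₃ h₄.1)
  | recu_sub j h₁ _ h₂ h₃ ih =>
    obtain ⟨h, ih⟩ := ih
    exact step h₁ (.recu_sub j ih h₂ (ih.sub h₃.1.sub) h₃)
  | port h₁ h₂ h₃ _ h₄ _ h₅ ih ih' =>
    obtain ⟨h, ih, ih'⟩ := pair ih ih'
    exact step h₁ (.port h₂ h₃ ih h₄ ih' h₅)

end HRec

namespace HRec

variable {F : Family}

open CTree

/-! ### Sizes, depths and decompositions of free algebra terms -/

theorem exists_ar_le (F : Family) : ∃ B, ∀ (a : F.Alg) (c : F.Cons a), F.ar c ≤ B :=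
  ⟨Finset.univ.sup fun a => Finset.univ.sup fun c : F.Cons a => F.ar c, fun a c =>
    (Finset.le_sup (f := fun c : F.Cons a => F.ar c) (Finset.mem_univ c)).trans
      (Finset.le_sup (f := fun a => Finset.univ.sup fun c : F.Cons a => F.ar c)
        (Finset.mem_univ a))⟩

namespace ETerm

variable {a : F.Alg}

theorem size_mk_le {B K : ℕ} {c : F.Cons a} {ts : Fin (F.ar c) → ETerm F a} (hB : F.ar c ≤ B)
    (hK : ∀ j, (ts j).size ≤ K) : (ETerm.mk c ts).size ≤ B * K + 1 := by
  have h := Finset.sum_le_card_nsmul Finset.univ (fun j => (ts j).size) K fun j _ => hK j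
  rw [Finset.card_univ, Fintype.card_fin, smul_eq_mul] at h
  have := Nat.mul_le_mul_right K hB
  simp only [size]
  omega

/-- The depth of a free algebra term. -/
def depth : ETerm F a → ℕ
  | .mk _ args => (Finset.univ.sup fun i => (args i).depth) + 1

theorem size_le_pow_depth {B : ℕ} (hB : ∀ (a : F.Alg) (c : F.Cons a), F.ar c ≤ B) (t : ETerm F a) :
    t.size ≤ (B + 1) ^ t.depth := by
  induction t with
  | mk c ts ih =>
    have hK : ∀ j, (ts j).size ≤ (B + 1) ^ (Finset.univ.sup fun i => (ts i).depth) := fun j =>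
      (ih j).trans (Nat.pow_le_pow_right (Nat.succ_pos _)
        (Finset.le_sup (f := fun i => (ts i).depth) (Finset.mem_univ j)))
    refine (size_mk_le (hB a c) hK).trans ?_
    rw [depth, pow_succ]
    have := Nat.one_le_pow (Finset.univ.sup fun i => (ts i).depth) (B + 1) (Nat.succ_pos _)
    nlinarith

/-- A decomposition of `t` amounts to the choice of the constructor at which the subterm is rooted.
-/
theorem cardLe_plug_eq (t : ETerm F a) :
    CardLe {p : ECtx F a × ETerm F a | p.1.plug p.2 = t} t.size := by
  induction t with
  | mk c ts ih =>
    have h : {p : ECtx F a × ETerm F a | p.1.plug p.2 = .mk c ts} ⊆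
        (⋃ i, (fun p => (.mk c i (fun j => ts j.1) p.1, p.2)) ''
          {p : ECtx F a × ETerm F a | p.1.plug p.2 = ts i}) ∪ {(.hole, .mk c ts)} := by
      rintro ⟨u, s⟩ hp
      simp only [Set.mem_ofPred_eq] at hp
      cases u with
      | hole => exact Or.inr (by rw [← hp]; rfl)
      | mk d i rest u =>
        simp only [ECtx.plug, mk.injEq] at hp
        obtain ⟨rfl, hp⟩ := hp
        have hp := eq_of_heq hp
        refine Or.inl (Set.mem_iUnion.2 ⟨i, (u, s), ?_, ?_⟩)
        · simpa using congrFun hp i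
        · have : rest = fun j => ts j.1 := funext fun j => by
            simpa [j.2] using congrFun hp j.1
          rw [this]
    exact ((CardLe.iUnion fun i => (ih i).image _).union
      (CardLe.of_subset_singleton fun y hy => hy)).mono h le_rfl

end ETerm

variable {Γ : Ctx F} {G : IGraph Γ} {m d h h' l : ℕ} {lev : G.Edge → ℕ}
  {T S : CTree F G.Vert G.Edge}

theorem CTree.wellFounded_isChild {V E : Type} :
    WellFounded (IsChild : CTree F V E → CTree F V E → Prop) := by
  refine ⟨fun T => ?_⟩
  induction T with
  | node l n f ih =>
    refine ⟨_, fun S hS => ?_⟩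
    obtain ⟨j, rfl⟩ := hS
    exact ih j

theorem CTree.Sub.not_isChild {V E : Type} {S T : CTree F V E} (hT : T.Sub S) : ¬ S.IsChild T :=
  fun hS => wellFounded_isChild.transGen.irrefl.irrefl T (Relation.TransGen.tail' hT hS)

/-- Only constructors change the term, and they combine at most `B` terms. -/
theorem Rule.size_le {X : CTree F G.Vert G.Edge → Prop} {v : G.Vert} {n : Node F G.Edge} {B K : ℕ}
    (hB : ∀ (a : F.Alg) (c : F.Cons a), F.ar c ≤ B) (hB' : 0 < B)
    (hK : ∀ S, X S → S.val.2.size ≤ K) (hT : Rule G X v n T) : T.val.2.size ≤ B * K + 1 := by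
  have hBK : K ≤ B * K + 1 := by nlinarith
  cases hT
  case con_zero h₁ h₂ =>
    exact ETerm.size_mk_le (hB _ _) fun j => (Fin.cast h₁ j).elim0
  case con_zero_box h₁ _ _ _ _ =>
    exact ETerm.size_mk_le (hB _ _) fun j => (Fin.cast h₁ j).elim0
  case con_succ h₁ h₂ h₃ =>
    refine ETerm.size_mk_le (hB _ _) fun j => ?_
    have := hK _ (h₂ j)
    rw [val, h₃ j] at this
    exact this
  all_goals
    have h₀ := hK _ ‹X _›
    exact h₀.trans hBK

/-! ### Stacks -/

/-- The stacks at edges inside `l` boxes that arise in at most `h` rounds. -/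
def Stk (G : IGraph Γ) (h : ℕ) : ℕ → Set (List (StackElt F G.Vert))
  | 0 => {[]}
  | l + 1 => {U | ∃ (v : G.Vert) (a : F.Alg) (e₀ : G.Edge) (es : F.Cons a → G.Edge) (g : G.Edge)
      (u : ECtx F a) (s : ETerm F a) (U' : List (StackElt F G.Vert)) (T : CTree F G.Vert G.Edge),
      G.node v = .recu a e₀ es g ∧ U' ∈ Stk G h l ∧ Stage G h T ∧
      T.root = ⟨⟨a, u.plug s⟩, e₀, U', .hole⟩ ∧ U = ⟨a, u, s, v⟩ :: U'}

theorem Stk.mono (hh : h ≤ h') (l : ℕ) : Stk G h l ⊆ Stk G h' l := by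
  induction l with
  | zero => exact subset_rfl
  | succ l ih =>
    rintro U ⟨v, a, e₀, es, g, u, s, U', T, h₁, h₂, h₃, h₄, h₅⟩
    exact ⟨v, a, e₀, es, g, u, s, U', T, h₁, ih h₂, h₃.mono hh, h₄, h₅⟩

/-- Every rule keeps the stack in step with the box level of the edge. Elements are pushed only for
decompositions of a recursion argument that has already been generated. -/
theorem Stage.stack_mem (hG : Good G m d lev) (hT : Stage G h T) :
    T.root.stack ∈ Stk G h (lev T.root.edge) := by
  induction h generalizing T with
  | zero => exact hT.elim
  | succ h ih =>
    obtain ⟨v, hv⟩ := hT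
    have ih : ∀ {T e U L}, Stage G h T → T.At e U L → U ∈ Stk G (h + 1) (lev e) := by
      rintro T e U L hT ⟨rfl, rfl, rfl⟩
      exact Stk.mono h.le_succ _ (ih hT)
    have ihr : ∀ {T x e U L}, Stage G h T → T.root = ⟨x, e, U, L⟩ → U ∈ Stk G (h + 1) (lev e) := by
      intro T x e U L hT hr
      exact ih hT ⟨by rw [hr], by rw [hr], by rw [hr]⟩
    have hlev := hG.levelOK v
    have hrec : ∀ {w a e₀ es g T U u s}, G.node w = .recu a e₀ es g → Stage G h T →
        T.root = ⟨⟨a, u.plug s⟩, e₀, U, .hole⟩ → ⟨a, u, s, w⟩ :: U ∈ Stk G (h + 1) (lev e₀ + 1) :=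
      fun {w a e₀ es g T U u s} h₁ h₂ h₃ =>
        ⟨w, a, e₀, es, g, u, s, U, T, h₁, ihr h₂ h₃, h₂.succ, h₃, rfl⟩
    generalize hn : G.node v = n at hv hlev
    cases hv <;> simp only [root_ext, root_node, Node.LevelOK] at hlev ⊢
    case con_zero h₁ => rw [hG.box_none _ h₁]; exact rfl
    case con_zero_box h₁ h₂ h₃ h₄ h₅ => rw [hG.box_some _ _ _ _ _ _ h₂ h₃]; exact hrec h₃ h₄ h₅
    case con_succ h₁ h₂ h₃ => exact ihr (h₂ ⟨0, h₁⟩) (h₃ ⟨0, h₁⟩)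
    case port h₁ h₂ h₃ h₄ h₅ h₆ => rw [hG.box_some _ _ _ _ _ _ h₁ h₂]; exact hrec h₂ h₃ h₄
    case cond_pos h₁ h₂ h₃ h₄ h₅ => rw [← hlev.1]; exact ihr h₁ h₂
    case cond_neg h₁ h₂ h₃ h₄ h₅ => rw [hlev.2, ← hlev.1]; exact ihr h₁ h₂
    case cond_sub j h₁ h₂ h₃ h₄ => rw [hlev.2, ← hlev.1]; exact ihr h₁ h₂
    case recu_up h₁ h₂ h₃ h₄ h₅ h₆ => rw [hlev.2, ← hlev.1]; exact hrec hn h₁ h₂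
    case recu_down h₁ h₂ h₃ h₄ h₅ h₆ =>
      rw [hlev.2, ← hlev.1]
      refine hrec hn h₁ ?_
      -- The context and subterm for the child copy decompose the same whole argument.
      rw [ECtx.plug_comp, ECtx.plug_frame]
      exact h₂
    case recu_out h₁ h₂ h₃ h₄ h₅ => rw [← hlev.1]; exact ihr h₁ h₂
    case recu_in h₁ h₂ h₃ h₄ h₅ => rw [hlev.2, ← hlev.1]; exact hrec (u := .hole) hn h₁ h₂
    case recu_sub h₁ h₂ h₃ h₄ => rw [hlev.2, ← hlev.1]; exact hrec hn h₁ h₂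
    all_goals
      have h₀ := ih ‹Stage G h _› ‹_›
      first | exact h₀ | (simp only [hlev.1, hlev.2] at h₀ ⊢; exact h₀)

/-! ### Depths of the terms in a stage -/

/-- The occurrences of constructors in a tree, each consisting of a vertex and a stack. -/
def conPos (G : IGraph Γ) (T : CTree F G.Vert G.Edge) : Set (G.Vert × List (StackElt F G.Vert)) :=
  {p | ∃ (S : CTree F G.Vert G.Edge) (a : F.Alg) (c : F.Cons a) (n : ℕ) (e : G.Edge), S.Sub T ∧ G.node p.1 = .con a c n e ∧
    S.At e p.2 (.rights (.base a n) (F.ar c) .hole)}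

theorem conPos_subset (hS : S.IsChild T) : conPos G S ⊆ conPos G T := by
  rintro p ⟨R, a, c, n, e, h₁, h₂, h₃⟩
  exact ⟨R, a, c, n, e, h₁.tail hS, h₂, h₃⟩

/-- The depth of the term grows only at constructors, and there a pair of vertex and stack is met
that does not occur in any child; otherwise, by determinacy, the tree would be a proper subtree of
itself. -/
theorem Stage.depth_le (hG : Good G m d lev) (hT : Stage G h T) (hf : (conPos G T).Finite) :
    T.val.2.depth ≤ (conPos G T).ncard := by
  induction h generalizing T with
  | zero => exact hT.elim
  | succ h ih =>
    have hT' := hT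
    obtain ⟨v, hv⟩ := hT
    have hext : ∀ {T e U L}, Stage G h T → (conPos G (T.ext e U L)).Finite →
        (T.ext e U L).val.2.depth ≤ (conPos G (T.ext e U L)).ncard := fun {T e U L} hT hf => by
      have hs := conPos_subset (G := G) (S := T) (T := T.ext e U L) ⟨0, rfl⟩
      exact (ih hT (hf.subset hs)).trans (Set.ncard_le_ncard hs hf)
    generalize hn : G.node v = n at hv
    cases hv
    case con_zero a n' e c ts f h₁ h₂ =>
      have : (v, []) ∈ conPos G (.node ⟨⟨a, .mk c ts⟩, e, [], .hole⟩ 0 f) :=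
        ⟨_, a, c, n', e, .refl, hn, rfl, rfl, by rw [h₁]; rfl⟩
      refine le_trans ?_ (Nat.succ_le_of_lt ((Set.ncard_pos hf).2 ⟨_, this⟩))
      have : (Finset.univ.sup fun i => (ts i).depth) = 0 :=
        Nat.le_zero.1 (Finset.sup_le fun j _ => (Fin.cast h₁ j).elim0)
      simp only [val, root_node, ETerm.depth, this]
      exact le_rfl
    case con_zero_box a n' e c ts f w b e₀ es g T U u t h₁ h₂ h₃ h₄ h₅ =>
      have : (v, ⟨b, u, t, w⟩ :: U) ∈
          conPos G (.node ⟨⟨a, .mk c ts⟩, e, ⟨b, u, t, w⟩ :: U, .hole⟩ 0 f) :=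
        ⟨_, a, c, n', e, .refl, hn, rfl, rfl, by rw [h₁]; rfl⟩
      refine le_trans ?_ (Nat.succ_le_of_lt ((Set.ncard_pos hf).2 ⟨_, this⟩))
      have : (Finset.univ.sup fun i => (ts i).depth) = 0 :=
        Nat.le_zero.1 (Finset.sup_le fun j _ => (Fin.cast h₁ j).elim0)
      simp only [val, root_node, ETerm.depth, this]
      exact le_rfl
    case con_succ a n' e U c ts f h₁ h₂ h₃ =>
      have hmem : (v, U) ∈ conPos G (.node ⟨⟨a, .mk c ts⟩, e, U,
          .rights (.base a n') (F.ar c) .hole⟩ (F.ar c) f) :=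
        ⟨_, a, c, n', e, .refl, hn, rfl, rfl, rfl⟩
      refine Nat.succ_le_of_lt ((Finset.sup_lt_iff ((Set.ncard_pos hf).2 ⟨_, hmem⟩)).2 fun j _ => ?_)
      have hs : conPos G (f j) ⊆ _ := conPos_subset (T := .node ⟨⟨a, .mk c ts⟩, e, U,
          .rights (.base a n') (F.ar c) .hole⟩ (F.ar c) f) ⟨j, rfl⟩
      have hd := ih (h₂ j) (hf.subset hs)
      rw [val, h₃ j] at hd
      refine lt_of_le_of_lt hd (Set.ncard_lt_ncard ⟨hs, fun hs' => ?_⟩ hf)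
      obtain ⟨S, b, c', k, e', h₄, h₅, h₆⟩ := hs' hmem
      obtain ⟨rfl, h₇⟩ := Node.con.inj (h₅.symm.trans hn)
      obtain ⟨hc, rfl, rfl⟩ := h₇
      obtain rfl := eq_of_heq hc
      have hS := ((h₂ j).sub h₄).unique hG hT' (h₆.samePos ⟨rfl, rfl, rfl⟩)
      rw [hS] at h₄
      exact h₄.not_isChild ⟨j, rfl⟩
    all_goals exact hext ‹_› hf

end HRec

namespace HRec

variable {F : Family}

open CTree

variable {Γ : Ctx F} {G : IGraph Γ} {m d h h' l N : ℕ} {lev : G.Edge → ℕ}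
  {T S : CTree F G.Vert G.Edge}

theorem conPos_subset_prod (hG : Good G m d lev) (hT : Stage G h T) :
    conPos G T ⊆ {v | (G.node v).Counted} ×ˢ ⋃ i : Fin (d + 1), Stk G h i := by
  rintro ⟨v, U⟩ ⟨S, a, c, n, e, h₁, h₂, h₃⟩
  refine ⟨?_, Set.mem_iUnion.2 ⟨⟨lev e, Nat.lt_succ_of_le (hG.lev_le e)⟩, ?_⟩⟩
  · simp only [Set.mem_ofPred_eq, h₂, Node.Counted]
  · have := (hT.sub h₁).stack_mem hG
    rwa [h₃.1, h₃.2.1] at this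

/-- A bound for the sizes of terms in terms of the numbers of constructors and of stacks. -/
theorem Stage.size_le_of_stk {B : ℕ} (hB : ∀ (a : F.Alg) (c : F.Cons a), F.ar c ≤ B)
    (hG : Good G m d lev) (hm : m ≤ N) (hN : ∀ i ≤ d, CardLe (Stk G h i) N) (hT : Stage G h T) :
    T.val.2.size ≤ (B + 1) ^ (N * ((d + 1) * N)) := by
  have hc : CardLe (conPos G T) (N * ((d + 1) * N)) := by
    have := hG.counted.prod (CardLe.iUnion fun i : Fin (d + 1) => hN i (Nat.lt_succ_iff.1 i.2))
    refine this.mono (conPos_subset_prod hG hT) ?_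
    rw [Finset.sum_const, Finset.card_univ, Fintype.card_fin, smul_eq_mul]
    exact Nat.mul_le_mul_right _ hm
  exact (ETerm.size_le_pow_depth hB _).trans (Nat.pow_le_pow_right (Nat.succ_pos _)
    ((hT.depth_le hG hc.finite).trans hc.ncard_le))

/-- The instances of recursions inside `l` boxes whose argument has been generated. -/
def Inst (G : IGraph Γ) (h l : ℕ) : Set (G.Vert × List (StackElt F G.Vert)) :=
  {p | ∃ (a : F.Alg) (e₀ : G.Edge) (es : F.Cons a → G.Edge) (g : G.Edge)
      (T : CTree F G.Vert G.Edge) (t : ETerm F a), G.node p.1 = .recu a e₀ es g ∧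
      p.2 ∈ Stk G h l ∧ Stage G h T ∧ T.root = ⟨⟨a, t⟩, e₀, p.2, .hole⟩}

theorem Inst.mono (hh : h ≤ h') (l : ℕ) : Inst G h l ⊆ Inst G h' l := by
  rintro p ⟨a, e₀, es, g, T, t, h₁, h₂, h₃, h₄⟩
  exact ⟨a, e₀, es, g, T, t, h₁, Stk.mono hh l h₂, h₃.mono hh, h₄⟩

/-- A recursion whose argument has a value is over a nonempty algebra, so its vertex is among the
counted ones. -/
theorem Inst.cardLe (hG : Good G m d lev) (hm : m ≤ N) (hN : CardLe (Stk G h l) N) :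
    CardLe (Inst G h l) (N * N) := by
  refine (hG.counted.prod hN).mono ?_ (Nat.mul_le_mul_right _ hm)
  rintro ⟨v, U⟩ ⟨a, e₀, es, g, T, t, h₁, h₂, h₃, h₄⟩
  refine ⟨?_, h₂⟩
  obtain ⟨c, -⟩ := t
  simp only [Set.mem_ofPred_eq, h₁, Node.Counted]
  exact c.pos

/-- By determinacy an instance has a single argument term. The stacks over the instance correspond
to decompositions of that term, of which there are at most `x`. -/
theorem Stk.cardLe_succ {x k : ℕ} (hG : Good G m d lev) (hk : CardLe (Inst G h l) k)
    (hx : ∀ (v : G.Vert) (a : F.Alg) (e₀ : G.Edge) (es : F.Cons a → G.Edge) (g : G.Edge)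
      (T : CTree F G.Vert G.Edge) (t : ETerm F a) (U : List (StackElt F G.Vert)),
      G.node v = .recu a e₀ es g → U ∈ Stk G h l → Stage G h T →
      T.root = ⟨⟨a, t⟩, e₀, U, .hole⟩ → t.size ≤ x) : CardLe (Stk G h (l + 1)) (k * x) := by
  have := hk.biUnion (m := x) (f := fun p => {U | U ∈ Stk G h (l + 1) ∧ U.tail = p.2 ∧
    ∃ q ∈ U.head?, StackElt.vert q = p.1}) ?_
  · refine this.mono ?_ le_rfl
    intro U hU
    have hU' := hU
    obtain ⟨v, a, e₀, es, g, u, s, U', T, h₁, h₂, h₃, h₄, rfl⟩ := hU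
    simp only [Set.mem_iUnion]
    exact ⟨(v, U'), ⟨a, e₀, es, g, T, _, h₁, h₂, h₃, h₄⟩, hU', rfl, _, rfl, rfl⟩
  · rintro ⟨v, U⟩ ⟨a, e₀, es, g, T, t, h₁, h₂, h₃, h₄⟩
    refine ((ETerm.cardLe_plug_eq t).image fun p => (⟨a, p.1, p.2, v⟩ :: U :
      List (StackElt F G.Vert))).mono ?_ (hx v a e₀ es g T t U h₁ h₂ h₃ h₄)
    rintro _ ⟨⟨v', a', e₀', es', g', u, s, U', T', h₁', h₂', h₃', h₄', rfl⟩, h₅, q, h₆, h₇⟩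
    simp only [List.head?_cons, Option.mem_def, Option.some.injEq] at h₆
    subst h₆
    simp only [List.tail_cons] at h₅ h₇
    subst h₅ h₇
    obtain ⟨rfl, h₈⟩ := Node.recu.inj (h₁.symm.trans h₁')
    obtain ⟨rfl, -⟩ := h₈
    obtain rfl := h₃.unique hG h₃' (samePos_of_root h₄ h₄')
    have := (Label.mk.inj (h₄.symm.trans h₄')).1
    simp only [Sigma.mk.injEq, heq_eq_eq, true_and] at this
    exact ⟨(u, s), this.symm, rfl⟩

/-- If the sizes of the terms generated in `h'` rounds can be bounded in terms of the sizes of the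
arguments of the recursions inside `l` boxes, then there is an absolute bound for these sizes. -/
theorem Inst.size_le (hG : Good G m d lev) {z : ℕ → ℕ} (hz : Monotone z)
    (hf : (Inst G h l).Finite)
    (hb : ∀ h' ≤ h, ∀ x, CardLe (Stk G h' (l + 1)) ((Inst G h l).ncard * x) →
      ∀ T, Stage G (h' + 1) T → T.val.2.size ≤ z x) :
    ∀ h' ≤ h, ∀ (v : G.Vert) (a : F.Alg) (e₀ : G.Edge) (es : F.Cons a → G.Edge) (g : G.Edge)
      (T : CTree F G.Vert G.Edge) (t : ETerm F a) (U : List (StackElt F G.Vert)),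
      G.node v = .recu a e₀ es g → U ∈ Stk G h' l → Stage G h' T →
      T.root = ⟨⟨a, t⟩, e₀, U, .hole⟩ → t.size ≤ z^[(Inst G h' l).ncard] 0 := by
  intro h'
  induction h' with
  | zero => exact fun _ _ _ _ _ _ _ _ _ _ _ h => h.elim
  | succ h' ih =>
    intro hh v a e₀ es g T t U h₁ h₂ h₃ h₄
    have ih := ih (by omega)
    have hfin : ∀ {i}, i ≤ h → (Inst G i l).Finite := fun hi => hf.subset (Inst.mono hi l)
    have hmono : Monotone fun n => z^[n] 0 := hz.monotone_iterate_of_le_map (Nat.zero_le _)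
    -- If the round produces no new instance, the argument was already present one round earlier, by
    -- determinacy, and so was its bound.
    by_cases hsub : Inst G (h' + 1) l ⊆ Inst G h' l
    · rw [(hsub.antisymm (Inst.mono h'.le_succ l))]
      obtain ⟨a', e₀', es', g', T', t', h₁', h₂', h₃', h₄'⟩ :=
        hsub (a := (v, U)) ⟨a, e₀, es, g, T, t, h₁, h₂, h₃, h₄⟩
      obtain ⟨rfl, h₈⟩ := Node.recu.inj (h₁.symm.trans h₁')
      obtain ⟨rfl, -⟩ := h₈
      obtain rfl := h₃.unique hG h₃' (samePos_of_root h₄ h₄')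
      exact ih v a e₀ es g T t U h₁ h₂' h₃' h₄
    -- A round with new instances is charged to the growth of their number: the old arguments bound
    -- the stacks of level l+1, hence the new arguments, at the price of one more application of
    -- `z`.
    · have hlt : (Inst G h' l).ncard < (Inst G (h' + 1) l).ncard :=
        Set.ncard_lt_ncard ⟨Inst.mono h'.le_succ l, hsub⟩ (hfin hh)
      have hc : CardLe (Inst G h' l) (Inst G h l).ncard :=
        ⟨hf.toFinset, fun p hp => by simpa using Inst.mono (by omega) l hp,
          by rw [Set.ncard_eq_toFinset_card _ hf]⟩
      have := hb h' (by omega) _ (Stk.cardLe_succ hG hc ih) T h₃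
      rw [val, h₄] at this
      refine this.trans ?_
      rw [← Function.iterate_succ_apply' z]
      exact hmono hlt

/-- The sizes of the terms generated for a derivation whose edges lie inside at most `d` boxes. -/
theorem exists_primrec_size_le (F : Family) (d r : ℕ) (hr : r ≤ d) :
    ∃ p : ℕ → ℕ, Primrec p ∧ Monotone p ∧ ∀ (Γ : Ctx F) (G : IGraph Γ) (m N h : ℕ)
      (lev : G.Edge → ℕ), Good G m d lev → m ≤ N → (∀ i ≤ d - r, CardLe (Stk G h i) N) →
      ∀ T, Stage G h T → T.val.2.size ≤ p N := by
  obtain ⟨B, hB⟩ := exists_ar_le F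
  -- `r` is the number of levels for which no bound on the number of stacks is given yet.
  induction r with
  | zero =>
    refine ⟨fun N => (B + 1) ^ (N * ((d + 1) * N)), ?_, ?_, fun Γ G m N h lev hG hm hN T hT =>
      hT.size_le_of_stk hB hG hm hN⟩
    · have hpow : Primrec fun n => (B + 1) ^ n := by
        have : Primrec fun n : ℕ => (fun x => (B + 1) * x)^[n] 1 :=
          Primrec.nat_iterate Primrec.id (Primrec.const 1)
            (Primrec.nat_mul.comp₂ (Primrec₂.const (B + 1)) Primrec₂.right)
        refine this.of_eq fun n => ?_
        induction n with
        | zero => rfl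
        | succ n ih => rw [Function.iterate_succ_apply', ih, pow_succ']
      exact hpow.comp (Primrec.nat_mul.comp Primrec.id
        (Primrec.nat_mul.comp (Primrec.const _) Primrec.id))
    · exact fun a b hab => Nat.pow_le_pow_right (Nat.succ_pos _) (by gcongr)
  | succ r ih =>
    obtain ⟨p, hp, hpm, hpb⟩ := ih (by omega)
    -- If the arguments inside `l` boxes have size at most `x`, there are at most `N * N * x` stacks
    -- of level `l + 1`, as there are at most `N * N` instances. So `N + N * N * x` bounds all
    -- levels up to `l + 1` and `p` applies. The outer factor and summand account for one more
    -- round; `B + 1` is used to have a positive bound for arities.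
    let z : ℕ → ℕ → ℕ := fun N x => (B + 1) * p (N + N * N * x) + 1
    have hz : ∀ N, Monotone (z N) := fun N a b hab => by
      have : p (N + N * N * a) ≤ p (N + N * N * b) := hpm (by gcongr)
      simp only [z]
      gcongr
    have hzN : ∀ {N N'} x, N ≤ N' → z N x ≤ z N' x := fun {N N'} x hN => by
      have : p (N + N * N * x) ≤ p (N' + N' * N' * x) := hpm (by gcongr)
      simp only [z]
      gcongr
    have hzi : ∀ {N N' k k' : ℕ}, N ≤ N' → k ≤ k' → (z N)^[k] 0 ≤ (z N')^[k'] 0 :=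
      fun {N N' k k'} hN hk => by
        refine le_trans ?_ ((hz N').monotone_iterate_of_le_map (Nat.zero_le _) hk)
        exact (hz N).iterate_le_of_le (fun x => hzN x hN) k 0
    -- The number of instances bounds the number of iterations of `z`, which start at 0 because no
    -- term exists before the first round.
    refine ⟨fun N => p (N + N * N * (z N)^[N * N] 0), ?_, ?_,
      fun Γ G m N h lev hG hm hN T hT => ?_⟩
    · have hNN : Primrec fun N : ℕ => N * N := Primrec.nat_mul.comp Primrec.id Primrec.id
      have hz' : Primrec₂ z := Primrec.nat_add.comp (Primrec.nat_mul.comp (Primrec.const _)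
        (hp.comp (Primrec.nat_add.comp Primrec.fst (Primrec.nat_mul.comp
          (hNN.comp Primrec.fst) Primrec.snd)))) (Primrec.const 1)
      exact hp.comp (Primrec.nat_add.comp Primrec.id (Primrec.nat_mul.comp hNN
        (Primrec.nat_iterate hNN (Primrec.const 0) hz')))
    · intro a b hab
      have h₁ := hzi hab (Nat.mul_le_mul hab hab)
      exact hpm (by gcongr)
    · have hl : d - r = d - (r + 1) + 1 := by omega
      set l := d - (r + 1) with hld
      have hI := Inst.cardLe hG hm (hN l le_rfl)
      have hst : ∀ {h' x : ℕ}, h' ≤ h → CardLe (Stk G h' (l + 1)) (N * N * x) →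
          ∀ i ≤ d - r, CardLe (Stk G h' i) (N + N * N * x) := fun {h' x} hh hc i hi => by
        rcases Nat.lt_or_ge l i with hil | hil
        · obtain rfl : i = l + 1 := by omega
          exact hc.mono subset_rfl (by omega)
        · exact (hN i hil).mono (Stk.mono hh i) (by omega)
      have hle : ∀ {c x : ℕ}, c ≤ N * N → c * x ≤ N * N * x := fun hc => Nat.mul_le_mul_right _ hc
      have key := Inst.size_le (G := G) (h := h) (l := l) hG (hz N) hI.finite
        fun h' hh x hx T hT => by
          obtain ⟨v, hv⟩ := hT
          have hK := hpb Γ G m _ h' lev hG (hm.trans (Nat.le_add_right _ _))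
            (hst hh (hx.mono subset_rfl (hle hI.ncard_le)))
          exact hv.size_le (fun a c => (hB a c).trans B.le_succ) (Nat.succ_pos _) hK
      have hc := Stk.cardLe_succ hG hI fun v a e₀ es g T t U h₁ h₂ h₃ h₄ =>
        (key h le_rfl v a e₀ es g T t U h₁ h₂ h₃ h₄).trans
          (hzi le_rfl hI.ncard_le)
      exact hpb Γ G m _ h lev hG (hm.trans (Nat.le_add_right _ _)) (hst le_rfl hc) T hT

/-- All `d` levels above 0 are open at the start. At level 0 the only stack is the empty one, which
the size of the term bounds, being positive. -/
theorem exists_primrec_inT_size (F : Family) (d : ℕ) : ∃ p : ℕ → ℕ, Nat.Primrec p ∧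
    ∀ (Γ : Ctx F) (M : Tm F) (A : Ty F) (π : Der (baseTypes F) Γ M A), π.depth = d →
      ∀ T : CTree F π.graph.Vert π.graph.Edge, InT π.graph T → T.val.2.size ≤ p M.size := by
  obtain ⟨p, hp, -, hb⟩ := exists_primrec_size_le F d d le_rfl
  refine ⟨p, Primrec.nat_iff.1 hp, fun Γ M A π hd T hT => ?_⟩
  obtain ⟨lev, hG⟩ := π.exists_good
  obtain ⟨h, hT⟩ := hT.exists_stage
  refine hb Γ π.graph M.size M.size h lev (hd ▸ hG) le_rfl (fun i hi => ?_) T hT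
  obtain rfl : i = 0 := by omega
  exact (CardLe.of_subset_singleton fun y hy => hy).mono subset_rfl M.size_pos

end HRec

/-! ### Representable functions: confluence, an environment machine on codes, its running time. -/

namespace HRec

variable {F : Family}

/-! ### Uniqueness of normal forms -/

theorem Tm.apps_con_inj {a a' : F.Alg} {c : F.Cons a} {c' : F.Cons a'} {Ns Ns' : List (Tm F)}
    (h : Tm.apps (.con a c) Ns = Tm.apps (.con a' c') Ns') :
    (⟨a, c⟩ : Σ a : F.Alg, F.Cons a) = ⟨a', c'⟩ ∧ Ns = Ns' := by
  induction Ns using List.reverseRecOn generalizing Ns' with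
  | nil =>
    rcases List.eq_nil_or_concat Ns' with rfl | ⟨Ns', N', rfl⟩
    · rw [apps_nil, apps_nil, con.injEq] at h
      exact ⟨Sigma.ext h.1 h.2, rfl⟩
    · rw [List.concat_eq_append, apps_concat] at h
      cases h
  | append_singleton Ns N ih =>
    rcases List.eq_nil_or_concat Ns' with rfl | ⟨Ns', N', rfl⟩
    · rw [apps_concat] at h
      cases h
    · rw [List.concat_eq_append, apps_concat, apps_concat, app.injEq] at h
      obtain ⟨h₁, rfl⟩ := ih h.1
      exact ⟨h₁, by rw [h.2, List.concat_eq_append]⟩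

theorem ETerm.toTm_inj {a a' : F.Alg} {t : ETerm F a} {t' : ETerm F a'} (h : t.toTm = t'.toTm) :
    (⟨a, t⟩ : Val F) = ⟨a', t'⟩ := by
  induction t generalizing a' with
  | mk c ts ih =>
    obtain ⟨c', ts'⟩ := t'
    obtain ⟨h₁, h₂⟩ := Tm.apps_con_inj h
    obtain ⟨rfl, hc⟩ := Sigma.mk.inj h₁
    obtain rfl := eq_of_heq hc
    have hts : ts = ts' := funext fun j => by
      have := ih j (congrFun (List.ofFn_injective h₂) j)
      simpa using this
    rw [hts]

theorem Tm.IsValue.not_step {V M : Tm F} (h : V.IsValue) : ¬ Step V M := by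
  cases h with
  | fvar => exact fun h => by cases h
  | lam => exact fun h => by cases h
  | alg h => exact h.not_step

/-- Reduction is weak and by value: values do not reduce, and a redex is never properly inside
another redex at a position where reduction is allowed. So different steps are in disjoint positions
and commute in one step each. -/
theorem Step.diamond {M N L : Tm F} (h : Step M N) (h' : Step M L) :
    N = L ∨ ∃ K, Step N K ∧ Step L K := by
  induction h generalizing L with
  | beta M hV =>
    cases h' with
    | beta => exact Or.inl rfl
    | appL _ h => cases h
    | appR _ h => exact absurd h hV.not_step
  | @cond a c ts N =>
    generalize hX : Tm.cond (ETerm.mk c ts).toTm (F.alg a).numCons N = X at h'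
    cases h' with
    | @cond a' c' ts' N' =>
      obtain ⟨h₁, -, h₂⟩ := Tm.cond.inj hX
      obtain ⟨rfl, h₃⟩ := Sigma.mk.inj (ETerm.toTm_inj h₁)
      obtain ⟨rfl, h₄⟩ := ETerm.mk.inj (eq_of_heq h₃)
      obtain rfl := eq_of_heq h₄
      obtain rfl := eq_of_heq h₂
      exact Or.inl rfl
    | condL n N' h =>
      obtain ⟨rfl, -⟩ := Tm.cond.inj hX
      exact absurd h (Tm.isAlg_toTm _).not_step
    | _ => cases hX
  | @recu a c ts N =>
    generalize hX : Tm.recu (ETerm.mk c ts).toTm (F.alg a).numCons N = X at h'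
    cases h' with
    | @recu a' c' ts' N' =>
      obtain ⟨h₁, -, h₂⟩ := Tm.recu.inj hX
      obtain ⟨rfl, h₃⟩ := Sigma.mk.inj (ETerm.toTm_inj h₁)
      obtain ⟨rfl, h₄⟩ := ETerm.mk.inj (eq_of_heq h₃)
      obtain rfl := eq_of_heq h₄
      obtain rfl := eq_of_heq h₂
      exact Or.inl rfl
    | recuL n N' h =>
      obtain ⟨rfl, -⟩ := Tm.recu.inj hX
      exact absurd h (Tm.isAlg_toTm _).not_step
    | _ => cases hX
  | appL P h ih =>
    cases h' with
    | beta => cases h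
    | appL _ h' =>
      rcases ih h' with rfl | ⟨K, h₁, h₂⟩
      exacts [Or.inl rfl, Or.inr ⟨_, .appL _ h₁, .appL _ h₂⟩]
    | appR _ h' => exact Or.inr ⟨_, .appR _ h', .appL _ h⟩
  | appR P h ih =>
    cases h' with
    | beta _ hV => exact absurd h hV.not_step
    | appL _ h' => exact Or.inr ⟨_, .appL _ h', .appR _ h⟩
    | appR _ h' =>
      rcases ih h' with rfl | ⟨K, h₁, h₂⟩
      exacts [Or.inl rfl, Or.inr ⟨_, .appR _ h₁, .appR _ h₂⟩]
  | @condL M M' n N h ih =>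
    generalize hX : Tm.cond M n N = X at h'
    cases h' with
    | cond c ts N' =>
      obtain ⟨rfl, -⟩ := Tm.cond.inj hX
      exact absurd h (Tm.isAlg_toTm _).not_step
    | condL n N' h' =>
      obtain ⟨rfl, rfl, h₁⟩ := Tm.cond.inj hX
      obtain rfl := eq_of_heq h₁
      rcases ih h' with rfl | ⟨K, h₁, h₂⟩
      exacts [Or.inl rfl, Or.inr ⟨_, .condL _ _ h₁, .condL _ _ h₂⟩]
    | _ => cases hX
  | @recuL M M' n N h ih =>
    generalize hX : Tm.recu M n N = X at h'
    cases h' with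
    | recu c ts N' =>
      obtain ⟨rfl, -⟩ := Tm.recu.inj hX
      exact absurd h (Tm.isAlg_toTm _).not_step
    | recuL n N' h' =>
      obtain ⟨rfl, rfl, h₁⟩ := Tm.recu.inj hX
      obtain rfl := eq_of_heq h₁
      rcases ih h' with rfl | ⟨K, h₁, h₂⟩
      exacts [Or.inl rfl, Or.inr ⟨_, .recuL _ _ h₁, .recuL _ _ h₂⟩]
    | _ => cases hX

theorem Step.eq_of_normal {M N L : Tm F} (hN : Relation.ReflTransGen Step M N)
    (hL : Relation.ReflTransGen Step M L) (hN' : ∀ K, ¬ Step N K) (hL' : ∀ K, ¬ Step L K) :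
    N = L := by
  obtain ⟨K, h₁, h₂⟩ := Relation.church_rosser (fun a b c hb hc => by
    rcases Step.diamond hb hc with rfl | ⟨d, h₁, h₂⟩
    exacts [⟨_, .refl, .refl⟩, ⟨d, .single h₁, .single h₂⟩]) hN hL
  rcases h₁.cases_head with rfl | ⟨_, h, -⟩
  · rcases h₂.cases_head with rfl | ⟨_, h, -⟩
    exacts [rfl, absurd h (hL' _)]
  · exact absurd h (hN' _)

/-! ### Closed values and closed terms -/

/-- A typed constructor term is one constructor applied to complete free algebra terms, with `k`
arguments missing: arguments have base type, so they cannot be partial applications themselves. -/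
theorem HasTy.exists_apps_toTm {φ : ℕ → Option (Ty F)} {Δ : List (Ty F)} {M : Tm F} {A : Ty F}
    (h : HasTy φ Δ M A) (hM : M.IsAlg) :
    ∃ (a : F.Alg) (n : ℕ) (c : F.Cons a) (ts : List (ETerm F a)) (k : ℕ), ts.length + k = F.ar c ∧
      M = Tm.apps (.con a c) (ts.map ETerm.toTm) ∧ A = Ty.lin (.base a n) k (.base a n) := by
  induction hM generalizing A with
  | con a c =>
    cases h with
    | con _ _ n => exact ⟨a, n, c, [], F.ar c, Nat.zero_add _, rfl, rfl⟩
  | @app M N _ _ ihM ihN =>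
    cases h with
    | app h₁ h₂ =>
      obtain ⟨a, n, c, ts, k, hk, rfl, hA⟩ := ihM h₁
      cases k with
      | zero => cases hA
      | succ k =>
        obtain ⟨rfl, rfl⟩ := Ty.arr.inj hA
        obtain ⟨b, n', d, ss, k', hk', rfl, hB⟩ := ihN h₂
        cases k' with
        | succ k' => cases hB
        | zero =>
          obtain ⟨rfl, -⟩ := Ty.base.inj hB
          refine ⟨a, n, c, ts ++ [.mk d fun i => ss.get (Fin.cast hk'.symm i)], k, by simp; omega,
            ?_, rfl⟩
          rw [List.map_append, List.map_singleton, Tm.apps_concat, ETerm.toTm]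
          congr 2
          refine List.ext_get (by simpa using hk') fun i h₁ h₂ => by simp

theorem HasTy.exists_toTm {φ : ℕ → Option (Ty F)} {Δ : List (Ty F)} {M : Tm F} {a : F.Alg} {n : ℕ}
    (h : HasTy φ Δ M (.base a n)) (hM : M.IsAlg) : ∃ t : ETerm F a, M = t.toTm := by
  obtain ⟨b, n', c, ts, k, hk, rfl, hA⟩ := h.exists_apps_toTm hM
  cases k with
  | succ k => cases hA
  | zero =>
    obtain ⟨rfl, -⟩ := Ty.base.inj hA
    refine ⟨.mk c fun i => ts.get (Fin.cast hk.symm i), ?_⟩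
    rw [ETerm.toTm]
    congr 1
    exact List.ext_get (by simpa using hk) fun i h₁ h₂ => by simp

theorem HasTy.exists_base_of_arr {φ : ℕ → Option (Ty F)} {Δ : List (Ty F)} {M : Tm F} {A B : Ty F}
    (h : HasTy φ Δ M (.arr A B)) (hM : M.IsAlg) : ∃ a n, A = .base a n := by
  obtain ⟨a, n, c, ts, k, -, -, hA⟩ := h.exists_apps_toTm hM
  cases k with
  | zero => cases hA
  | succ k => exact ⟨a, n, (Ty.arr.inj hA).1⟩

/-- Types that are inhabited by set-theoretic functions. -/
def Ty.Inh : Ty F → Prop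
  | base a _ => Nonempty (ETerm F a)
  | arr A B => A.Inh → B.Inh

theorem Ty.inh_lin (A B : Ty F) (n : ℕ) : (Ty.lin A n B).Inh ↔ (n = 0 ∨ A.Inh → B.Inh) := by
  induction n with
  | zero => simp [lin]
  | succ n ih =>
    simp only [lin, Inh, ih]
    tauto

/-- Soundness of typing for inhabitation; it shows that a closed term of base type witnesses a
nonempty algebra. The machine needs this because a conditional or recursion without branches does
not add to the size of its argument. -/
theorem HasTy.inh {φ : ℕ → Option (Ty F)} {Δ : List (Ty F)} {M : Tm F} {A : Ty F}
    (h : HasTy φ Δ M A) (hφ : ∀ x, φ x = none) (hΔ : ∀ B ∈ Δ, B.Inh) : A.Inh := by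
  induction h with
  | bvar h => exact hΔ _ (List.mem_of_getElem? h)
  | fvar h => simp [hφ] at h
  | con a c n =>
    rw [Ty.inh_lin]
    rintro (h | h)
    · exact ⟨.mk c fun i => (Fin.cast h i).elim0⟩
    · exact h
  | app _ _ ih₁ ih₂ => exact ih₁ hΔ (ih₂ hΔ)
  | lam _ _ ih => exact fun hA => ih (List.forall_mem_cons.2 ⟨hA, hΔ⟩)
  | cond hn _ _ ih ihs =>
    subst hn
    obtain ⟨⟨c, ts⟩⟩ := ih hΔ
    exact (Ty.inh_lin _ _ _).1 (ihs c hΔ) (Or.inr ⟨.mk c ts⟩)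
  | recu hn _ _ ih ihs =>
    subst hn
    obtain ⟨t⟩ := ih hΔ
    -- A result of type C is obtained by structural recursion; constants are the base case, where no
    -- recursive value is required.
    induction t with
    | mk c ts iht =>
      refine (Ty.inh_lin _ _ _).1 ((Ty.inh_lin _ _ _).1 (ihs c hΔ) (Or.inr ⟨.mk c ts⟩)) ?_
      by_cases h0 : F.ar c = 0
      · exact Or.inl h0
      · exact Or.inr (iht ⟨0, Nat.pos_of_ne_zero h0⟩)

end HRec

namespace HRec

variable {F : Family}

/-! ### Codes and functions on codes -/

/-- The code of a list of codes. -/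
def listCode : List ℕ → ℕ
  | [] => 0
  | n :: l => Nat.pair n (listCode l)

/-- The entry with index `i` of the list with code `n`. -/
def nthCode (i n : ℕ) : ℕ := ((fun m => m.unpair.2)^[i] n).unpair.1

@[simp]
theorem nthCode_zero (m n : ℕ) : nthCode 0 (Nat.pair m n) = m := by simp [nthCode]

@[simp]
theorem nthCode_succ (i m n : ℕ) : nthCode (i + 1) (Nat.pair m n) = nthCode i n := by
  simp [nthCode]

theorem nthCode_listCode {l : List ℕ} {i : ℕ} (h : i < l.length) : nthCode i (listCode l) = l[i] := by
  induction l generalizing i with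
  | nil => exact absurd h (Nat.not_lt_zero i)
  | cons n l ih =>
    cases i with
    | zero => exact nthCode_zero _ _
    | succ i => exact (nthCode_succ _ _ _).trans (ih (Nat.lt_of_succ_lt_succ h))

/-- Expressions for functions on codes that destruct, look up, compare and construct. -/
inductive CodeExpr : Type
  | var : CodeExpr
  | num (n : ℕ) : CodeExpr
  | fst (e : CodeExpr) : CodeExpr
  | snd (e : CodeExpr) : CodeExpr
  | pair (e g : CodeExpr) : CodeExpr
  | nth (e g : CodeExpr) : CodeExpr
  | ite (e : CodeExpr) (n : ℕ) (g h : CodeExpr) : CodeExpr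

namespace CodeExpr

/-- The value of an expression. -/
def eval : CodeExpr → ℕ → ℕ
  | var, x => x
  | num n, _ => n
  | fst e, x => (e.eval x).unpair.1
  | snd e, x => (e.eval x).unpair.2
  | pair e g, x => Nat.pair (e.eval x) (g.eval x)
  | nth e g, x => nthCode (e.eval x) (g.eval x)
  | ite e n g h, x => if e.eval x = n then g.eval x else h.eval x

theorem primrec_eval (e : CodeExpr) : Primrec e.eval := by
  induction e with
  | var => exact Primrec.id
  | num n => exact Primrec.const n
  | fst e ih => exact Primrec.fst.comp (Primrec.unpair.comp ih)
  | snd e ih => exact Primrec.snd.comp (Primrec.unpair.comp ih)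
  | pair e g ih₁ ih₂ => exact Primrec₂.natPair.comp ih₁ ih₂
  | nth e g ih₁ ih₂ =>
    exact Primrec.fst.comp (Primrec.unpair.comp (Primrec.nat_iterate ih₁ ih₂
      ((Primrec.snd.comp Primrec.unpair).comp₂ Primrec₂.right)))
  | ite e n g h ih₁ ih₂ ih₃ => exact Primrec.ite (Primrec.eq.comp ih₁ (Primrec.const n)) ih₂ ih₃

end CodeExpr

namespace Tm

/-- The code of a term. -/
def code : Tm F → ℕ
  | bvar i => Nat.pair 0 i
  | app M N => Nat.pair 1 (Nat.pair M.code N.code)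
  | con _ c => Nat.pair 2 c
  | lam M => Nat.pair 3 M.code
  | cond L _ N => Nat.pair 4 (Nat.pair L.code (listCode (List.ofFn fun i => (N i).code)))
  | recu L _ N => Nat.pair 5 (Nat.pair L.code (listCode (List.ofFn fun i => (N i).code)))
  | fvar x => Nat.pair 6 x

/-- Simultaneous replacement of the indices that point at least `k` binders up. -/
def inst (σ : ℕ → Tm F) : ℕ → Tm F → Tm F
  | k, bvar i => if i < k then bvar i else σ (i - k)
  | _, fvar x => fvar x
  | _, con a c => con a c
  | k, app M N => app (inst σ k M) (inst σ k N)
  | k, lam M => lam (inst σ (k + 1) M)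
  | k, cond L n N => cond (inst σ k L) n (fun i => inst σ k (N i))
  | k, recu L n N => recu (inst σ k L) n (fun i => inst σ k (N i))

theorem openAt_inst {σ : ℕ → Tm F} (hσ : ∀ i V k, openAt V k (σ i) = σ i) (V : Tm F) {j k : ℕ}
    (hjk : j ≤ k) (M : Tm F) : openAt V k (inst σ j M) = inst σ j M := by
  induction M generalizing j k with
  | bvar i =>
    by_cases h : i < j
    · simp only [inst, h, if_true, openAt]
      rw [if_neg (by omega)]
    · simp only [inst, h, if_false, hσ]
  | fvar | con => rfl
  | app M N ihM ihN => simp only [inst, openAt, ihM hjk, ihN hjk]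
  | lam M ih => simp only [inst, openAt, ih (Nat.succ_le_succ hjk)]
  | cond L n N ih ihs => simp only [inst, openAt, ih hjk, ihs _ hjk]
  | recu L n N ih ihs => simp only [inst, openAt, ih hjk, ihs _ hjk]

/-- Contracting a closure equals evaluating its body in the extended environment; this is the beta
step of the machine. -/
theorem openAt_inst_succ {σ : ℕ → Tm F} (hσ : ∀ i V k, openAt V k (σ i) = σ i) (V : Tm F) (k : ℕ)
    (M : Tm F) :
    openAt V k (inst σ (k + 1) M) = inst (fun i => Nat.casesOn i V σ) k M := by
  induction M generalizing k with
  | bvar i =>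
    rcases lt_trichotomy i k with h | rfl | h
    · simp only [inst, h, h.trans k.lt_succ_self, if_true, openAt, h.ne, if_false]
    · simp [inst, openAt]
    · obtain ⟨j, rfl⟩ := Nat.exists_eq_add_of_lt h
      have h₁ : ¬ k + j + 1 < k + 1 := by omega
      have h₂ : ¬ k + j + 1 < k := by omega
      have h₃ : k + j + 1 - (k + 1) = j := by omega
      have h₄ : k + j + 1 - k = j + 1 := by omega
      simp only [inst, h₁, h₂, if_false, h₃, h₄, hσ]
  | fvar | con => rfl
  | app M N ihM ihN => simp only [inst, openAt, ihM, ihN]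
  | lam M ih => simp only [inst, openAt, ih]
  | cond L n N ih ihs => simp only [inst, openAt, ih, ihs]
  | recu L n N ih ihs => simp only [inst, openAt, ih, ihs]

theorem inst_of_hasTy {φ : ℕ → Option (Ty F)} {Δ : List (Ty F)} {M : Tm F} {A : Ty F}
    (h : HasTy φ Δ M A) (σ : ℕ → Tm F) {k : ℕ} (hk : Δ.length ≤ k) : inst σ k M = M := by
  induction h generalizing k with
  | bvar h =>
    have := (List.getElem?_eq_some_iff.1 h).1
    simp only [inst]
    rw [if_pos (by omega)]
  | fvar | con => rfl
  | app _ _ ih₁ ih₂ => simp only [inst, ih₁ hk, ih₂ hk]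
  | lam _ _ ih => simp only [inst, ih (Nat.succ_le_succ hk)]
  | cond _ _ _ ih ihs => simp only [inst, ih hk, ihs _ hk]
  | recu _ _ _ ih ihs => simp only [inst, ih hk, ihs _ hk]

/-- Costs are computed from code before instantiation, whereas the bounds concern the denoted terms.
-/
theorem size_le_size_inst (σ : ℕ → Tm F) (k : ℕ) (M : Tm F) : M.size ≤ (inst σ k M).size := by
  induction M generalizing k with
  | bvar i => exact size_pos _
  | fvar | con => exact le_rfl
  | app M N ihM ihN => exact Nat.add_le_add (ihM k) (ihN k)
  | lam M ih => exact Nat.succ_le_succ (ih _)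
  | cond L n N ih ihs =>
    exact Nat.add_le_add_right (Nat.add_le_add (ih k) (Finset.sum_le_sum fun i _ => ihs i k)) n
  | recu L n N ih ihs =>
    exact Nat.add_le_add_right (Nat.add_le_add (ih k) (Finset.sum_le_sum fun i _ => ihs i k)) n

end Tm

/-! ### An abstract machine -/

/-- Values made of constructors. -/
inductive AVal (F : Family) : Type
  | con (a : F.Alg) (c : F.Cons a) : AVal F
  | app (x y : AVal F) : AVal F

namespace AVal

/-- The term denoted by a value. -/
def toTm : AVal F → Tm F
  | con a c => .con a c
  | app x y => .app x.toTm y.toTm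

theorem isAlg_toTm (x : AVal F) : x.toTm.IsAlg := by
  induction x with
  | con a c => exact .con a c
  | app x y ihx ihy => exact .app ihx ihy

/-- The code of a value. -/
def code : AVal F → ℕ
  | con _ c => Nat.pair 0 c
  | app x y => Nat.pair 1 (Nat.pair x.code y.code)

/-- Replace the head of a value as prescribed by `g` and the arguments as prescribed by `R`. -/
def spine (g : ℕ → Tm F) (R : Tm F → Tm F) : AVal F → Tm F
  | con _ c => g c
  | app x y => .app (x.spine g R) (R y.toTm)

theorem spine_of_toTm_eq (g : ℕ → Tm F) (R : Tm F → Tm F) {x : AVal F} {a : F.Alg} {c : F.Cons a}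
    {Ns : List (Tm F)} (h : x.toTm = Tm.apps (.con a c) Ns) :
    x.spine g R = Tm.apps (g c) (Ns.map R) := by
  induction x generalizing Ns with
  | con b d =>
    obtain ⟨h₁, rfl⟩ := Tm.apps_con_inj (Ns := []) h
    obtain ⟨rfl, hd⟩ := Sigma.mk.inj h₁
    obtain rfl := eq_of_heq hd
    rfl
  | app x y ih =>
    rcases List.eq_nil_or_concat Ns with rfl | ⟨Ns, N, rfl⟩
    · cases h
    · rw [List.concat_eq_append, Tm.apps_concat, toTm, Tm.app.injEq] at h
      rw [List.concat_eq_append, List.map_append, List.map_singleton, Tm.apps_concat, spine,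
        ih h.1, h.2]

/-- The cost of the traversal of a value, where `g` gives the cost for the head. -/
def cost (g : ℕ → ℕ) (r : ℕ) : AVal F → ℕ
  | con _ c => g c
  | app x _ => x.cost g r + r

/-- Each argument on the spine has size at least 1 and pays for `r ≤ 4`. The slack `e` makes room
for the extra unit when one spine is the head of another. -/
theorem cost_le {h : ℕ → ℕ} {g : ℕ → Tm F} {r e : ℕ} (hr : r ≤ 4)
    (hg : ∀ c, h c + e ≤ 4 * (g c).size) (R : Tm F → Tm F) (x : AVal F) :
    x.cost h r + e ≤ 4 * (x.spine g R).size := by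
  induction x with
  | con a c => exact hg c
  | app x y ih =>
    have := (R y.toTm).size_pos
    simp only [cost, spine, Tm.size]
    omega

end AVal

/-- Values and environments of the machine: elements of free algebras, closures, and lists. -/
inductive MVal (F : Family) : Type
  | alg (x : AVal F) : MVal F
  | clo (B : Tm F) (ρ : MVal F) : MVal F
  | nil : MVal F
  | cons (v ρ : MVal F) : MVal F

namespace MVal

/-- The term denoted by a value, and the substitution denoted by an environment. -/
def decode : MVal F → Tm F × (ℕ → Tm F)
  | alg x => (x.toTm, fun _ => .fvar 0)
  | clo B ρ => (.lam (Tm.inst ρ.decode.2 1 B), fun _ => .fvar 0)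
  | nil => (.fvar 0, fun _ => .fvar 0)
  | cons v ρ => (.fvar 0, fun i => Nat.casesOn i v.decode.1 ρ.decode.2)

/-- The term denoted by a value. -/
def toTm (v : MVal F) : Tm F := v.decode.1

/-- The substitution denoted by an environment. -/
def env (v : MVal F) : ℕ → Tm F := v.decode.2

theorem openAt_decode (v : MVal F) : (∀ V k, Tm.openAt V k v.toTm = v.toTm) ∧
    ∀ i V k, Tm.openAt V k (v.env i) = v.env i := by
  induction v with
  | alg x => exact ⟨fun V k => x.isAlg_toTm.openAt_eq V k, fun _ _ _ => rfl⟩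
  | clo B ρ ih =>
    exact ⟨fun V k => congrArg Tm.lam (Tm.openAt_inst ih.2 V (Nat.le_add_left 1 k) B),
      fun _ _ _ => rfl⟩
  | nil => exact ⟨fun _ _ => rfl, fun _ _ _ => rfl⟩
  | cons v ρ ihv ihρ =>
    refine ⟨fun _ _ => rfl, fun i V k => ?_⟩
    cases i with
    | zero => exact ihv.1 V k
    | succ i => exact ihρ.2 i V k

theorem isValue_toTm (v : MVal F) : v.toTm.IsValue := by
  cases v with
  | alg x => exact .alg x.isAlg_toTm
  | clo B ρ => exact .lam _
  | nil => exact .fvar 0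
  | cons v ρ => exact .fvar 0

/-- The code of a value. -/
def code : MVal F → ℕ
  | alg x => Nat.pair 0 x.code
  | clo B ρ => Nat.pair 1 (Nat.pair B.code ρ.code)
  | nil => 0
  | cons v ρ => Nat.pair v.code ρ.code

/-- A lookup that leaves the environment yields the variable 0, which has no type when no free
variable has one. -/
theorem env_cases (ρ : MVal F) (i : ℕ) :
    ρ.env i = .fvar 0 ∨ ∃ v : MVal F, ρ.env i = v.toTm ∧ nthCode i ρ.code = v.code := by
  induction ρ generalizing i with
  | cons v ρ _ ih =>
    cases i with
    | zero => exact Or.inr ⟨v, rfl, nthCode_zero _ _⟩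
    | succ i =>
      rw [code, nthCode_succ]
      exact ih i
  | _ => exact Or.inl rfl

end MVal

/-- The term denoted by the branch for the constructor with index `c`. -/
def branch {n : ℕ} (N : Fin n → Tm F) (ρ : MVal F) (c : ℕ) : Tm F :=
  if h : c < n then Tm.inst ρ.env 0 (N ⟨c, h⟩) else .fvar 0

/-- The cost of the evaluation of the branch for the constructor with index `c`. -/
def branchCost {n : ℕ} (N : Fin n → Tm F) (c : ℕ) : ℕ :=
  if h : c < n then 4 * (N ⟨c, h⟩).size - 1 else 0

theorem branchCost_le {n : ℕ} (N : Fin n → Tm F) (ρ : MVal F) (c : ℕ) :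
    branchCost N c + 1 ≤ 4 * (branch N ρ c).size := by
  unfold branchCost branch
  split_ifs with h
  · have := Tm.size_le_size_inst ρ.env 0 (N ⟨c, h⟩)
    have := (N ⟨c, h⟩).size_pos
    omega
  · simp [Tm.size]

/-- Continuations of the machine. -/
inductive MCont (F : Family) : Type
  | nil : MCont F
  | arg (P : Tm F) (ρ : MVal F) (K : MCont F) : MCont F
  | fn (v : MVal F) (K : MCont F) : MCont F
  | cond (n : ℕ) (N : Fin n → Tm F) (ρ : MVal F) (K : MCont F) : MCont F
  | recu (n : ℕ) (N : Fin n → Tm F) (ρ : MVal F) (K : MCont F) : MCont F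
  | recArg (x : AVal F) (n : ℕ) (N : Fin n → Tm F) (ρ : MVal F) (K : MCont F) : MCont F

namespace MCont

/-- The term obtained by filling the hole of a continuation. -/
def fill : MCont F → Tm F → Tm F
  | nil, t => t
  | arg P ρ K, t => K.fill (.app t (Tm.inst ρ.env 0 P))
  | fn v K, t => K.fill (.app v.toTm t)
  | cond n N ρ K, t => K.fill (.cond t n fun i => Tm.inst ρ.env 0 (N i))
  | recu n N ρ K, t => K.fill (.recu t n fun i => Tm.inst ρ.env 0 (N i))
  | recArg x n N ρ K, t =>
    K.fill (.app t (.recu x.toTm n fun i => Tm.inst ρ.env 0 (N i)))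

theorem fill_step (K : MCont F) {t t' : Tm F} (h : Step t t') : Step (K.fill t) (K.fill t') := by
  induction K generalizing t t' with
  | nil => exact h
  | arg P ρ K ih => exact ih (.appL _ h)
  | fn v K ih => exact ih (.appR _ h)
  | cond n N ρ K ih => exact ih (.condL _ _ h)
  | recu n N ρ K ih => exact ih (.recuL _ _ h)
  | recArg x n N ρ K ih => exact ih (.appL _ h)

theorem exists_hasTy {φ : ℕ → Option (Ty F)} (K : MCont F) {t : Tm F} {A : Ty F}
    (h : HasTy φ [] (K.fill t) A) : ∃ B, HasTy φ [] t B := by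
  induction K generalizing t with
  | nil => exact ⟨A, h⟩
  | arg P ρ K ih => obtain ⟨B, h⟩ := ih h; cases h; exact ⟨_, ‹_›⟩
  | fn v K ih => obtain ⟨B, h⟩ := ih h; cases h; exact ⟨_, ‹_›⟩
  | cond n N ρ K ih => obtain ⟨B, h⟩ := ih h; cases h; exact ⟨_, ‹HasTy φ [] t _›⟩
  | recu n N ρ K ih => obtain ⟨B, h⟩ := ih h; cases h; exact ⟨_, ‹HasTy φ [] t _›⟩
  | recArg x n N ρ K ih => obtain ⟨B, h⟩ := ih h; cases h; exact ⟨_, ‹HasTy φ [] t _›⟩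

/-- The number of machine steps which the frames of a continuation account for. -/
def cost : MCont F → ℕ
  | nil => 0
  | arg P _ K => 4 * P.size - 1 + K.cost
  | fn _ K => 1 + K.cost
  | cond _ _ _ K => K.cost
  | recu _ _ _ K => K.cost
  | recArg _ _ _ _ K => 2 + K.cost

/-- Each frame is charged to the part of the filled term that it contributes. -/
theorem cost_le (K : MCont F) (t : Tm F) : K.cost + 4 * t.size ≤ 4 * (K.fill t).size := by
  induction K generalizing t with
  | nil => simp [cost, fill]
  | arg P ρ K ih =>
    have h₁ := ih (.app t (Tm.inst ρ.env 0 P))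
    have h₂ := Tm.size_le_size_inst ρ.env 0 P
    simp only [cost, fill, Tm.size] at h₁ ⊢
    omega
  | fn v K ih =>
    have h₁ := ih (.app v.toTm t)
    have h₂ := v.toTm.size_pos
    simp only [cost, fill, Tm.size] at h₁ ⊢
    omega
  | cond n N ρ K ih =>
    have h₁ := ih (.cond t n fun i => Tm.inst ρ.env 0 (N i))
    simp only [cost, fill, Tm.size] at h₁ ⊢
    omega
  | recu n N ρ K ih =>
    have h₁ := ih (.recu t n fun i => Tm.inst ρ.env 0 (N i))
    simp only [cost, fill, Tm.size] at h₁ ⊢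
    omega
  | recArg x n N ρ K ih =>
    have h₁ := ih (.app t (.recu x.toTm n fun i => Tm.inst ρ.env 0 (N i)))
    have h₂ := x.toTm.size_pos
    simp only [cost, fill, Tm.size] at h₁ ⊢
    omega

/-- The code of a continuation. -/
def code : MCont F → ℕ
  | nil => Nat.pair 0 0
  | arg P ρ K => Nat.pair 1 (Nat.pair P.code (Nat.pair ρ.code K.code))
  | fn v K => Nat.pair 2 (Nat.pair v.code K.code)
  | cond _ N ρ K =>
    Nat.pair 3 (Nat.pair (listCode (List.ofFn fun i => (N i).code)) (Nat.pair ρ.code K.code))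
  | recu _ N ρ K =>
    Nat.pair 4 (Nat.pair (listCode (List.ofFn fun i => (N i).code)) (Nat.pair ρ.code K.code))
  | recArg x _ N ρ K =>
    Nat.pair 5 (Nat.pair x.code
      (Nat.pair (listCode (List.ofFn fun i => (N i).code)) (Nat.pair ρ.code K.code)))

end MCont

end HRec

namespace HRec

variable {F : Family}

/-- States of the machine: evaluation of a term in an environment, return of a value, call of a branch
with the arguments of a value, and unfolding of a recursion. -/
inductive MState (F : Family) : Type
  | eval (P : Tm F) (ρ : MVal F) (K : MCont F) : MState F
  | ret (v : MVal F) (K : MCont F) : MState F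
  | call (x : AVal F) (n : ℕ) (N : Fin n → Tm F) (ρ : MVal F) (K : MCont F) : MState F
  | unfold (x y : AVal F) (n : ℕ) (N : Fin n → Tm F) (ρ : MVal F) (K : MCont F) : MState F

namespace MState

/-- The term denoted by a state. -/
def toTm : MState F → Tm F
  | eval P ρ K => K.fill (Tm.inst ρ.env 0 P)
  | ret v K => K.fill v.toTm
  | call x _ N ρ K => K.fill (x.spine (branch N ρ) id)
  | unfold x y n N ρ K => K.fill (x.spine (fun _ => y.spine (branch N ρ) id)
      fun t => .recu t n fun i => Tm.inst ρ.env 0 (N i))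

/-- A bound for the number of machine steps that do not correspond to a reduction. -/
def cost : MState F → ℕ
  | eval P _ K => 4 * P.size - 2 + K.cost
  | ret _ K => 1 + K.cost
  | call x _ N _ K => x.cost (branchCost N) 4 + K.cost
  | unfold x y _ N _ K => x.cost (fun _ => y.cost (branchCost N) 4 + 1) 3 + K.cost

theorem cost_le (s : MState F) : s.cost ≤ 4 * s.toTm.size := by
  cases s with
  | eval P ρ K =>
    have h₁ := K.cost_le (Tm.inst ρ.env 0 P)
    have h₂ := Tm.size_le_size_inst ρ.env 0 P
    simp only [cost, toTm]
    omega
  | ret v K =>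
    have h₁ := K.cost_le v.toTm
    have h₂ := v.toTm.size_pos
    simp only [cost, toTm]
    omega
  | call x n N ρ K =>
    have h₁ := K.cost_le (x.spine (branch N ρ) id)
    have h₂ := AVal.cost_le le_rfl (branchCost_le N ρ) id x
    simp only [cost, toTm]
    omega
  | unfold x y n N ρ K =>
    have h₁ := K.cost_le (x.spine (fun _ => y.spine (branch N ρ) id)
      fun t => .recu t n fun i => Tm.inst ρ.env 0 (N i))
    have h₂ := AVal.cost_le (r := 3) (h := fun _ => y.cost (branchCost N) 4 + 1) (e := 0)
      (Nat.le_succ 3) (fun _ => AVal.cost_le le_rfl (branchCost_le N ρ) id y)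
      (fun t => .recu t n fun i => Tm.inst ρ.env 0 (N i)) x
    simp only [cost, toTm]
    omega

/-- The code of a state. -/
def code : MState F → ℕ
  | eval P ρ K => Nat.pair 0 (Nat.pair P.code (Nat.pair ρ.code K.code))
  | ret v K => Nat.pair 1 (Nat.pair v.code K.code)
  | call x _ N ρ K => Nat.pair 2 (Nat.pair x.code
      (Nat.pair (listCode (List.ofFn fun i => (N i).code)) (Nat.pair ρ.code K.code)))
  | unfold x y _ N ρ K => Nat.pair 3 (Nat.pair x.code (Nat.pair y.code
      (Nat.pair (listCode (List.ofFn fun i => (N i).code)) (Nat.pair ρ.code K.code))))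

end MState

namespace CodeExpr

/-- The transition from a state that evaluates a term. -/
def evalStep (P ρ K : CodeExpr) : CodeExpr :=
  .ite (.fst P) 0 (.pair (.num 1) (.pair (.nth (.snd P) ρ) K)) <|
  .ite (.fst P) 1 (.pair (.num 0) (.pair (.fst (.snd P)) (.pair ρ
    (.pair (.num 1) (.pair (.snd (.snd P)) (.pair ρ K)))))) <|
  .ite (.fst P) 2 (.pair (.num 1) (.pair (.pair (.num 0) (.pair (.num 0) (.snd P))) K)) <|
  .ite (.fst P) 3 (.pair (.num 1) (.pair (.pair (.num 1) (.pair (.snd P) ρ)) K)) <|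
  .ite (.fst P) 4 (.pair (.num 0) (.pair (.fst (.snd P)) (.pair ρ
    (.pair (.num 3) (.pair (.snd (.snd P)) (.pair ρ K)))))) <|
  .pair (.num 0) (.pair (.fst (.snd P)) (.pair ρ
    (.pair (.num 4) (.pair (.snd (.snd P)) (.pair ρ K)))))

/-- The transition from a state that returns a value. -/
def retStep (v K : CodeExpr) : CodeExpr :=
  .ite (.fst K) 0 .var <|
  .ite (.fst K) 1 (.pair (.num 0) (.pair (.fst (.snd K)) (.pair (.fst (.snd (.snd K)))
    (.pair (.num 2) (.pair v (.snd (.snd (.snd K)))))))) <|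
  .ite (.fst K) 2 (.ite (.fst (.fst (.snd K))) 0
    (.pair (.num 1) (.pair (.pair (.num 0) (.pair (.num 1) (.pair (.snd (.fst (.snd K))) (.snd v))))
      (.snd (.snd K))))
    (.pair (.num 0) (.pair (.fst (.snd (.fst (.snd K))))
      (.pair (.pair v (.snd (.snd (.fst (.snd K))))) (.snd (.snd K)))))) <|
  .ite (.fst K) 3 (.pair (.num 2) (.pair (.snd v) (.snd K))) <|
  .ite (.fst K) 4 (.pair (.num 3) (.pair (.snd v) (.pair (.snd v) (.snd K)))) <|
  .pair (.num 1) (.pair (.pair (.num 0) (.fst (.snd K))) (.pair (.num 4)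
    (.pair (.fst (.snd (.snd K))) (.pair (.fst (.snd (.snd (.snd K))))
      (.pair (.num 2) (.pair v (.snd (.snd (.snd (.snd K))))))))))

/-- The transition from a state that calls a branch. -/
def callStep (x N ρ K : CodeExpr) : CodeExpr :=
  .ite (.fst x) 0 (.pair (.num 0) (.pair (.nth (.snd x) N) (.pair ρ K))) <|
  .pair (.num 2) (.pair (.fst (.snd x)) (.pair N (.pair ρ (.pair (.num 1)
    (.pair (.num (Nat.pair 0 0)) (.pair (.pair (.pair (.num 0) (.snd (.snd x))) (.num 0)) K))))))

/-- The transition from a state that unfolds a recursion. -/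
def unfoldStep (x y N ρ K : CodeExpr) : CodeExpr :=
  .ite (.fst x) 0 (.pair (.num 2) (.pair y (.pair N (.pair ρ K)))) <|
  .pair (.num 3) (.pair (.fst (.snd x)) (.pair y (.pair N (.pair ρ
    (.pair (.num 5) (.pair (.snd (.snd x)) (.pair N (.pair ρ K))))))))

/-- The transition function of the machine. -/
def machine : CodeExpr :=
  .ite (.fst .var) 0
    (evalStep (.fst (.snd .var)) (.fst (.snd (.snd .var))) (.snd (.snd (.snd .var)))) <|
  .ite (.fst .var) 1 (retStep (.fst (.snd .var)) (.snd (.snd .var))) <|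
  .ite (.fst .var) 2
    (callStep (.fst (.snd .var)) (.fst (.snd (.snd .var))) (.fst (.snd (.snd (.snd .var))))
      (.snd (.snd (.snd (.snd .var))))) <|
  unfoldStep (.fst (.snd .var)) (.fst (.snd (.snd .var))) (.fst (.snd (.snd (.snd .var))))
    (.fst (.snd (.snd (.snd (.snd .var))))) (.snd (.snd (.snd (.snd (.snd .var)))))

end CodeExpr

namespace MState

open CodeExpr

theorem eval_machine_ret_nil (v : MVal F) : machine.eval (ret v .nil).code = (ret v .nil).code := by
  simp [machine, CodeExpr.eval, retStep, code, MCont.code]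

theorem not_hasTy_fvar {Δ : List (Ty F)} {x : ℕ} {A : Ty F} :
    ¬ HasTy (fun _ => none) Δ (.fvar x) A := fun h => by cases h; contradiction

/-- Values of base type are made of constructors. -/
theorem exists_alg_of_hasTy {v : MVal F} {a : F.Alg} {n : ℕ}
    (h : HasTy (fun _ => none) [] v.toTm (.base a n)) : ∃ x, v = .alg x := by
  cases v with
  | alg x => exact ⟨x, rfl⟩
  | clo B ρ => cases h
  | nil => exact absurd h not_hasTy_fvar
  | cons v ρ => exact absurd h not_hasTy_fvar

theorem pos_of_hasTy {φ : ℕ → Option (Ty F)} (hφ : ∀ x, φ x = none) {L : Tm F} {a : F.Alg} {m : ℕ}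
    (h : HasTy φ [] L (.base a m)) : 0 < (F.alg a).numCons := by
  obtain ⟨⟨c, -⟩⟩ := h.inh hφ (by simp)
  exact c.pos

/-- A typed state is final or makes a step which either decreases the cost or is a reduction. -/
theorem progress (s : MState F) {A : Ty F} (h : HasTy (fun _ => none) [] s.toTm A) :
    (∃ v, s = ret v .nil) ∨ ∃ s' : MState F, machine.eval s.code = s'.code ∧
      (s'.toTm = s.toTm ∧ s'.cost < s.cost ∨ Step s.toTm s'.toTm) := by
  cases s with
  | eval P ρ K =>
    obtain ⟨B, hB⟩ := K.exists_hasTy h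
    right
    cases P with
    | bvar i =>
      rcases ρ.env_cases i with hi | ⟨v, hi, hv⟩
      · simp only [Tm.inst, Nat.not_lt_zero, if_false, Nat.sub_zero, hi] at hB
        exact absurd hB not_hasTy_fvar
      · refine ⟨ret v K, by simp [machine, CodeExpr.eval, evalStep, code, Tm.code, hv],
          Or.inl ⟨by simp [toTm, Tm.inst, hi], by simp [cost, Tm.size]⟩⟩
    | fvar x => exact absurd hB not_hasTy_fvar
    | con a c =>
      exact ⟨ret (.alg (.con a c)) K,
        by simp [machine, CodeExpr.eval, evalStep, code, Tm.code, MVal.code, AVal.code],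
        Or.inl ⟨rfl, by simp [cost, Tm.size]⟩⟩
    | app P Q =>
      refine ⟨eval P ρ (.arg Q ρ K),
        by simp [machine, CodeExpr.eval, evalStep, code, Tm.code, MCont.code],
        Or.inl ⟨rfl, ?_⟩⟩
      have h₁ := P.size_pos
      have h₂ := Q.size_pos
      simp only [cost, Tm.size, MCont.cost]
      omega
    | lam P =>
      refine ⟨ret (.clo P ρ) K,
        by simp [machine, CodeExpr.eval, evalStep, code, Tm.code, MVal.code], Or.inl ⟨rfl, ?_⟩⟩
      simp only [cost, Tm.size]
      omega
    | cond L n N =>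
      refine ⟨eval L ρ (.cond n N ρ K),
        by simp [machine, CodeExpr.eval, evalStep, code, Tm.code, MCont.code], Or.inl ⟨rfl, ?_⟩⟩
      -- The cost decreases only because there is at least one branch.
      have hn : 0 < n := by
        cases hB with
        | cond hn hL _ => exact hn ▸ pos_of_hasTy (fun _ => rfl) hL
      have h₁ := L.size_pos
      simp only [cost, Tm.size, MCont.cost]
      omega
    | recu L n N =>
      refine ⟨eval L ρ (.recu n N ρ K),
        by simp [machine, CodeExpr.eval, evalStep, code, Tm.code, MCont.code], Or.inl ⟨rfl, ?_⟩⟩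
      have hn : 0 < n := by
        cases hB with
        | recu hn hL _ => exact hn ▸ pos_of_hasTy (fun _ => rfl) hL
      have h₁ := L.size_pos
      simp only [cost, Tm.size, MCont.cost]
      omega
  | ret v K =>
    cases K with
    | nil => exact Or.inl ⟨v, rfl⟩
    | arg P ρ K =>
      refine Or.inr ⟨eval P ρ (.fn v K),
        by simp [machine, CodeExpr.eval, retStep, code, MCont.code], Or.inl ⟨rfl, ?_⟩⟩
      have h₁ := P.size_pos
      simp only [cost, MCont.cost]
      omega
    | fn f K =>
      obtain ⟨B, hB⟩ := K.exists_hasTy h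
      right
      cases f with
      | alg x =>
        cases hB with
        | app h₁ h₂ =>
          obtain ⟨a, n, rfl⟩ := h₁.exists_base_of_arr x.isAlg_toTm
          obtain ⟨y, rfl⟩ := exists_alg_of_hasTy h₂
          exact ⟨ret (.alg (.app x y)) K,
            by simp [machine, CodeExpr.eval, retStep, code, MCont.code, MVal.code, AVal.code],
            Or.inl ⟨rfl, by simp [cost, MCont.cost]⟩⟩
      | clo P ρ =>
        refine ⟨eval P (.cons v ρ) K,
          by simp [machine, CodeExpr.eval, retStep, code, MCont.code, MVal.code], Or.inr ?_⟩
        -- The abstraction denoted by the closure is contracted.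
        have := Step.beta (Tm.inst ρ.env 1 P) v.isValue_toTm
        rw [Tm.openAt_inst_succ ρ.openAt_decode.2] at this
        exact K.fill_step this
      | nil => cases hB with | app h₁ h₂ => exact absurd h₁ not_hasTy_fvar
      | cons => cases hB with | app h₁ h₂ => exact absurd h₁ not_hasTy_fvar
    | cond n N ρ K =>
      obtain ⟨B, hB⟩ := K.exists_hasTy h
      right
      cases hB with
      | cond hn hL hN =>
        obtain ⟨x, rfl⟩ := exists_alg_of_hasTy hL
        obtain ⟨⟨c, ts⟩, ht⟩ := HasTy.exists_toTm (M := x.toTm) hL x.isAlg_toTm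
        subst hn
        refine ⟨call x _ N ρ K,
          by simp [machine, CodeExpr.eval, retStep, code, MCont.code, MVal.code], Or.inr ?_⟩
        have := Step.cond c ts fun i => Tm.inst ρ.env 0 (N i)
        rw [← ht] at this
        -- Codes record only the index of a constructor; typing ensures that the head constructor
        -- belongs to the algebra of the conditional, so its index selects the right branch.
        have hs := x.spine_of_toTm_eq (branch N ρ) id ht
        rw [List.map_id, branch, dif_pos c.2] at hs
        rw [← hs] at this
        exact K.fill_step this
    | recu n N ρ K =>
      obtain ⟨B, hB⟩ := K.exists_hasTy h
      right
      cases hB with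
      | recu hn hL hN =>
        obtain ⟨x, rfl⟩ := exists_alg_of_hasTy hL
        obtain ⟨⟨c, ts⟩, ht⟩ := HasTy.exists_toTm (M := x.toTm) hL x.isAlg_toTm
        subst hn
        refine ⟨unfold x x _ N ρ K,
          by simp [machine, CodeExpr.eval, retStep, code, MCont.code, MVal.code], Or.inr ?_⟩
        have := Step.recu c ts fun i => Tm.inst ρ.env 0 (N i)
        rw [← ht] at this
        have hs := x.spine_of_toTm_eq (branch N ρ) id ht
        -- The value is traversed twice: the outer spine supplies the recursive calls on the
        -- subterms, the inner one the subterms themselves.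
        have hs' := x.spine_of_toTm_eq (fun _ => x.spine (branch N ρ) id)
          (fun t => Tm.recu t _ fun i => Tm.inst ρ.env 0 (N i)) ht
        rw [List.map_id, branch, dif_pos c.2] at hs
        refine K.fill_step (hs'.trans ?_ ▸ this)
        rw [hs, List.map_ofFn, Tm.apps_append]
        rfl
    | recArg x n N ρ K =>
      refine Or.inr ⟨ret (.alg x) (.recu n N ρ (.fn v K)),
        by simp [machine, CodeExpr.eval, retStep, code, MCont.code, MVal.code], Or.inl ⟨rfl, ?_⟩⟩
      simp only [cost, MCont.cost]
      omega
  | call x n N ρ K =>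
    right
    cases x with
    | con a c =>
      obtain ⟨B, hB⟩ := K.exists_hasTy h
      simp only [AVal.spine, branch] at hB
      split_ifs at hB with hc
      · refine ⟨eval (N ⟨c, hc⟩) ρ K, ?_, Or.inl ⟨?_, ?_⟩⟩
        · have := nthCode_listCode (l := List.ofFn fun i => (N i).code) (i := c) (by simpa using hc)
          simp [machine, CodeExpr.eval, callStep, code, AVal.code, this]
        · simp only [toTm, AVal.spine, branch, hc, dif_pos]
        · have := (N ⟨c, hc⟩).size_pos
          simp only [cost, AVal.cost, branchCost, hc, dif_pos]
          omega
      · exact absurd hB not_hasTy_fvar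
    | app x y =>
      -- An argument that is already a value is passed as index 0 in a one-element environment.
      -- Evaluating it accounts for 3, one less than the 4 charged per argument.
      refine ⟨call x n N ρ (.arg (.bvar 0) (.cons (.alg y) .nil) K),
        by simp [machine, CodeExpr.eval, callStep, code, AVal.code, MCont.code, MVal.code, Tm.code],
        Or.inl ⟨rfl, ?_⟩⟩
      simp only [cost, MCont.cost, AVal.cost, Tm.size]
      omega
  | unfold x y n N ρ K =>
    right
    cases x with
    | con a c =>
      refine ⟨call y n N ρ K,
        by simp [machine, CodeExpr.eval, unfoldStep, code, AVal.code],
        Or.inl ⟨rfl, ?_⟩⟩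
      simp only [cost, AVal.cost]
      omega
    | app x z =>
      -- The pending recursive call accounts for 2, one less than the 3 charged per argument.
      refine ⟨unfold x y n N ρ (.recArg z n N ρ K),
        by simp [machine, CodeExpr.eval, unfoldStep, code, AVal.code, MCont.code],
        Or.inl ⟨rfl, ?_⟩⟩
      simp only [cost, MCont.cost, AVal.cost]
      omega

end MState

end HRec

namespace HRec

variable {F : Family}

/-! ### Representable functions -/

/-- After `j` reductions at most `B - j` remain. Each makes one machine step, after which the cost
is at most 4 times the size of the term, hence at most `4 * B`. Final states are fixed points, so
running longer does no harm. -/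
theorem MState.exists_iterate_machine {M : Tm F} {B : ℕ}
    (hB : ∀ n N, Steps n M N → n ≤ B ∧ N.size ≤ B) (k : ℕ) (s : MState F) {A : Ty F} {j : ℕ}
    (h : HasTy (fun _ => none) [] s.toTm A) (hj : Steps j M s.toTm)
    (hk : (B - j) * (4 * B + 1) + s.cost ≤ k) :
    ∃ v n, Steps n M v.toTm ∧ CodeExpr.machine.eval^[k] s.code = (ret v .nil).code := by
  induction k generalizing s j with
  | zero =>
    rcases s.progress h with ⟨v, rfl⟩ | ⟨s', -, ⟨-, hs⟩ | hs⟩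
    · exact ⟨v, j, hj, rfl⟩
    · omega
    · have h₁ := (hB _ _ (hj.tail hs)).1
      have : 0 < (B - j) * (4 * B + 1) := Nat.mul_pos (by omega) (Nat.succ_pos _)
      omega
  | succ k ih =>
    rcases s.progress h with ⟨v, rfl⟩ | ⟨s', he, ⟨ht, hs⟩ | hs⟩
    · exact ⟨v, j, hj, Function.iterate_fixed (eval_machine_ret_nil v) _⟩
    · rw [Function.iterate_succ_apply, he]
      exact ih s' (ht ▸ h) (ht ▸ hj) (by omega)
    · rw [Function.iterate_succ_apply, he]
      refine ih s' (h.step hs) (hj.tail hs) ?_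
      obtain ⟨h₁, h₂⟩ := hB _ _ (hj.tail hs)
      have h₃ := s'.cost_le
      obtain ⟨i, rfl⟩ := Nat.exists_eq_add_of_le h₁
      have h₄ : j + 1 + i - (j + 1) = i := by omega
      have h₅ : j + 1 + i - j = i + 1 := by omega
      rw [h₅, Nat.succ_mul i] at hk
      rw [h₄]
      omega

theorem Steps.reflTransGen {n : ℕ} {M N : Tm F} (h : Steps n M N) :
    Relation.ReflTransGen Step M N := by
  induction h with
  | refl => exact .refl
  | tail _ hs ih => exact ih.tail hs

/-- The machine computes the value of a closed term. -/
theorem exists_value_of_steps_le {M : Tm F} {A : Ty F} {B : ℕ} (h : HasTy (fun _ => none) [] M A)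
    (hB : ∀ n N, Steps n M N → n ≤ B ∧ N.size ≤ B) :
    ∃ v : MVal F, Relation.ReflTransGen Step M v.toTm ∧
      CodeExpr.machine.eval^[(B + 1) * (4 * B + 1)] (MState.eval M .nil .nil).code =
        (MState.ret v .nil).code := by
  have ht : (MState.eval M .nil .nil).toTm = M := Tm.inst_of_hasTy h _ le_rfl
  have hc := (MState.eval M (.nil : MVal F) .nil).cost_le
  rw [ht] at hc
  have hs := (hB 0 M (.refl M)).2
  obtain ⟨v, n, hv, hr⟩ := MState.exists_iterate_machine hB ((B + 1) * (4 * B + 1))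
    (.eval M .nil .nil) (ht.symm ▸ h) (j := 0) (ht.symm ▸ .refl M) (by
      rw [Nat.sub_zero, Nat.succ_mul B]
      omega)
  exact ⟨v, hv.reflTransGen, hr⟩

/-- The codes of numerals, where `t` is the tag of constructors. -/
def numeralCode (t : ℕ) : ℕ → ℕ
  | 0 => Nat.pair t 1
  | n + 1 => Nat.pair 1 (Nat.pair (Nat.pair t 0) (numeralCode t n))

theorem primrec_numeralCode (t : ℕ) : Primrec (numeralCode t) := by
  refine (Primrec.nat_rec₁ (Nat.pair t 1) (f := fun _ c => Nat.pair 1 (Nat.pair (Nat.pair t 0) c))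
    (Primrec₂.natPair.comp (Primrec.const 1)
      (Primrec₂.natPair.comp (Primrec.const _) Primrec.snd))).of_eq fun n => ?_
  induction n with
  | zero => rfl
  | succ n ih => exact congrArg (fun c => Nat.pair 1 (Nat.pair (Nat.pair t 0) c)) ih

/-- This makes decoding a bounded search. -/
theorem le_numeralCode (t n : ℕ) : n ≤ numeralCode t n := by
  induction n with
  | zero => exact Nat.zero_le _
  | succ n ih =>
    have h₁ := Nat.add_le_pair 1 (Nat.pair (Nat.pair t 0) (numeralCode t n))
    have h₂ := Nat.right_le_pair (Nat.pair t 0) (numeralCode t n)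
    rw [numeralCode]
    omega

theorem numeralCode_zero_injective : Function.Injective (numeralCode 0) := by
  intro m n h
  induction m generalizing n with
  | zero =>
    cases n with
    | zero => rfl
    | succ n => exact absurd (Nat.pair_eq_pair.1 h).1 Nat.zero_ne_one
  | succ m ih =>
    cases n with
    | zero => exact absurd (Nat.pair_eq_pair.1 h).1 Nat.one_ne_zero
    | succ n => exact congrArg _ (ih (Nat.pair_eq_pair.1 (Nat.pair_eq_pair.1 h).2).2)

/-- The number denoted by the numeral with code `c`. -/
def decodeNumeral (c : ℕ) : ℕ := Nat.findGreatest (fun m => numeralCode 0 m = c) c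

theorem decodeNumeral_numeralCode (m : ℕ) : decodeNumeral (numeralCode 0 m) = m :=
  numeralCode_zero_injective
    (Nat.findGreatest_spec (P := fun k => numeralCode 0 k = numeralCode 0 m) (le_numeralCode 0 m) rfl)

theorem primrec_decodeNumeral : Primrec decodeNumeral :=
  Primrec.nat_findGreatest Primrec.id
    (PrimrecRel.comp Primrec.eq ((primrec_numeralCode 0).comp Primrec.snd) Primrec.fst)

section numeral

variable {u : F.Alg} (hu : F.alg u = unaryAlg)

theorem isAlg_numeral (n : ℕ) : (numeral hu n).IsAlg := by
  induction n with
  | zero => exact .con _ _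
  | succ n ih => exact .app (.con _ _) ih

theorem size_numeral (n : ℕ) : (numeral hu n).size = n + 1 := by
  induction n with
  | zero => rfl
  | succ n ih => rw [numeral, Tm.size, ih, Tm.size, Nat.add_comm]

theorem code_numeral (n : ℕ) : (numeral hu n).code = numeralCode 2 n := by
  induction n with
  | zero => rfl
  | succ n ih => rw [numeral, Tm.code, ih]; rfl

theorem AVal.code_of_toTm_eq_numeral {x : AVal F} {n : ℕ} (h : x.toTm = numeral hu n) :
    x.code = numeralCode 0 n := by
  induction n generalizing x with
  | zero =>
    cases x with
    | con a c =>
      obtain ⟨rfl, hc⟩ := Tm.con.inj h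
      obtain rfl := eq_of_heq hc
      rfl
    | app => cases h
  | succ n ih =>
    cases x with
    | con => cases h
    | app x y =>
      obtain ⟨h₁, h₂⟩ := Tm.app.inj h
      cases x with
      | con a c =>
        obtain ⟨rfl, hc⟩ := Tm.con.inj h₁
        obtain rfl := eq_of_heq hc
        rw [code, ih h₂]
        rfl
      | app => cases h₁

theorem MVal.code_of_toTm_eq_numeral {v : MVal F} {n : ℕ} (h : v.toTm = numeral hu n) :
    v.code = Nat.pair 0 (numeralCode 0 n) := by
  cases v with
  | alg x => exact congrArg _ (AVal.code_of_toTm_eq_numeral hu h)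
  | _ => cases n <;> cases h

theorem hasTy_numeral {φ : ℕ → Option (Ty F)} {Δ : List (Ty F)} (i n : ℕ) :
    HasTy φ Δ (numeral hu n) (.base u i) := by
  -- The arities 1 and 0 as a function of the index, in a form that needs no transport of
  -- constructors along `hu`.
  have har : ∀ c : F.Cons u, F.ar c = 1 - (c : ℕ) := by
    have : ∀ D : DataAlg, D = unaryAlg → ∀ c : Fin D.numCons, D.arity c = 1 - (c : ℕ) := by
      rintro _ rfl (c : Fin 2)
      fin_cases c <;> rfl
    exact this _ hu
  have hc := fun c : F.Cons u => HasTy.con (φ := φ) (Δ := Δ) u c i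
  induction n with
  | zero =>
    have := hc ⟨1, by simp [hu, unaryAlg]⟩
    rw [har] at this
    exact this
  | succ n ih =>
    have := hc ⟨0, by simp [hu, unaryAlg]⟩
    rw [har] at this
    exact this.app ih

theorem hasTy_apps_numeral {φ : ℕ → Option (Ty F)} {Δ : List (Ty F)} {l : List ℕ} {Ts : List (Ty F)}
    (hl : l.length = Ts.length) (hT : ∀ T ∈ Ts, ∃ i, T = .base u i) {M : Tm F} {A : Ty F}
    (h : HasTy φ Δ M (Ts.foldr .arr A)) : HasTy φ Δ (M.apps (l.map (numeral hu))) A := by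
  induction l generalizing M Ts with
  | nil =>
    obtain rfl := List.length_eq_zero_iff.1 hl.symm
    exact h
  | cons n l ih =>
    cases Ts with
    | nil => cases hl
    | cons T Ts =>
      obtain ⟨⟨i, rfl⟩, hT'⟩ := List.forall_mem_cons.1 hT
      exact ih (Nat.succ.inj hl) hT' (HasTy.app h (hasTy_numeral hu i n))

theorem rank_apps_numeral (M : Tm F) (l : List ℕ) :
    (M.apps (l.map (numeral hu))).rank = M.rank := by
  induction l generalizing M with
  | nil => rfl
  | cons n l ih =>
    rw [List.map_cons, Tm.apps_cons, ih, Tm.rank, (isAlg_numeral hu n).rank_eq_zero, Nat.max_zero]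

theorem size_apps_numeral (M : Tm F) (l : List ℕ) :
    (M.apps (l.map (numeral hu))).size = l.foldl (fun s n => s + (n + 1)) M.size := by
  induction l generalizing M with
  | nil => rfl
  | cons n l ih => rw [List.map_cons, Tm.apps_cons, ih, Tm.size, size_numeral, List.foldl_cons]

theorem code_apps_numeral (M : Tm F) (l : List ℕ) :
    (M.apps (l.map (numeral hu))).code =
      l.foldl (fun c n => Nat.pair 1 (Nat.pair c (numeralCode 2 n))) M.code := by
  induction l generalizing M with
  | nil => rfl
  | cons n l ih => rw [List.map_cons, Tm.apps_cons, ih, Tm.code, code_numeral, List.foldl_cons]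

/-- With `M` fixed, the size and the code of its application to numerals are folds over the
arguments. The bound on the running time, the final state and the decoded numeral are therefore
primitive recursive in the arguments. -/
theorem primrec'_of_represents {k : ℕ} {f : List.Vector ℕ k → ℕ} {M : Tm F}
    (h : Represents hu (baseTypes F) M f) : Nat.Primrec' f := by
  obtain ⟨⟨i, j, ⟨π⟩⟩, hf⟩ := h
  -- Numerals have rank zero, so one bound serves for all arguments.
  obtain ⟨q, hq, -, hb⟩ := exists_primrec_steps_le F M.rank
  let B : List.Vector ℕ k → ℕ := fun v => q (v.toList.foldl (fun s n => s + (n + 1)) M.size)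
  -- The code of the initial state: tag 0 for evaluation, the term, the empty environment 0 and the
  -- empty continuation `Nat.pair 0 0`.
  let c : List.Vector ℕ k → ℕ := fun v => Nat.pair 0 (Nat.pair
    (v.toList.foldl (fun c n => Nat.pair 1 (Nat.pair c (numeralCode 2 n))) M.code)
    (Nat.pair 0 (Nat.pair 0 0)))
  have hB : Primrec B := hq.comp (Primrec.list_foldl Primrec.vector_toList (Primrec.const _)
    (Primrec.nat_add.comp (Primrec.fst.comp Primrec.snd)
      (Primrec.succ.comp (Primrec.snd.comp Primrec.snd))).to₂)
  have hc : Primrec c := Primrec₂.natPair.comp (Primrec.const 0) (Primrec₂.natPair.comp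
    (Primrec.list_foldl Primrec.vector_toList (Primrec.const _)
      (Primrec₂.natPair.comp (Primrec.const 1)
        (Primrec₂.natPair.comp (Primrec.fst.comp Primrec.snd)
          ((primrec_numeralCode 2).comp (Primrec.snd.comp Primrec.snd)))).to₂)
    (Primrec.const _))
  have hr : Primrec fun v => CodeExpr.machine.eval^[(B v + 1) * (4 * B v + 1)] (c v) :=
    Primrec.nat_iterate (Primrec.nat_mul.comp (Primrec.succ.comp hB)
        (Primrec.succ.comp (Primrec.nat_mul.comp (Primrec.const 4) hB))) hc
      (CodeExpr.primrec_eval CodeExpr.machine |>.comp₂ Primrec₂.right)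
  -- The projections extract the constructor value from the code of a final state, dropping the tags
  -- of the state and of the value and the empty continuation.
  refine Nat.Primrec'.of_prim ((primrec_decodeNumeral.comp ((CodeExpr.primrec_eval
    (.snd (.fst (.snd .var)))).comp hr)).of_eq fun v => ?_)
  have hM : HasTy (fun _ => none) [] (M.apps (v.toList.map (numeral hu))) (.base u j) :=
    hasTy_apps_numeral hu (Ts := List.ofFn fun l => .base u (i l)) (by simp)
      (fun T hT => by
        obtain ⟨l, rfl⟩ := List.mem_ofFn.1 hT
        exact ⟨i l, rfl⟩)
      (π.hasTy fun p hp => absurd hp (Multiset.notMem_zero p))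
  obtain ⟨w, hw, he⟩ := exists_value_of_steps_le (B := B v) hM fun n N hN => by
    have := hb _ _ _ hM (rank_apps_numeral hu M v.toList).le n N hN
    rwa [size_apps_numeral] at this
  have hw' := Step.eq_of_normal hw (hf v) (fun _ => w.isValue_toTm.not_step)
    fun _ => (isAlg_numeral hu _).not_step
  have hc' : c v = (MState.eval (M.apps (v.toList.map (numeral hu))) .nil .nil).code := by
    rw [MState.code, code_apps_numeral]
    rfl
  rw [hc', he, MState.code, MVal.code_of_toTm_eq_numeral hu hw']
  simp [CodeExpr.eval, decodeNumeral_numeralCode]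

end numeral

end HRec

theorem mainTheorem4 (F : HRec.Family) :
    (∀ d : ℕ, ∃ p : ℕ → ℕ, Nat.Primrec p ∧
      ∀ (Γ : HRec.Ctx F) (M : HRec.Tm F) (A : HRec.Ty F)
        (π : HRec.Der (HRec.baseTypes F) Γ M A), π.Standard → π.depth = d →
        ∀ T : HRec.CTree F π.graph.Vert π.graph.Edge, HRec.InT π.graph T →
          T.val.2.size ≤ p M.size) ∧
    (∀ d : ℕ, ∃ q : ℕ → ℕ, Nat.Primrec q ∧
      ∀ (Γ : HRec.Ctx F) (M : HRec.Tm F) (A : HRec.Ty F)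
        (π : HRec.Der (HRec.baseTypes F) Γ M A), π.Standard → π.depth = d →
        ∀ (n : ℕ) (N : HRec.Tm F), HRec.Steps n M N → n ≤ q M.size ∧ N.size ≤ q M.size) ∧
    (∀ (u : F.Alg) (hu : F.alg u = HRec.unaryAlg) (k : ℕ) (f : List.Vector ℕ k → ℕ),
      (∃ M : HRec.Tm F, HRec.Represents hu (HRec.baseTypes F) M f) → Nat.Primrec' f) := by
  refine ⟨fun d => ?_, fun d => ?_, ?_⟩
  · obtain ⟨p, hp, hb⟩ := HRec.exists_primrec_inT_size F d
    exact ⟨p, hp, fun Γ M A π _ hd T hT => hb Γ M A π hd T hT⟩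
  · obtain ⟨q, hq, hb⟩ := HRec.exists_primrec_normalization F d
    exact ⟨q, hq, fun Γ M A π _ hd n N hN => hb Γ M A π hd n N hN⟩
  · rintro u hu k f ⟨M, hM⟩
    exact HRec.primrec'_of_represents hu hM
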